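/- Let $k$ be a field, $V$ a finite-dimensional $k$-vector space placed in degree $1$, $V^{(n)}=V^{\otimes n}$ for $n \ge 0$ (and $V^{(n)}=0$ for $n<0$), $S$ a finite set of integers $\geq 2$, and $R=\bigoplus_{s\in S}R_s$ with $R_s\subseteq V^{(s)}$ subspaces satisfying the minimality condition $$R_s\cap\sum_{t\in S,\,t<s}\ \sum_{j=0}^{s-t}V^{(j)}\otimes R_t\otimes V^{(s-t-j)}=0\qquad(s\in S).$$ Let $A=T(V)/\langle R\rangle$ be the corresponding $S$-multi-homogeneous algebra, graded by tensor length, with $A_{>0}=\bigoplus_{n>0}A_n$ and trivial module $k=A/A_{>0}$. Put $n_s(2l)=sl$ and $n_s(2l+1)=sl+1$; put $J_0=k$, $J_1=V$ and, for $i\ge2$, $J_i=\bigoplus_{s\in S}J_i^s$ with $$J_i^s=\bigcap_{j=0}^{n_s(i)-s}V^{(j)}\otimes R_s\otimes V^{(n_s(i)-s-j)}\subseteq V^{(n_s(i))},$$ graded by tensor length. The left multi-Koszul complex is $$\cdots\to A\otimes J_i\xrightarrow{\delta_i}A\otimes J_{i-1}\to\cdots\to A\otimes V\xrightarrow{\delta_1}A\to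 k\to0,$$ where $\delta_1$ is multiplication, and for $i\ge2$ the map $\delta_i$ on $A\otimes J_i^s$ is the restriction of $$\alpha\otimes v_1\cdots v_{n_s(i)}\mapsto\alpha v_1\cdots v_{a}\otimes v_{a+1}\cdots v_{n_s(i)},\qquad a=n_s(i)-n_s(i-1)$$ (so $a=s-1$ for $i$ even and $a=1$ for $i$ odd). The algebra $A$ is called left multi-Koszul if this complex is a projective resolution of the left module $k$. Symmetrically, the right multi-Koszul complex has terms $J_i\otimes A$, with differential moving the last $n_s(i)-n_s(i-1)$ letters of a word of $J_i^s$ into $A$ (multiplying from the left), and $A$ is right multi-Koszul if it is a projective resolution of the right module $k$. Let $\mathrm{Tor}_i^A(k,k)=H_i(k\otimes_A P_\bullet)$, with its internal $\mathbb{Z}$-grading, where $P_\bullet\to k$ is a projective resolution of the trivial left $A$-module $k$ by $\mathbb{Z}$-graded $A$-modules. Then such resolutions exist, and, whichever one is used: (1) $A$ is left multi-Koszul if and only if for every $i\ge0$ there is an isomorphism of graded vector spaces $\mathrm{Tor}_i^A(k,k)\cong J_i$; (2) $A$ is right multi-Koszul if and only if for every $i\ge0$ there is an isomorphism of graded vector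 spaces $\mathrm{Tor}_i^A(k,k)\cong J_i$. -/

import Mathlib

open scoped TensorProduct

universe u v w

noncomputable section

namespace MultiKoszul

section TensorPowers

variable (k : Type u) [Field k] (V : Type v) [AddCommGroup V] [Module k V]

/-- The tensor power `V^(n)` for `n : ℕ`, as the degree `n` part of the tensor algebra `T(V)`. -/
abbrev tpow (n : ℕ) : Submodule k (TensorAlgebra k V) :=
  LinearMap.range (TensorAlgebra.ι k : V →ₗ[k] TensorAlgebra k V) ^ n

/-- The tensor power `V^(n)` for `n : ℤ`, with the convention `V^(n) = 0` for `n < 0`. -/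
def tpowInt : ℤ → Submodule k (TensorAlgebra k V)
  | Int.ofNat n => tpow k V n
  | Int.negSucc _ => ⊥

/-- The projection of `T(V)` onto its degree `n` part. -/
def projDeg (n : ℕ) : TensorAlgebra k V →ₗ[k] TensorAlgebra k V :=
  GradedAlgebra.proj (tpow k V) n

/-- Auxiliary action of `v ∈ V` on `T(V) × (V ⊗ T(V))`: `(w, z) ↦ (v w, v ⊗ w)`. -/
def splitLeftAux :
    V →ₗ[k] Module.End k (TensorAlgebra k V × (V ⊗[k] TensorAlgebra k V)) where
  toFun v := ((LinearMap.mulLeft k (TensorAlgebra.ι k v)).prod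
    (TensorProduct.mk k V (TensorAlgebra k V) v)) ∘ₗ LinearMap.fst k _ _
  map_add' v v' := by
    refine LinearMap.ext fun x => Prod.ext ?_ ?_ <;> simp [add_mul]
  map_smul' c v := by
    refine LinearMap.ext fun x => Prod.ext ?_ ?_ <;> simp

/-- Splitting off the first letter: `v₁ v₂ ⋯ vₙ ↦ v₁ ⊗ v₂ ⋯ vₙ`, and `1 ↦ 0`. -/
def splitLeft : TensorAlgebra k V →ₗ[k] V ⊗[k] TensorAlgebra k V :=
  LinearMap.snd k _ _ ∘ₗ LinearMap.applyₗ ((1, 0) : TensorAlgebra k V × (V ⊗[k] TensorAlgebra k V))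
    ∘ₗ (TensorAlgebra.lift k (splitLeftAux k V)).toLinearMap

/-- Auxiliary action of `v ∈ V` on `T(V) × (T(V) ⊗ V)`: `(w, z) ↦ (w v, w ⊗ v)`. -/
def splitRightAux :
    V →ₗ[k] (Module.End k (TensorAlgebra k V × (TensorAlgebra k V ⊗[k] V)))ᵐᵒᵖ where
  toFun v := MulOpposite.op (((LinearMap.mulRight k (TensorAlgebra.ι k v)).prod
    ((TensorProduct.mk k (TensorAlgebra k V) V).flip v)) ∘ₗ LinearMap.fst k _ _)
  map_add' v v' := by
    rw [← MulOpposite.op_add]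
    congr 1
    refine LinearMap.ext fun x => Prod.ext ?_ ?_ <;> simp [mul_add]
  map_smul' c v := by
    rw [RingHom.id_apply, ← MulOpposite.op_smul]
    congr 1
    refine LinearMap.ext fun x => Prod.ext ?_ ?_ <;> simp

/-- Splitting off the last letter: `v₁ ⋯ vₙ₋₁ vₙ ↦ v₁ ⋯ vₙ₋₁ ⊗ vₙ`, and `1 ↦ 0`. -/
def splitRight : TensorAlgebra k V →ₗ[k] TensorAlgebra k V ⊗[k] V :=
  LinearMap.snd k _ _ ∘ₗ LinearMap.applyₗ ((1, 0) : TensorAlgebra k V × (TensorAlgebra k V ⊗[k] V))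
    ∘ₗ (MulOpposite.opLinearEquiv k).symm.toLinearMap
    ∘ₗ (TensorAlgebra.lift k (splitRightAux k V)).toLinearMap

theorem splitLeft_one : splitLeft k V 1 = 0 := by
  simp [splitLeft]

theorem splitRight_one : splitRight k V 1 = 0 := by
  simp [splitRight]

theorem splitLeft_ι_mul (v : V) (x : TensorAlgebra k V) :
    splitLeft k V (TensorAlgebra.ι k v * x) = v ⊗ₜ[k] x := by
  have key : ∀ x : TensorAlgebra k V, ∀ p : TensorAlgebra k V × (V ⊗[k] TensorAlgebra k V),
      (TensorAlgebra.lift k (splitLeftAux k V) x p).1 = x * p.1 := by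
    intro x
    induction x using TensorAlgebra.induction with
    | algebraMap r => intro p; simp [Algebra.smul_def]
    | ι v => intro p; simp [splitLeftAux]
    | mul a b ha hb => intro p; simp [ha, hb, mul_assoc]
    | add a b ha hb => intro p; simp [ha, hb, add_mul]
  have h := key x (1, 0)
  simp only [mul_one] at h
  have e : splitLeft k V (TensorAlgebra.ι k v * x) =
      v ⊗ₜ[k] (TensorAlgebra.lift k (splitLeftAux k V) x (1, 0)).1 := by
    simp only [splitLeft, LinearMap.comp_apply, AlgHom.toLinearMap_apply, map_mul,
      TensorAlgebra.lift_ι_apply]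
    rfl
  rw [e, h]

theorem splitRight_mul_ι (x : TensorAlgebra k V) (v : V) :
    splitRight k V (x * TensorAlgebra.ι k v) = x ⊗ₜ[k] v := by
  have key : ∀ x : TensorAlgebra k V, ∀ p : TensorAlgebra k V × (TensorAlgebra k V ⊗[k] V),
      ((TensorAlgebra.lift k (splitRightAux k V) x).unop p).1 = p.1 * x := by
    intro x
    induction x using TensorAlgebra.induction with
    | algebraMap r =>
      intro p
      rw [AlgHom.commutes, MulOpposite.algebraMap_apply, MulOpposite.unop_op]
      simp [Algebra.smul_def, Algebra.commutes]
    | ι v => intro p; simp [splitRightAux]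
    | mul a b ha hb => intro p; simp [ha, hb, mul_assoc]
    | add a b ha hb => intro p; simp [ha, hb, mul_add]
  have h := key x (1, 0)
  simp only [one_mul] at h
  have e : splitRight k V (x * TensorAlgebra.ι k v) =
      ((TensorAlgebra.lift k (splitRightAux k V) x).unop (1, 0)).1 ⊗ₜ[k] v := by
    simp only [splitRight, LinearMap.comp_apply, AlgHom.toLinearMap_apply, map_mul,
      TensorAlgebra.lift_ι_apply]
    rfl
  rw [e, h]

end TensorPowers

/-! ### Graded projective resolutions and graded Tor groups -/

section Tor

variable {k : Type u} [Field k] {A : Type v} [Ring A] [Algebra k A]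

/-- A projective resolution `⋯ → P 1 → P 0 → k → 0` of the trivial left module `k = A / A_{>0}`
by `ℤ`-graded left modules over a graded `k`-algebra `A = ⨁ 𝒜 n` with augmentation `ε`. -/
structure GradedProjectiveResolution (𝒜 : ℕ → Submodule k A) (ε : A →ₐ[k] k) where
  P : ℕ → Type w
  [addCommGroup : ∀ i, AddCommGroup (P i)]
  [moduleBase : ∀ i, Module k (P i)]
  [moduleAlg : ∀ i, Module A (P i)]
  [isScalarTower : ∀ i, IsScalarTower k A (P i)]
  /-- `deg i n` is the homogeneous component of degree `n` of `P i`. -/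
  deg : ∀ i, ℤ → Submodule k (P i)
  isInternal : ∀ i, DirectSum.IsInternal (deg i)
  smul_mem : ∀ i (m : ℕ) (n : ℤ) (a : A) (x : P i),
    a ∈ 𝒜 m → x ∈ deg i n → a • x ∈ deg i (m + n)
  projective : ∀ i, Module.Projective A (P i)
  d : ∀ i, P (i + 1) →ₗ[A] P i
  d_mem : ∀ i n x, x ∈ deg (i + 1) n → d i x ∈ deg i n
  aug : P 0 →ₗ[k] k
  aug_smul : ∀ (a : A) (x : P 0), aug (a • x) = ε a * aug x
  aug_eq_zero : ∀ n x, x ∈ deg 0 n → n ≠ 0 → aug x = 0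
  aug_surjective : Function.Surjective aug
  exact_zero : ∀ x, aug x = 0 ↔ ∃ y, d 0 y = x
  exact_succ : ∀ i x, d i x = 0 ↔ ∃ y, d (i + 1) y = x

namespace GradedProjectiveResolution

attribute [instance] addCommGroup moduleBase moduleAlg isScalarTower

variable {𝒜 : ℕ → Submodule k A} {ε : A →ₐ[k] k} (Q : GradedProjectiveResolution.{u, v, w} 𝒜 ε)

/-- The subspace `A_{>0} P_i`, so that `k ⊗_A P_i = P_i / A_{>0} P_i` (with `A_{>0} = ker ε`). -/
def augPart (i : ℕ) : Submodule k (Q.P i) :=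
  Submodule.span k {y | ∃ (a : A) (x : Q.P i), ε a = 0 ∧ a • x = y}

/-- The preimage in `P_i` of the `i`-cycles of the complex `k ⊗_A P`. -/
def cycles : ∀ i, Submodule k (Q.P i)
  | 0 => ⊤
  | i + 1 => (Q.augPart i).comap ((Q.d i).restrictScalars k)

/-- The preimage in `P_i` of the `i`-boundaries of the complex `k ⊗_A P`. -/
def boundaries (i : ℕ) : Submodule k (Q.P i) :=
  Q.augPart i ⊔ LinearMap.range ((Q.d i).restrictScalars k)

/-- The degree `n` component of `Tor_i^A(k, k) = H_i(k ⊗_A P)`, i.e. homogeneous cycles of degree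
`n` modulo homogeneous boundaries of degree `n`. -/
abbrev Tor (i : ℕ) (n : ℤ) : Type w :=
  ↥(Q.deg i n ⊓ Q.cycles i) ⧸ (Q.boundaries i).comap (Q.deg i n ⊓ Q.cycles i).subtype

end GradedProjectiveResolution

end Tor

/-! ### Multi-homogeneous algebras -/

/-- A minimal space of homogeneous relations `R = ⨁_{s ∈ S} R_s`, `R_s ⊆ V^(s)`, where `S` is a
finite set of integers `≥ 2`. The values `R s` with `s ∉ S` play no role. -/
structure MultiHomogeneous (k : Type u) [Field k] (V : Type v) [AddCommGroup V] [Module k V] where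
  S : Finset ℕ
  two_le : ∀ s ∈ S, 2 ≤ s
  R : ℕ → Submodule k (TensorAlgebra k V)
  R_le : ∀ s ∈ S, R s ≤ tpow k V s
  /-- Minimality: `R_s` meets the degree `s` part of the ideal generated by the `R_t`, `t < s`,
  only in `0`. -/
  minimal : ∀ s ∈ S, Disjoint (R s)
    (⨆ t ∈ S.filter (fun t => t < s), ⨆ j ∈ Finset.range (s - t + 1),
      tpow k V j * R t * tpow k V (s - t - j))

namespace MultiHomogeneous

variable {k : Type u} [Field k] {V : Type v} [AddCommGroup V] [Module k V]
  (D : MultiHomogeneous k V)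

/-- The two-sided ideal of `T(V)` generated by the relations. -/
def ideal : Ideal (TensorAlgebra k V) :=
  (TwoSidedIdeal.span {x : TensorAlgebra k V | ∃ s ∈ D.S, x ∈ D.R s}).asIdeal

instance : D.ideal.IsTwoSided := by
  unfold ideal
  infer_instance

/-- The `S`-multi-homogeneous algebra `A = T(V) / ⟨R⟩`. -/
abbrev Alg : Type (max u v) := TensorAlgebra k V ⧸ D.ideal

/-- The quotient map `T(V) → A`. -/
def quot : TensorAlgebra k V →ₐ[k] D.Alg := Ideal.Quotient.mkₐ k D.ideal

/-- The homogeneous component `A_n`. -/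
def grading (n : ℕ) : Submodule k D.Alg := (tpow k V n).map D.quot.toLinearMap

theorem algebraMapInv_eq_zero {n : ℕ} (hn : n ≠ 0) {x : TensorAlgebra k V}
    (hx : x ∈ tpow k V n) : TensorAlgebra.algebraMapInv x = 0 := by
  have h : tpow k V n ≤
      LinearMap.ker (TensorAlgebra.algebraMapInv (R := k) (M := V)).toLinearMap := by
    obtain ⟨m, rfl⟩ := Nat.exists_eq_succ_of_ne_zero hn
    rw [tpow, pow_succ, Submodule.mul_le]
    rintro a - _ ⟨v, rfl⟩
    simp [TensorAlgebra.algebraMapInv]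
  exact h hx

theorem algebraMapInv_ideal (x : TensorAlgebra k V) (hx : x ∈ D.ideal) :
    TensorAlgebra.algebraMapInv x = 0 := by
  have h : TwoSidedIdeal.span {x : TensorAlgebra k V | ∃ s ∈ D.S, x ∈ D.R s} ≤
      TwoSidedIdeal.ker (TensorAlgebra.algebraMapInv (R := k) (M := V)) := by
    rw [TwoSidedIdeal.span_le]
    rintro y ⟨s, hs, hy⟩
    have h2 := D.two_le s hs
    exact (TwoSidedIdeal.mem_ker _).2 (algebraMapInv_eq_zero (by omega) (D.R_le s hs hy))
  exact (TwoSidedIdeal.mem_ker _).1 (h (TwoSidedIdeal.mem_asIdeal.1 hx))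

/-- The augmentation `A → k`, with kernel `A_{>0}`. -/
def aug : D.Alg →ₐ[k] k :=
  Ideal.Quotient.liftₐ D.ideal TensorAlgebra.algebraMapInv D.algebraMapInv_ideal

/-- `n_s(2l) = s l` and `n_s(2l+1) = s l + 1`. -/
def nInd (s i : ℕ) : ℕ := s * (i / 2) + i % 2

/-- `J_i^s = ⋂_{j=0}^{n_s(i)-s} V^(j) ⊗ R_s ⊗ V^(n_s(i)-s-j)` (used for `i ≥ 2`), inside `T(V)`. -/
def Jcomp (s i : ℕ) : Submodule k (TensorAlgebra k V) :=
  ⨅ j ∈ Finset.range (nInd s i - s + 1),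
    tpow k V j * D.R s * tpow k V (nInd s i - s - j)

/-- `J_0 = k`, `J_1 = V` and `J_i = ⨁_{s ∈ S} J_i^s` for `i ≥ 2`. Since `J_i^s` lies in degree
`n_s(i)` and these degrees are distinct for distinct `s`, the sum inside `T(V)` is direct. -/
def J : ℕ → Submodule k (TensorAlgebra k V)
  | 0 => tpow k V 0
  | 1 => tpow k V 1
  | i + 2 => ⨆ s ∈ D.S, D.Jcomp s (i + 2)

/-- The homogeneous component of degree `n` of the graded vector space `J_i`. -/
def Jdeg (i : ℕ) (n : ℤ) : Submodule k (TensorAlgebra k V) := D.J i ⊓ tpowInt k V n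

/-- The number of letters moved into `A` by the differential in homological degree `i` on the
component indexed by `s`, namely `n_s(i) - n_s(i-1)`. -/
def jump (s i : ℕ) : ℕ := if Even i then s - 1 else 1

/-! #### The left complex -/

/-- `A ⊗ T(V) → A ⊗ T(V)`, `α ⊗ v₁ v₂ ⋯ vₙ ↦ α v₁ ⊗ v₂ ⋯ vₙ` and `α ⊗ 1 ↦ 0`. -/
def shiftL : D.Alg ⊗[k] TensorAlgebra k V →ₗ[k] D.Alg ⊗[k] TensorAlgebra k V :=
  (LinearMap.mul' k D.Alg ∘ₗ (D.quot.toLinearMap ∘ₗ TensorAlgebra.ι k).lTensor D.Alg).rTensor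
      (TensorAlgebra k V)
    ∘ₗ (TensorProduct.assoc k D.Alg V (TensorAlgebra k V)).symm.toLinearMap
    ∘ₗ (splitLeft k V).lTensor D.Alg

/-- `K(A)_i = A ⊗ J_i`, as a subspace of `A ⊗ T(V)`. -/
def KL (i : ℕ) : Submodule k (D.Alg ⊗[k] TensorAlgebra k V) :=
  LinearMap.range ((D.J i).subtype.lTensor D.Alg)

/-- The differential `δ_i` for `i ≥ 1`: `δ_1` is `α ⊗ v ↦ α v ⊗ 1`, and for `i ≥ 2`, on words of
length `n_s(i)`, the first `n_s(i) - n_s(i-1)` letters are multiplied into `A`.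
(The value at `i = 0` is not used.) -/
def deltaL : ℕ → (D.Alg ⊗[k] TensorAlgebra k V →ₗ[k] D.Alg ⊗[k] TensorAlgebra k V)
  | 0 => 0
  | 1 => D.shiftL
  | i + 2 => ∑ s ∈ D.S,
      (D.shiftL ^ jump s (i + 2)) ∘ₗ (projDeg k V (nInd s (i + 2))).lTensor D.Alg

/-- The augmentation `δ_0 : K(A)_0 = A ⊗ k → k`. -/
def augL : D.Alg ⊗[k] TensorAlgebra k V →ₗ[k] k :=
  LinearMap.mul' k k ∘ₗ TensorProduct.map D.aug.toLinearMap
    (TensorAlgebra.algebraMapInv (R := k) (M := V)).toLinearMap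

/-- `A` is left multi-Koszul: the augmented complex `⋯ → A ⊗ J_2 → A ⊗ V → A → k → 0` of free left
modules is exact, i.e. it is a projective resolution of `k`. -/
def IsLeftMultiKoszul : Prop :=
  (D.KL 0).map D.augL = ⊤ ∧
  D.KL 0 ⊓ LinearMap.ker D.augL = (D.KL 1).map (D.deltaL 1) ∧
  ∀ i, 1 ≤ i → D.KL i ⊓ LinearMap.ker (D.deltaL i) = (D.KL (i + 1)).map (D.deltaL (i + 1))

/-! #### The right complex -/

/-- `T(V) ⊗ A → T(V) ⊗ A`, `vₙ ⋯ v₂ v₁ ⊗ α ↦ vₙ ⋯ v₂ ⊗ v₁ α` and `1 ⊗ α ↦ 0`. -/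
def shiftR : TensorAlgebra k V ⊗[k] D.Alg →ₗ[k] TensorAlgebra k V ⊗[k] D.Alg :=
  (LinearMap.mul' k D.Alg ∘ₗ (D.quot.toLinearMap ∘ₗ TensorAlgebra.ι k).rTensor D.Alg).lTensor
      (TensorAlgebra k V)
    ∘ₗ (TensorProduct.assoc k (TensorAlgebra k V) V D.Alg).toLinearMap
    ∘ₗ (splitRight k V).rTensor D.Alg

/-- `K(A)'_i = J_i ⊗ A`, as a subspace of `T(V) ⊗ A`. -/
def KR (i : ℕ) : Submodule k (TensorAlgebra k V ⊗[k] D.Alg) :=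
  LinearMap.range ((D.J i).subtype.rTensor D.Alg)

/-- The differential `δ'_i` for `i ≥ 1`: `δ'_1` is `v ⊗ α ↦ 1 ⊗ v α`, and for `i ≥ 2`, on words of
length `n_s(i)`, the last `n_s(i) - n_s(i-1)` letters are multiplied into `A`.
(The value at `i = 0` is not used.) -/
def deltaR : ℕ → (TensorAlgebra k V ⊗[k] D.Alg →ₗ[k] TensorAlgebra k V ⊗[k] D.Alg)
  | 0 => 0
  | 1 => D.shiftR
  | i + 2 => ∑ s ∈ D.S,
      (D.shiftR ^ jump s (i + 2)) ∘ₗ (projDeg k V (nInd s (i + 2))).rTensor D.Alg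

/-- The augmentation `δ'_0 : K(A)'_0 = k ⊗ A → k`. -/
def augR : TensorAlgebra k V ⊗[k] D.Alg →ₗ[k] k :=
  LinearMap.mul' k k ∘ₗ TensorProduct.map
    (TensorAlgebra.algebraMapInv (R := k) (M := V)).toLinearMap D.aug.toLinearMap

/-- `A` is right multi-Koszul: the augmented complex `⋯ → J_2 ⊗ A → V ⊗ A → A → k → 0` of free
right modules is exact, i.e. it is a projective resolution of `k`. -/
def IsRightMultiKoszul : Prop :=
  (D.KR 0).map D.augR = ⊤ ∧
  D.KR 0 ⊓ LinearMap.ker D.augR = (D.KR 1).map (D.deltaR 1) ∧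
  ∀ i, 1 ≤ i → D.KR i ⊓ LinearMap.ker (D.deltaR i) = (D.KR (i + 1)).map (D.deltaR (i + 1))

end MultiHomogeneous

end MultiKoszul

end

/-!
The algebra `A = T(V) / I` is compared with two complexes of projective left modules.

*The Gruenberg resolution.* The left ideals `T ⊇ 𝔪 ⊇ I ⊇ I𝔪 ⊇ I² ⊇ I²𝔪 ⊇ ⋯` of the tensor algebra
`T = T(V)`, where `𝔪` is the augmentation ideal, form a chain `L_i` (`chain`) with
`L_{i+2} = I L_i`. Graded left ideals of a tensor algebra are free, so the quotients
`L_i / L_{i+2} = A ⊗_T L_i` are projective over `A`, and the inclusions `L_{i+1} ⊆ L_i` make them a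
resolution of `k` (`gruenbergResolution`). Reading off `Tor` gives the Govorov formula
`Tor_{i+1} = (L_{i+1} ∩ 𝔪 L_i) / (𝔪 L_{i+1} + L_{i+2})` (`govorov_equiv`,
`tor_succ_equiv_govorov`), valid for every graded projective resolution.

*Comparison.* For a projective complex with cycles `Z` in `P i`, the quotient
`(Z ∩ A_{>0} P i) / A_{>0} Z` is a form of `Tor_{i+1}` that only sees the complex up to `P i`. It
agrees for any two complexes which are exact below `P i` (`GradedComplex.cycTor_equiv`).

*The Koszul complex.* The point where minimality of `R` is used is that the cycles of
`K_i = A ⊗ J_i` always lie in `A_{>0} ⊗ J_i` (`augFst_eq_zero_of_deltaL`): if `1 ⊗ w + z` is a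
cycle with `z` decomposable, then comparing components in `T` modulo the relations of one fixed
degree puts the component of `w` in `R_s ⊗ V^(n-s)` into the space from which minimality separates
it. Hence the generators `J_{i+1}` map injectively to `Tor_{i+1}` once the complex is exact at
`K_i` in smaller internal degrees. All spaces being finite-dimensional in each degree, an abstract
isomorphism `Tor_{i+1} ≅ J_{i+1}` forces this map to be bijective, and exactness follows by
induction on the internal and the homological degree
(`GradedComplex.MinimalGenerators.exactAt_iff`). So `A` is left multi-Koszul exactly
when the Govorov spaces are isomorphic to the `J_{i+1}` (`isLeftMultiKoszul_iff_govorov`).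

*The right-hand side.* Reversing words turns the right Koszul complex of `A` into the left Koszul
complex of the opposite algebra (`isRightMultiKoszul_iff_op`). It preserves the Govorov spaces,
since `L_{2l} = I^l T` and `L_{2l+1} = I^l 𝔪` (`govorov_op_equiv`), and the spaces `J_i`
(`Jdeg_op_equiv`), so the same condition also characterises right multi-Koszul algebras.
-/

noncomputable section

namespace MultiKoszul

/-! ### Subquotients of vector spaces -/

section Subquotient

variable {k : Type*} [Field k] {M M' : Type*} [AddCommGroup M] [Module k M]
  [AddCommGroup M'] [Module k M']

/-- The subquotient `X / (X ∩ B)` of a vector space. -/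
abbrev SubQuot (X B : Submodule k M) : Type _ := ↥X ⧸ B.comap X.subtype

/-- A linear map on `X` which identifies `B` with the preimage of `B'` and is onto `X'` modulo `B'`
induces an isomorphism of subquotients. -/
theorem subQuot_equiv {X B : Submodule k M} {X' B' : Submodule k M'} (f : ↥X →ₗ[k] M')
    (hX : ∀ x, f x ∈ X') (hB : ∀ x : ↥X, f x ∈ B' ↔ (x : M) ∈ B)
    (hsurj : ∀ y ∈ X', ∃ x, f x - y ∈ B') :
    Nonempty (SubQuot X B ≃ₗ[k] SubQuot X' B') := by
  let F : ↥X →ₗ[k] SubQuot X' B' := (B'.comap X'.subtype).mkQ ∘ₗ f.codRestrict X' hX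
  have hker : LinearMap.ker F = B.comap X.subtype := by
    ext x
    simp only [F, LinearMap.mem_ker, LinearMap.comp_apply, Submodule.mkQ_apply,
      Submodule.Quotient.mk_eq_zero, Submodule.mem_comap]
    exact hB x
  have hF : Function.Surjective F := by
    intro y
    obtain ⟨y, rfl⟩ := Submodule.mkQ_surjective _ y
    obtain ⟨x, hx⟩ := hsurj y y.2
    refine ⟨x, ?_⟩
    simp only [F, LinearMap.comp_apply, Submodule.mkQ_apply]
    rw [Submodule.Quotient.eq]
    exact hx
  exact ⟨(Submodule.quotEquivOfEq _ _ hker.symm).trans (F.quotKerEquivOfSurjective hF)⟩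

end Subquotient

/-! ### Graded vector spaces -/

section Graded

variable {k : Type*} [Field k] {M N : Type*} [AddCommGroup M] [Module k M]
  [AddCommGroup N] [Module k N] {deg : ℤ → Submodule k M} {deg' : ℤ → Submodule k N}

/-- The projection of a graded vector space onto its component of degree `n`. -/
def homComp (h : DirectSum.IsInternal deg) (n : ℤ) : M →ₗ[k] M :=
  (deg n).subtype ∘ₗ DirectSum.component k ℤ (fun n => ↥(deg n)) n ∘ₗ
    (LinearEquiv.ofBijective (DirectSum.coeLinearMap deg) h).symm.toLinearMap

theorem homComp_mem (h : DirectSum.IsInternal deg) (n : ℤ) (x : M) : homComp h n x ∈ deg n :=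
  Subtype.coe_prop _

theorem homComp_of_mem (h : DirectSum.IsInternal deg) {n : ℤ} {x : M} (hx : x ∈ deg n) :
    homComp h n x = x :=
  congrArg Subtype.val (h.ofBijective_coeLinearMap_of_mem hx)

theorem homComp_of_mem_ne (h : DirectSum.IsInternal deg) {m n : ℤ} (hmn : m ≠ n) {x : M}
    (hx : x ∈ deg m) : homComp h n x = 0 :=
  congrArg Subtype.val (h.ofBijective_coeLinearMap_of_mem_ne hmn hx)

theorem graded_induction {κ : Type*} {deg : κ → Submodule k M} [Nonempty κ] (h : iSup deg = ⊤)
    {p : M → Prop} (hom : ∀ n, ∀ x ∈ deg n, p x)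
    (add : ∀ x y, p x → p y → p (x + y)) (x : M) : p x :=
  Submodule.iSup_induction deg (motive := p) (h ▸ Submodule.mem_top : x ∈ iSup deg) hom
    (hom (Classical.arbitrary κ) 0 (zero_mem _)) add

theorem mem_of_homComp_mem (h : DirectSum.IsInternal deg) {X : Submodule k M} {x : M}
    (hx : ∀ n, homComp h n x ∈ X) : x ∈ X := by
  classical
  have e : x = DirectSum.coeLinearMap deg
      ((LinearEquiv.ofBijective (DirectSum.coeLinearMap deg) h).symm x) :=
    ((LinearEquiv.ofBijective (DirectSum.coeLinearMap deg) h).apply_symm_apply x).symm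
  rw [e, DirectSum.coeLinearMap_eq_dfinsuppSum]
  exact Submodule.sum_mem _ fun n _ => hx n

/-- A family of subspaces with compatible projections that spans the space is a grading. -/
theorem isInternal_of_proj (π : ℤ → M →ₗ[k] M) (h1 : ∀ n, ∀ x ∈ deg n, π n x = x)
    (h2 : ∀ m n, m ≠ n → ∀ x ∈ deg m, π n x = 0) (h3 : iSup deg = ⊤) :
    DirectSum.IsInternal deg := by
  refine DirectSum.isInternal_submodule_of_iSupIndep_of_iSup_eq_top ?_ h3
  intro n
  rw [Submodule.disjoint_def]
  intro x hx hx'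
  have : (⨆ m, ⨆ (_ : m ≠ n), deg m) ≤ LinearMap.ker (π n) :=
    iSup₂_le fun m hm x hx => h2 m n hm x hx
  rw [← h1 n x hx]
  exact this hx'

/-- A subspace containing the homogeneous components of its elements inherits a grading. -/
theorem isInternal_comap (h : DirectSum.IsInternal deg) (f : N →ₗ[k] M)
    (hf : Function.Injective f) (hX : ∀ n x, homComp h n (f x) ∈ LinearMap.range f) :
    DirectSum.IsInternal fun n => (deg n).comap f := by
  let e := LinearEquiv.ofInjective f hf
  have he : ∀ y, f (e.symm y) = y := fun y => congrArg Subtype.val (e.apply_symm_apply y)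
  let π : ℤ → N →ₗ[k] N := fun n =>
    e.symm.toLinearMap ∘ₗ (homComp h n ∘ₗ f).codRestrict (LinearMap.range f) (hX n)
  have hπ : ∀ n x, f (π n x) = homComp h n (f x) := fun n x => he _
  refine isInternal_of_proj π ?_ ?_ ?_
  · exact fun n x hx => hf ((hπ n x).trans (homComp_of_mem h hx))
  · exact fun m n hmn x hx =>
      hf ((hπ n x).trans ((homComp_of_mem_ne h hmn hx).trans (map_zero f).symm))
  · rw [eq_top_iff]
    rintro x -
    have : f x ∈ (⨆ n, (deg n).comap f).map f := by
      refine mem_of_homComp_mem h fun n => ⟨π n x, ?_, hπ n x⟩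
      refine Submodule.mem_iSup_of_mem n ?_
      rw [Submodule.mem_comap, hπ]
      exact homComp_mem h n _
    obtain ⟨y, hy, hyx⟩ := this
    rwa [← hf hyx]

/-- The map induced on the target of a surjection. -/
def descend {P : Type*} [AddCommGroup P] [Module k P] (f : M →ₗ[k] N)
    (hf : Function.Surjective f) (g : M →ₗ[k] P) (h : ∀ x, f x = 0 → g x = 0) : N →ₗ[k] P :=
  (LinearMap.ker f).liftQ g h ∘ₗ (f.quotKerEquivOfSurjective hf).symm.toLinearMap

theorem descend_apply {P : Type*} [AddCommGroup P] [Module k P] (f : M →ₗ[k] N)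
    (hf : Function.Surjective f) (g : M →ₗ[k] P) (h : ∀ x, f x = 0 → g x = 0) (x : M) :
    descend f hf g h (f x) = g x := by
  have : (f.quotKerEquivOfSurjective hf).symm (f x) = (LinearMap.ker f).mkQ x := by
    rw [LinearEquiv.symm_apply_eq]
    rfl
  simp only [descend, LinearMap.comp_apply, LinearEquiv.coe_coe]
  rw [this]
  rfl

theorem isInternal_map (h : DirectSum.IsInternal deg) (f : M →ₗ[k] N)
    (hf : Function.Surjective f) (hker : ∀ n x, f x = 0 → f (homComp h n x) = 0) :
    DirectSum.IsInternal fun n => (deg n).map f := by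
  refine isInternal_of_proj (fun n => descend f hf (f ∘ₗ homComp h n) (hker n)) ?_ ?_ ?_
  · rintro n _ ⟨x, hx, rfl⟩
    rw [descend_apply, LinearMap.comp_apply, homComp_of_mem h hx]
  · rintro m n hmn _ ⟨x, hx, rfl⟩
    rw [descend_apply, LinearMap.comp_apply, homComp_of_mem_ne h hmn hx, map_zero]
  · rw [← Submodule.map_iSup, h.submodule_iSup_eq_top, Submodule.map_top,
      LinearMap.range_eq_top.2 hf]

/-- The degree `0` part of a linear map between graded vector spaces. -/
def degZero (h : DirectSum.IsInternal deg) (h' : DirectSum.IsInternal deg') (φ : M →ₗ[k] N) :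
    M →ₗ[k] N :=
  DirectSum.toModule k ℤ N (fun n => homComp h' n ∘ₗ φ ∘ₗ (deg n).subtype) ∘ₗ
    (LinearEquiv.ofBijective (DirectSum.coeLinearMap deg) h).symm.toLinearMap

theorem degZero_of_mem (h : DirectSum.IsInternal deg) (h' : DirectSum.IsInternal deg')
    (φ : M →ₗ[k] N) {n : ℤ} {x : M} (hx : x ∈ deg n) :
    degZero h h' φ x = homComp h' n (φ x) := by
  have e : (LinearEquiv.ofBijective (DirectSum.coeLinearMap deg) h).symm x =
      DirectSum.lof k ℤ (fun n => ↥(deg n)) n ⟨x, hx⟩ := by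
    rw [LinearEquiv.symm_apply_eq]
    exact (DirectSum.coeLinearMap_lof deg n ⟨x, hx⟩).symm
  simp only [degZero, LinearMap.comp_apply, LinearEquiv.coe_coe]
  rw [e, DirectSum.toModule_lof]
  rfl

theorem homComp_comm (h : DirectSum.IsInternal deg) (h' : DirectSum.IsInternal deg')
    (φ : M →ₗ[k] N) (hφ : ∀ n, ∀ x ∈ deg n, φ x ∈ deg' n) (n : ℤ) (x : M) :
    homComp h' n (φ x) = φ (homComp h n x) := by
  induction x using graded_induction h.submodule_iSup_eq_top with
  | hom m x hx =>
    by_cases hmn : m = n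
    · subst hmn
      rw [homComp_of_mem h hx, homComp_of_mem h' (hφ _ _ hx)]
    · rw [homComp_of_mem_ne h hmn hx, homComp_of_mem_ne h' hmn (hφ _ _ hx), map_zero]
  | add x y hx hy => simp only [map_add, hx, hy]

/-- A surjection onto the kernel of a graded map is surjective in each degree. -/
theorem exists_homogeneous_preimage (h : DirectSum.IsInternal deg)
    (h' : DirectSum.IsInternal deg') (φ : M →ₗ[k] N) (hφ : ∀ n, ∀ x ∈ deg n, φ x ∈ deg' n)
    {n : ℤ} {x : M} (hx : φ x ∈ deg' n) : ∃ y ∈ deg n, φ y = φ x :=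
  ⟨homComp h n x, homComp_mem h n x, by
    rw [← homComp_comm h h' φ hφ, homComp_of_mem h' hx]⟩

end Graded

section GradedModule

variable {k : Type*} [Field k] {A : Type*} [Ring A] [Algebra k A] {𝒜 : ℕ → Submodule k A}
  {M N : Type*} [AddCommGroup M] [Module k M] [Module A M]
  [AddCommGroup N] [Module k N] [Module A N]
  {deg : ℤ → Submodule k M} {deg' : ℤ → Submodule k N}

theorem homComp_smul (h : DirectSum.IsInternal deg)
    (hsmul : ∀ (m : ℕ) (n : ℤ) (a : A) (x : M), a ∈ 𝒜 m → x ∈ deg n → a • x ∈ deg (m + n))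
    {m : ℕ} {a : A} (ha : a ∈ 𝒜 m) (n : ℤ) (x : M) :
    homComp h (m + n) (a • x) = a • homComp h n x := by
  induction x using graded_induction h.submodule_iSup_eq_top with
  | hom l x hx =>
    by_cases hl : l = n
    · subst hl
      rw [homComp_of_mem h hx, homComp_of_mem h (hsmul _ _ _ _ ha hx)]
    · rw [homComp_of_mem_ne h hl hx, homComp_of_mem_ne h (by omega) (hsmul _ _ _ _ ha hx),
        smul_zero]
  | add x y hx hy => simp only [smul_add, map_add, hx, hy]

variable [IsScalarTower k A M] [IsScalarTower k A N]

/-- The degree `0` part of an `A`-linear map between graded `A`-modules. -/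
def degZeroA (hA : iSup 𝒜 = ⊤) (h : DirectSum.IsInternal deg) (h' : DirectSum.IsInternal deg')
    (hsmul : ∀ (m : ℕ) (n : ℤ) (a : A) (x : M), a ∈ 𝒜 m → x ∈ deg n → a • x ∈ deg (m + n))
    (hsmul' : ∀ (m : ℕ) (n : ℤ) (a : A) (x : N), a ∈ 𝒜 m → x ∈ deg' n → a • x ∈ deg' (m + n))
    (φ : M →ₗ[A] N) : M →ₗ[A] N where
  toFun := degZero h h' (φ.restrictScalars k)
  map_add' := map_add _
  map_smul' a x := by
    -- Linearity need only be checked for homogeneous `a` and `x`.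
    have key : ∀ a : A, ∀ x : M, degZero h h' (φ.restrictScalars k) (a • x) =
        a • degZero h h' (φ.restrictScalars k) x := by
      intro a
      refine Submodule.iSup_induction 𝒜 (motive := fun a => ∀ x : M,
        degZero h h' (φ.restrictScalars k) (a • x) = a • degZero h h' (φ.restrictScalars k) x)
        (hA ▸ Submodule.mem_top : a ∈ iSup 𝒜) ?_ (by simp) ?_
      · intro m a ha x
        induction x using graded_induction h.submodule_iSup_eq_top with
        | hom n x hx =>
          rw [degZero_of_mem h h' _ hx, degZero_of_mem h h' _ (hsmul m n a x ha hx)]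
          simp only [LinearMap.restrictScalars_apply, map_smul]
          exact homComp_smul h' hsmul' ha n _
        | add x y hx hy => simp only [smul_add, map_add, hx, hy]
      · intro a b ha hb x
        simp only [add_smul, map_add, ha, hb]
    exact key a x

theorem degZeroA_of_mem (hA : iSup 𝒜 = ⊤) (h : DirectSum.IsInternal deg)
    (h' : DirectSum.IsInternal deg')
    (hsmul : ∀ (m : ℕ) (n : ℤ) (a : A) (x : M), a ∈ 𝒜 m → x ∈ deg n → a • x ∈ deg (m + n))
    (hsmul' : ∀ (m : ℕ) (n : ℤ) (a : A) (x : N), a ∈ 𝒜 m → x ∈ deg' n → a • x ∈ deg' (m + n))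
    (φ : M →ₗ[A] N) {n : ℤ} {x : M} (hx : x ∈ deg n) :
    degZeroA hA h h' hsmul hsmul' φ x = homComp h' n (φ x) :=
  degZero_of_mem h h' (φ.restrictScalars k) hx

end GradedModule

/-! ### Comparison of projective complexes -/

section Comparison

variable {k : Type u} [Field k] {A : Type v} [Ring A] [Algebra k A]

/-- An augmented complex `⋯ → P 1 → P 0 → k → 0` of projective graded modules, not required to be
exact except at `k`. -/
structure GradedComplex (𝒜 : ℕ → Submodule k A) (ε : A →ₐ[k] k) where
  P : ℕ → Type w
  [addCommGroup : ∀ i, AddCommGroup (P i)]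
  [moduleBase : ∀ i, Module k (P i)]
  [moduleAlg : ∀ i, Module A (P i)]
  [isScalarTower : ∀ i, IsScalarTower k A (P i)]
  deg : ∀ i, ℤ → Submodule k (P i)
  isInternal : ∀ i, DirectSum.IsInternal (deg i)
  smul_mem : ∀ i (m : ℕ) (n : ℤ) (a : A) (x : P i),
    a ∈ 𝒜 m → x ∈ deg i n → a • x ∈ deg i (m + n)
  projective : ∀ i, Module.Projective A (P i)
  d : ∀ i, P (i + 1) →ₗ[A] P i
  d_mem : ∀ i n x, x ∈ deg (i + 1) n → d i x ∈ deg i n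
  aug : P 0 →ₗ[k] k
  aug_smul : ∀ (a : A) (x : P 0), aug (a • x) = ε a * aug x
  aug_eq_zero : ∀ n x, x ∈ deg 0 n → n ≠ 0 → aug x = 0
  aug_surjective : Function.Surjective aug
  aug_d : ∀ x, aug (d 0 x) = 0
  d_d : ∀ i x, d i (d (i + 1) x) = 0

attribute [instance] GradedComplex.addCommGroup GradedComplex.moduleBase
  GradedComplex.moduleAlg GradedComplex.isScalarTower

/-- The complex underlying a resolution. -/
def GradedProjectiveResolution.toComplex {𝒜 : ℕ → Submodule k A} {ε : A →ₐ[k] k}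
    (Q : GradedProjectiveResolution.{u, v, w} 𝒜 ε) : GradedComplex.{u, v, w} 𝒜 ε where
  P := Q.P
  deg := Q.deg
  isInternal := Q.isInternal
  smul_mem := Q.smul_mem
  projective := Q.projective
  d := Q.d
  d_mem := Q.d_mem
  aug := Q.aug
  aug_smul := Q.aug_smul
  aug_eq_zero := Q.aug_eq_zero
  aug_surjective := Q.aug_surjective
  aug_d x := (Q.exact_zero _).2 ⟨x, rfl⟩
  d_d i x := (Q.exact_succ i _).2 ⟨x, rfl⟩

/-- The subspace `A_{>0} X` of a module, for a subspace `X` and `A_{>0} = ker ε`. -/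
def augSpan (ε : A →ₐ[k] k) {M : Type*} [AddCommGroup M] [Module k M] [Module A M]
    (X : Submodule k M) : Submodule k M :=
  Submodule.span k {y | ∃ (a : A) (x : M), ε a = 0 ∧ x ∈ X ∧ a • x = y}

section augSpan

variable {ε : A →ₐ[k] k} {M N : Type*} [AddCommGroup M] [Module k M] [Module A M]
  [AddCommGroup N] [Module k N] [Module A N]

theorem smul_mem_augSpan {X : Submodule k M} {a : A} {x : M} (ha : ε a = 0) (hx : x ∈ X) :
    a • x ∈ augSpan ε X :=
  Submodule.subset_span ⟨a, x, ha, hx, rfl⟩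

theorem augSpan_le {X Y : Submodule k M} (h : ∀ a : A, ε a = 0 → ∀ x ∈ X, a • x ∈ Y) :
    augSpan ε X ≤ Y := by
  refine Submodule.span_le.2 ?_
  rintro _ ⟨a, x, ha, hx, rfl⟩
  exact h a ha x hx

theorem augSpan_mono {X Y : Submodule k M} (h : X ≤ Y) : augSpan ε X ≤ augSpan ε Y :=
  augSpan_le fun _ ha _ hx => smul_mem_augSpan ha (h hx)

variable [IsScalarTower k A M] [IsScalarTower k A N]

theorem map_mem_augSpan (f : M →ₗ[A] N) {X : Submodule k M} {Y : Submodule k N}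
    (h : ∀ x ∈ X, f x ∈ Y) {x : M} (hx : x ∈ augSpan ε X) : f x ∈ augSpan ε Y := by
  have : augSpan ε X ≤ (augSpan ε Y).comap (f.restrictScalars k) :=
    augSpan_le fun a ha x hx => by
      simpa using smul_mem_augSpan ha (h x hx)
  exact this hx

theorem exists_mem_augSpan_of_map (f : M →ₗ[A] N) {X : Submodule k M} {Y : Submodule k N}
    (h : ∀ y ∈ Y, ∃ x ∈ X, f x = y) {y : N} (hy : y ∈ augSpan ε Y) :
    ∃ x ∈ augSpan ε X, f x = y := by
  have : augSpan ε Y ≤ (augSpan ε X).map (f.restrictScalars k) :=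
    augSpan_le fun a ha y hy => by
      obtain ⟨x, hx, rfl⟩ := h y hy
      exact ⟨a • x, smul_mem_augSpan ha hx, map_smul f a x⟩
  exact this hy

end augSpan

variable {𝒜 : ℕ → Submodule k A} {ε : A →ₐ[k] k}

/-- Graded lifting property of a projective module: the degree `0` part of any lift is a lift. -/
theorem exists_graded_lift (hA : iSup 𝒜 = ⊤)
    {P Q N : Type*} [AddCommGroup P] [Module k P] [Module A P] [IsScalarTower k A P]
    [AddCommGroup Q] [Module k Q] [Module A Q] [IsScalarTower k A Q]
    [AddCommGroup N] [Module k N] [Module A N] [IsScalarTower k A N]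
    {degP : ℤ → Submodule k P} {degQ : ℤ → Submodule k Q} {degN : ℤ → Submodule k N}
    (hP : DirectSum.IsInternal degP) (hQ : DirectSum.IsInternal degQ)
    (hN : DirectSum.IsInternal degN)
    (sP : ∀ (m : ℕ) (n : ℤ) (a : A) (x : P), a ∈ 𝒜 m → x ∈ degP n → a • x ∈ degP (m + n))
    (sQ : ∀ (m : ℕ) (n : ℤ) (a : A) (x : Q), a ∈ 𝒜 m → x ∈ degQ n → a • x ∈ degQ (m + n))
    [Module.Projective A P] (φ : P →ₗ[A] N) (g : Q →ₗ[A] N)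
    (hφ : ∀ n, ∀ x ∈ degP n, φ x ∈ degN n) (hg : ∀ n, ∀ x ∈ degQ n, g x ∈ degN n)
    (h : ∀ x, ∃ y, g y = φ x) :
    ∃ F : P →ₗ[A] Q, (∀ n, ∀ x ∈ degP n, F x ∈ degQ n) ∧ ∀ x, g (F x) = φ x := by
  obtain ⟨F, hF⟩ := Module.projective_lifting_property g.rangeRestrict
    (φ.codRestrict (LinearMap.range g) h) g.surjective_rangeRestrict
  have hF' : ∀ x, g (F x) = φ x := fun x => congrArg Subtype.val (LinearMap.congr_fun hF x)
  refine ⟨degZeroA hA hP hQ sP sQ F, ?_, ?_⟩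
  · intro n x hx
    rw [degZeroA_of_mem hA hP hQ sP sQ F hx]
    exact homComp_mem _ _ _
  · intro x
    induction x using graded_induction hP.submodule_iSup_eq_top with
    | hom n x hx =>
      rw [degZeroA_of_mem hA hP hQ sP sQ F hx]
      have := homComp_comm hQ hN (g.restrictScalars k) hg n (F x)
      simp only [LinearMap.restrictScalars_apply] at this
      rw [← this, hF', homComp_of_mem hN (hφ n x hx)]
    | add x y hx hy => simp only [map_add, hx, hy]

namespace GradedComplex

variable (C : GradedComplex.{u, v, w} 𝒜 ε)

/-- The cycles of the augmented complex. -/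
def cyc : ∀ i, Submodule k (C.P i)
  | 0 => LinearMap.ker C.aug
  | i + 1 => LinearMap.ker ((C.d i).restrictScalars k)

/-- Exactness of the augmented complex at `P i`. -/
def ExactAt (i : ℕ) : Prop := ∀ x ∈ C.cyc i, ∃ y, C.d i y = x

theorem d_mem_cyc : ∀ i x, C.d i x ∈ C.cyc i
  | 0, x => C.aug_d x
  | i + 1, x => C.d_d i x

theorem aug_homComp_zero (x : C.P 0) : C.aug (homComp (C.isInternal 0) 0 x) = C.aug x := by
  induction x using graded_induction (C.isInternal 0).submodule_iSup_eq_top with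
  | hom m x hx =>
    by_cases hm : m = 0
    · subst hm
      rw [homComp_of_mem _ hx]
    · rw [homComp_of_mem_ne _ hm hx, C.aug_eq_zero m x hx hm, map_zero]
  | add x y hx hy => simp only [map_add, hx, hy]

theorem homComp_mem_cyc : ∀ (i : ℕ) (n : ℤ) (x : C.P i), x ∈ C.cyc i →
    homComp (C.isInternal i) n x ∈ C.cyc i
  | 0, n, x, hx => by
    have hx : C.aug x = 0 := hx
    change C.aug _ = 0
    by_cases hn : n = 0
    · subst hn
      rw [C.aug_homComp_zero, hx]
    · exact C.aug_eq_zero n _ (homComp_mem _ _ _) hn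
  | i + 1, n, x, hx => by
    have hx : C.d i x = 0 := hx
    change C.d i _ = 0
    have := homComp_comm (C.isInternal (i + 1)) (C.isInternal i) ((C.d i).restrictScalars k)
      (C.d_mem i) n x
    simp only [LinearMap.restrictScalars_apply] at this
    rw [← this, hx, map_zero]

/-- The degree `n` part of `Tor_{i+1}`, computed from the cycles `Z` of `P i` as
`(Z ∩ A_{>0} P i) / A_{>0} Z`. This only needs the complex up to `P i`. -/
abbrev cycTor (i : ℕ) (n : ℤ) : Type w :=
  SubQuot (C.deg i n ⊓ C.cyc i ⊓ augSpan ε ⊤) (augSpan ε (C.cyc i))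

variable (C' : GradedComplex.{u, v, w} 𝒜 ε)

/-- Graded maps `f : P i → P' i` and `g : P' i → P i` preserving cycles, such that `g f - 1` and
`f g - 1` agree on cycles with maps defined on all of `P i` and `P' i` and taking values in
cycles. -/
structure StageEquiv (i : ℕ) where
  f : C.P i →ₗ[A] C'.P i
  g : C'.P i →ₗ[A] C.P i
  h : C.P i →ₗ[A] C.P i
  h' : C'.P i →ₗ[A] C'.P i
  f_deg : ∀ n, ∀ x ∈ C.deg i n, f x ∈ C'.deg i n
  g_deg : ∀ n, ∀ x ∈ C'.deg i n, g x ∈ C.deg i n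
  h_deg : ∀ n, ∀ x ∈ C.deg i n, h x ∈ C.deg i n
  h_deg' : ∀ n, ∀ x ∈ C'.deg i n, h' x ∈ C'.deg i n
  f_cyc : ∀ x ∈ C.cyc i, f x ∈ C'.cyc i
  g_cyc : ∀ x ∈ C'.cyc i, g x ∈ C.cyc i
  h_cyc : ∀ x, h x ∈ C.cyc i
  h_cyc' : ∀ x, h' x ∈ C'.cyc i
  h_eq : ∀ x ∈ C.cyc i, h x = g (f x) - x
  h_eq' : ∀ x ∈ C'.cyc i, h' x = f (g x) - x

variable {C C'}

/-- The correction terms `h` and `h'` map `A_{>0} P` into `A_{>0} Z`, so that `f` and `g` are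
mutually inverse on `(Z ∩ A_{>0} P) / A_{>0} Z`. -/
theorem StageEquiv.cycTor_equiv {i : ℕ} (E : StageEquiv C C' i) (n : ℤ) :
    Nonempty (C.cycTor i n ≃ₗ[k] C'.cycTor i n) := by
  refine subQuot_equiv ((E.f.restrictScalars k).domRestrict _) ?_ ?_ ?_
  · rintro ⟨x, ⟨hx1, hx2⟩, hx3⟩
    exact ⟨⟨E.f_deg n x hx1, E.f_cyc x hx2⟩, map_mem_augSpan E.f (fun _ _ => Submodule.mem_top) hx3⟩
  · rintro ⟨x, ⟨hx1, hx2⟩, hx3⟩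
    refine ⟨fun hfx => ?_, fun hx => map_mem_augSpan E.f E.f_cyc hx⟩
    have hfx : E.f x ∈ augSpan ε (C'.cyc i) := hfx
    have h1 : E.g (E.f x) ∈ augSpan ε (C.cyc i) := map_mem_augSpan E.g E.g_cyc hfx
    have h2 : E.h x ∈ augSpan ε (C.cyc i) := map_mem_augSpan E.h (fun x _ => E.h_cyc x) hx3
    have : x = E.g (E.f x) - E.h x := by rw [E.h_eq x hx2]; abel
    change x ∈ _
    rw [this]
    exact sub_mem h1 h2
  · rintro y ⟨⟨hy1, hy2⟩, hy3⟩
    refine ⟨⟨E.g y, ⟨E.g_deg n y hy1, E.g_cyc y hy2⟩,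
      map_mem_augSpan E.g (fun _ _ => Submodule.mem_top) hy3⟩, ?_⟩
    change E.f (E.g y) - y ∈ _
    rw [← E.h_eq' y hy2]
    exact map_mem_augSpan E.h' (fun x _ => E.h_cyc' x) hy3

/-- Lifting of a map along the augmentation of a complex. -/
theorem exists_aug_lift (hA : iSup 𝒜 = ⊤) (C C' : GradedComplex.{u, v, w} 𝒜 ε) :
    ∃ f : C.P 0 →ₗ[A] C'.P 0, (∀ n, ∀ x ∈ C.deg 0 n, f x ∈ C'.deg 0 n) ∧
      ∀ x, C'.aug (f x) = C.aug x := by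
  -- The trivial module: `A` acts on `k` through `ε`.
  let _ : Module A k := Module.compHom k ε.toRingHom
  let a : C.P 0 →ₗ[A] k := { C.aug with map_smul' := C.aug_smul }
  let a' : C'.P 0 →ₗ[A] k := { C'.aug with map_smul' := C'.aug_smul }
  have := C.projective 0
  obtain ⟨F, hF⟩ := Module.projective_lifting_property a' a C'.aug_surjective
  have hF' : ∀ x, C'.aug (F x) = C.aug x := fun x => LinearMap.congr_fun hF x
  refine ⟨degZeroA hA (C.isInternal 0) (C'.isInternal 0) (C.smul_mem 0) (C'.smul_mem 0) F, ?_, ?_⟩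
  · intro n x hx
    rw [degZeroA_of_mem hA _ _ _ _ F hx]
    exact homComp_mem _ _ _
  · intro x
    induction x using graded_induction (C.isInternal 0).submodule_iSup_eq_top with
    | hom n x hx =>
      rw [degZeroA_of_mem hA _ _ _ _ F hx]
      by_cases hn : n = 0
      · subst hn
        rw [C'.aug_homComp_zero, hF']
      · rw [C.aug_eq_zero n x hx hn, C'.aug_eq_zero n _ (homComp_mem _ _ _) hn]
    | add x y hx hy => simp only [map_add, hx, hy]

theorem stageEquiv_zero (hA : iSup 𝒜 = ⊤) (C C' : GradedComplex.{u, v, w} 𝒜 ε) :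
    Nonempty (StageEquiv C C' 0) := by
  obtain ⟨f, hf, hf'⟩ := exists_aug_lift hA C C'
  obtain ⟨g, hg, hg'⟩ := exists_aug_lift hA C' C
  refine ⟨⟨f, g, g ∘ₗ f - LinearMap.id, f ∘ₗ g - LinearMap.id, hf, hg,
    fun n x hx => sub_mem (hg _ _ (hf _ _ hx)) hx, fun n x hx => sub_mem (hf _ _ (hg _ _ hx)) hx,
    fun x hx => (hf' x).trans hx, fun x hx => (hg' x).trans hx, fun x => ?_, fun x => ?_,
    fun x _ => rfl, fun x _ => rfl⟩⟩
  · change C.aug (g (f x) - x) = 0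
    rw [map_sub, hg', hf', sub_self]
  · change C'.aug (f (g x) - x) = 0
    rw [map_sub, hf', hg', sub_self]

/-- One half of the inductive step of the comparison theorem. -/
theorem StageEquiv.exists_step (hA : iSup 𝒜 = ⊤) {C C' : GradedComplex.{u, v, w} 𝒜 ε} {i : ℕ}
    (f : C.P i →ₗ[A] C'.P i) (f_deg : ∀ n, ∀ x ∈ C.deg i n, f x ∈ C'.deg i n)
    (f_cyc : ∀ x ∈ C.cyc i, f x ∈ C'.cyc i) (hC' : C'.ExactAt i) :
    ∃ F : C.P (i + 1) →ₗ[A] C'.P (i + 1),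
      (∀ n, ∀ x ∈ C.deg (i + 1) n, F x ∈ C'.deg (i + 1) n) ∧
      (∀ x, C'.d i (F x) = f (C.d i x)) ∧ ∀ x ∈ C.cyc (i + 1), F x ∈ C'.cyc (i + 1) := by
  have := C.projective (i + 1)
  obtain ⟨F, hF, hF'⟩ := exists_graded_lift hA (C.isInternal (i + 1)) (C'.isInternal (i + 1))
    (C'.isInternal i) (C.smul_mem _) (C'.smul_mem _) (f ∘ₗ C.d i) (C'.d i)
    (fun n x hx => f_deg n _ (C.d_mem i n x hx)) (C'.d_mem i)
    (fun x => hC' _ (f_cyc _ (C.d_mem_cyc i x)))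
  refine ⟨F, hF, hF', fun x hx => ?_⟩
  have hx : C.d i x = 0 := hx
  change C'.d i (F x) = 0
  rw [hF', LinearMap.comp_apply, hx, map_zero]

/-- The other half of the inductive step: the correction term `h` of the previous stage lifts to `s`
with `d s = h`, and the new correction term is `U - 1 - s d`. -/
theorem StageEquiv.exists_homotopy (hA : iSup 𝒜 = ⊤) {C : GradedComplex.{u, v, w} 𝒜 ε} {i : ℕ}
    (u h : C.P i →ₗ[A] C.P i) (h_deg : ∀ n, ∀ x ∈ C.deg i n, h x ∈ C.deg i n)
    (h_cyc : ∀ x, h x ∈ C.cyc i) (h_eq : ∀ x ∈ C.cyc i, h x = u x - x)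
    (U : C.P (i + 1) →ₗ[A] C.P (i + 1))
    (U_deg : ∀ n, ∀ x ∈ C.deg (i + 1) n, U x ∈ C.deg (i + 1) n)
    (hU : ∀ x, C.d i (U x) = u (C.d i x)) (hC : C.ExactAt i) :
    ∃ H : C.P (i + 1) →ₗ[A] C.P (i + 1),
      (∀ n, ∀ x ∈ C.deg (i + 1) n, H x ∈ C.deg (i + 1) n) ∧
      (∀ x, H x ∈ C.cyc (i + 1)) ∧ ∀ x ∈ C.cyc (i + 1), H x = U x - x := by
  have := C.projective i
  obtain ⟨s, hs, hs'⟩ := exists_graded_lift hA (C.isInternal i) (C.isInternal (i + 1))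
    (C.isInternal i) (C.smul_mem _) (C.smul_mem _) h (C.d i) h_deg (C.d_mem i)
    (fun x => hC _ (h_cyc x))
  refine ⟨U - LinearMap.id - s ∘ₗ C.d i, fun n x hx => ?_, fun x => ?_, fun x hx => ?_⟩
  · exact sub_mem (sub_mem (U_deg n x hx) hx) (hs n _ (C.d_mem i n x hx))
  · change C.d i (U x - x - s (C.d i x)) = 0
    rw [map_sub, map_sub, hs', hU, h_eq _ (C.d_mem_cyc i x), sub_self]
  · have hx : C.d i x = 0 := hx
    change U x - x - s (C.d i x) = _
    rw [hx, map_zero, sub_zero]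

theorem StageEquiv.succ (hA : iSup 𝒜 = ⊤) {i : ℕ} (E : StageEquiv C C' i) (hC : C.ExactAt i)
    (hC' : C'.ExactAt i) : Nonempty (StageEquiv C C' (i + 1)) := by
  obtain ⟨F, F_deg, hF, F_cyc⟩ := exists_step hA E.f E.f_deg E.f_cyc hC'
  obtain ⟨G, G_deg, hG, G_cyc⟩ := exists_step hA E.g E.g_deg E.g_cyc hC
  obtain ⟨H, H_deg, H_cyc, H_eq⟩ := exists_homotopy hA (E.g ∘ₗ E.f) E.h E.h_deg E.h_cyc E.h_eq
    (G ∘ₗ F) (fun n x hx => G_deg n _ (F_deg n x hx)) (fun x => by simp [hF, hG]) hC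
  obtain ⟨H', H_deg', H_cyc', H_eq'⟩ := exists_homotopy hA (E.f ∘ₗ E.g) E.h' E.h_deg' E.h_cyc'
    E.h_eq' (F ∘ₗ G) (fun n x hx => F_deg n _ (G_deg n x hx)) (fun x => by simp [hF, hG]) hC'
  exact ⟨⟨F, G, H, H', F_deg, G_deg, H_deg, H_deg', F_cyc, G_cyc, H_cyc, H_cyc', H_eq, H_eq'⟩⟩

/-- The comparison theorem for complexes that are exact only below a given stage. -/
theorem stageEquiv (hA : iSup 𝒜 = ⊤) (i : ℕ) (hC : ∀ j < i, C.ExactAt j)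
    (hC' : ∀ j < i, C'.ExactAt j) : Nonempty (StageEquiv C C' i) := by
  induction i with
  | zero => exact stageEquiv_zero hA C C'
  | succ i ih =>
    obtain ⟨E⟩ := ih (fun j hj => hC j (by omega)) (fun j hj => hC' j (by omega))
    exact E.succ hA (hC i (by omega)) (hC' i (by omega))

/-- `Tor_{i+1}` in the form `(Z ∩ A_{>0} P i) / A_{>0} Z` is the same for all complexes of
projectives that are exact below `P i`. -/
theorem cycTor_equiv (hA : iSup 𝒜 = ⊤) (i : ℕ) (hC : ∀ j < i, C.ExactAt j)
    (hC' : ∀ j < i, C'.ExactAt j) (n : ℤ) : Nonempty (C.cycTor i n ≃ₗ[k] C'.cycTor i n) := by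
  obtain ⟨E⟩ := stageEquiv hA i hC hC'
  exact E.cycTor_equiv n

variable (C) in
/-- The isomorphism `Tor_{i+1}(k, k) ≅ Tor_1(k, Z)` for the `i`-cycles `Z`, induced by the
differential. -/
theorem tor_equiv {i : ℕ} (h : C.ExactAt i) (h' : C.ExactAt (i + 1)) (n : ℤ) :
    Nonempty (SubQuot
      (C.deg (i + 1) n ⊓ (augSpan ε ⊤ : Submodule k (C.P i)).comap ((C.d i).restrictScalars k))
      (augSpan ε ⊤ ⊔ LinearMap.range ((C.d (i + 1)).restrictScalars k)) ≃ₗ[k] C.cycTor i n) := by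
  refine subQuot_equiv (((C.d i).restrictScalars k).domRestrict _) ?_ ?_ ?_
  · rintro ⟨x, hx1, hx2⟩
    exact ⟨⟨C.d_mem i n x hx1, C.d_mem_cyc i x⟩, hx2⟩
  · rintro ⟨x, hx1, hx2⟩
    change C.d i x ∈ augSpan ε _ ↔ x ∈ _
    constructor
    · intro hx
      -- `d x` is also the boundary of a decomposable `y`, and `x - y` is a boundary by exactness.
      obtain ⟨y, hy, hyx⟩ := exists_mem_augSpan_of_map (X := ⊤) (C.d i)
        (fun y hy => (h y hy).imp fun x hx => ⟨trivial, hx⟩) hx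
      obtain ⟨z, hz⟩ := h' (x - y) (show C.d i (x - y) = 0 by rw [map_sub, hyx, sub_self])
      exact Submodule.mem_sup.2 ⟨y, hy, x - y, ⟨z, hz⟩, by abel⟩
    · intro hx
      obtain ⟨y, hy, _, ⟨z, rfl⟩, rfl⟩ := Submodule.mem_sup.1 hx
      simp only [map_add, LinearMap.restrictScalars_apply, C.d_d, add_zero]
      exact map_mem_augSpan (C.d i) (fun x _ => C.d_mem_cyc i x) hy
  · rintro y ⟨⟨hy1, hy2⟩, hy3⟩
    obtain ⟨x, rfl⟩ := h y hy2
    obtain ⟨z, hz, hzx⟩ := exists_homogeneous_preimage (C.isInternal (i + 1)) (C.isInternal i)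
      ((C.d i).restrictScalars k) (C.d_mem i) hy1
    have hzx : C.d i z = C.d i x := hzx
    refine ⟨⟨z, hz, ?_⟩, ?_⟩
    · change C.d i z ∈ augSpan ε _
      rw [hzx]
      exact hy3
    · change C.d i z - C.d i x ∈ _
      rw [hzx, sub_self]
      exact zero_mem _

end GradedComplex

namespace GradedProjectiveResolution

variable (Q : GradedProjectiveResolution.{u, v, w} 𝒜 ε)

theorem exactAt_toComplex : ∀ i, Q.toComplex.ExactAt i
  | 0 => fun x hx => (Q.exact_zero x).1 hx
  | i + 1 => fun x hx => (Q.exact_succ i x).1 hx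

theorem augPart_eq (i : ℕ) : Q.augPart i = augSpan ε ⊤ := by
  simp [augPart, augSpan]

theorem tor_succ_equiv (i : ℕ) (n : ℤ) :
    Nonempty (Q.Tor (i + 1) n ≃ₗ[k] Q.toComplex.cycTor i n) := by
  have h := Q.toComplex.tor_equiv (Q.exactAt_toComplex i) (Q.exactAt_toComplex (i + 1)) n
  change Nonempty (SubQuot (Q.deg (i + 1) n ⊓ (Q.augPart i).comap ((Q.d i).restrictScalars k))
    (Q.augPart (i + 1) ⊔ LinearMap.range ((Q.d (i + 1)).restrictScalars k)) ≃ₗ[k] _)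
  rw [augPart_eq, augPart_eq]
  exact h

/-- `Tor_0(k, k)` is `k`, in degree `0`. -/
theorem tor_zero_equiv (n : ℤ) :
    Nonempty (Q.Tor 0 n ≃ₗ[k] SubQuot (if n = 0 then ⊤ else ⊥ : Submodule k k) ⊥) := by
  refine subQuot_equiv (X := Q.deg 0 n ⊓ Q.cycles 0) (B := Q.boundaries 0)
    (Q.aug.domRestrict _) ?_ ?_ ?_
  · rintro ⟨x, hx1, hx2⟩
    split_ifs with hn
    · trivial
    · exact Q.aug_eq_zero n x hx1 hn
  · rintro ⟨x, hx1, hx2⟩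
    change Q.aug x = 0 ↔ x ∈ Q.boundaries 0
    constructor
    · intro hx
      obtain ⟨y, hy⟩ := (Q.exact_zero x).1 hx
      exact Submodule.mem_sup_right ⟨y, hy⟩
    · intro hx
      have : Q.boundaries 0 ≤ LinearMap.ker Q.aug := by
        rw [boundaries, augPart_eq]
        refine sup_le (augSpan_le fun a ha x _ => ?_) ?_
        · rw [LinearMap.mem_ker, Q.aug_smul, ha, zero_mul]
        · rintro _ ⟨y, rfl⟩
          exact (Q.exact_zero _).2 ⟨y, rfl⟩
      exact this hx
  · intro y hy
    split_ifs at hy with hn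
    · subst hn
      obtain ⟨x, rfl⟩ := Q.aug_surjective y
      refine ⟨⟨homComp (Q.isInternal 0) 0 x, homComp_mem _ _ _, trivial⟩, ?_⟩
      change Q.aug _ - Q.aug x = 0
      rw [sub_eq_zero]
      exact Q.toComplex.aug_homComp_zero x
    · rw [(Submodule.mem_bot k).1 hy]
      exact ⟨0, by simp⟩

end GradedProjectiveResolution

end Comparison

/-! ### Exactness of a minimal complex -/

section Minimal

variable {k : Type u} [Field k] {A : Type v} [Ring A] [Algebra k A]
  {𝒜 : ℕ → Submodule k A} {ε : A →ₐ[k] k}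

namespace GradedComplex

variable (C : GradedComplex.{u, v, w} 𝒜 ε)

/-- A generating map for a complex whose cycles are decomposable: `G i n` maps onto the degree `n`
part of `P (i + 1) / A_{>0} P (i + 1)`, bijectively, and all cycles of the complex lie in
`A_{>0} P i`. -/
structure MinimalGenerators (G : ℕ → ℤ → Type w) [∀ i n, AddCommGroup (G i n)]
    [∀ i n, Module k (G i n)] where
  gen : ∀ i n, G i n →ₗ[k] C.P (i + 1)
  gen_mem : ∀ i n w, gen i n w ∈ C.deg (i + 1) n
  gen_surj : ∀ i n, ∀ z ∈ C.deg (i + 1) n, ∃ w, z - gen i n w ∈ augSpan ε ⊤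
  gen_inj : ∀ i n w, gen i n w ∈ augSpan ε (⊤ : Submodule k (C.P (i + 1))) → w = 0
  cyc_le : ∀ i, C.cyc i ≤ augSpan ε ⊤

variable {G : ℕ → ℤ → Type w} [∀ i n, AddCommGroup (G i n)] [∀ i n, Module k (G i n)]

namespace MinimalGenerators

variable {C} (E : C.MinimalGenerators G)

theorem d_gen_mem (i : ℕ) (n : ℤ) (w : G i n) :
    C.d i (E.gen i n w) ∈ C.deg i n ⊓ C.cyc i ⊓ augSpan ε ⊤ :=
  ⟨⟨C.d_mem i n _ (E.gen_mem i n w), C.d_mem_cyc i _⟩, E.cyc_le i (C.d_mem_cyc i _)⟩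

/-- The map from the generators of `P (i + 1)` to the degree `n` part of `Tor_{i+1}`. -/
def toTor (i : ℕ) (n : ℤ) : G i n →ₗ[k] C.cycTor i n :=
  (Submodule.mkQ _) ∘ₗ ((C.d i).restrictScalars k ∘ₗ E.gen i n).codRestrict
    (C.deg i n ⊓ C.cyc i ⊓ augSpan ε ⊤) (E.d_gen_mem i n)

/-- A generator whose boundary is trivial in `Tor` differs from a decomposable by a cycle, and
cycles are decomposable. -/
theorem toTor_injective {i : ℕ} {n : ℤ}
    (h : ∀ x ∈ C.deg i n, x ∈ augSpan ε (C.cyc i) → ∃ y ∈ augSpan ε ⊤, C.d i y = x) :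
    Function.Injective (E.toTor i n) := by
  rw [← LinearMap.ker_eq_bot, LinearMap.ker_eq_bot']
  intro w hw
  have hw : C.d i (E.gen i n w) ∈ augSpan ε (C.cyc i) :=
    (Submodule.Quotient.mk_eq_zero ((augSpan ε (C.cyc i)).comap _)).1 hw
  obtain ⟨y, hy, hyw⟩ := h _ (E.d_gen_mem i n w).1.1 hw
  refine E.gen_inj i n w ?_
  have hc : E.gen i n w - y ∈ C.cyc (i + 1) := by
    change C.d i _ = 0
    rw [map_sub, hyw, sub_self]
  simpa using add_mem (E.cyc_le (i + 1) hc) hy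

theorem toTor_surjective_iff {i : ℕ} {n : ℤ} : Function.Surjective (E.toTor i n) ↔
    ∀ x ∈ C.deg i n, x ∈ C.cyc i → ∃ w, C.d i (E.gen i n w) - x ∈ augSpan ε (C.cyc i) := by
  constructor
  · intro h x hx hx'
    obtain ⟨w, hw⟩ := h (Submodule.Quotient.mk ⟨x, ⟨hx, hx'⟩, E.cyc_le i hx'⟩)
    exact ⟨w, (Submodule.Quotient.eq ((augSpan ε (C.cyc i)).comap _)).1 hw⟩
  · intro h y
    obtain ⟨⟨x, hx⟩, rfl⟩ := Submodule.mkQ_surjective _ y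
    obtain ⟨w, hw⟩ := h x hx.1.1 hx.1.2
    exact ⟨w, (Submodule.Quotient.eq ((augSpan ε (C.cyc i)).comap _)).2 hw⟩

theorem nonempty_equiv_of_exactAt (E : C.MinimalGenerators G) (h : ∀ i, C.ExactAt i)
    (i : ℕ) (n : ℤ) : Nonempty (C.cycTor i n ≃ₗ[k] G i n) := by
  refine ⟨(LinearEquiv.ofBijective (E.toTor i n) ⟨E.toTor_injective ?_,
    E.toTor_surjective_iff.2 ?_⟩).symm⟩
  · intro x _ hx
    exact exists_mem_augSpan_of_map (C.d i) (X := ⊤)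
      (fun y hy => (h i y hy).imp fun _ hz => ⟨trivial, hz⟩) hx
  · intro x hx hx'
    obtain ⟨z, rfl⟩ := h i x hx'
    obtain ⟨z', hz', hzz⟩ := exists_homogeneous_preimage (C.isInternal (i + 1)) (C.isInternal i)
      ((C.d i).restrictScalars k) (C.d_mem i) hx
    obtain ⟨w, hw⟩ := E.gen_surj i n z' hz'
    refine ⟨w, ?_⟩
    have := map_mem_augSpan (C.d i) (Y := C.cyc i) (fun x _ => C.d_mem_cyc i x) hw
    rw [map_sub, show C.d i z' = C.d i z from hzz] at this
    rw [← neg_sub]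
    exact neg_mem this

/-- If the complex has the right `Tor` in homological degree `i + 1`, then it is exact at `P i`:
by induction on the internal degree, the generators map injectively, hence bijectively, to the
degree `n` part of the decomposable cycles modulo `A_{>0}` times the cycles. -/
theorem exactAt_of_equiv (E : C.MinimalGenerators G) (hε : ∀ m, ∀ a ∈ 𝒜 (m + 1), ε a = 0)
    (hA : ∀ a, ε a = 0 → a ∈ ⨆ m, 𝒜 (m + 1)) (hneg : ∀ i n, n < 0 → C.deg i n = ⊥)
    [∀ i n, FiniteDimensional k (G i n)] {i : ℕ}
    (h : ∀ n, Nonempty (C.cycTor i n ≃ₗ[k] G i n)) : C.ExactAt i := by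
  -- There is nothing in negative degrees, where the induction on the internal degree starts.
  have key : ∀ N : ℕ, ∀ n : ℤ, n < N → ∀ x ∈ C.deg i n, x ∈ C.cyc i → ∃ y, C.d i y = x := by
    intro N
    induction N with
    | zero =>
      intro n hn x hx _
      rw [hneg i n (by exact_mod_cast hn)] at hx
      exact ⟨0, by rw [map_zero, (Submodule.mem_bot k).1 hx]⟩
    | succ N ih =>
      intro n hn
      -- An element of `A_{>0} Z` of degree `n` involves only cycles of degree less than `n`, which
      -- are boundaries by induction.
      have h1 : ∀ x ∈ C.deg i n, x ∈ augSpan ε (C.cyc i) → ∃ y ∈ augSpan ε ⊤, C.d i y = x := by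
        intro x hx hx'
        have : augSpan ε (C.cyc i) ≤ ((augSpan ε ⊤).map ((C.d i).restrictScalars k)).comap
            (homComp (C.isInternal i) n) := by
          refine augSpan_le fun a ha x hx => ?_
          change homComp (C.isInternal i) n (a • x) ∈
            (augSpan ε ⊤).map ((C.d i).restrictScalars k)
          refine (iSup_le fun m a ha => ?_ : ⨆ m, 𝒜 (m + 1) ≤
            ((augSpan ε ⊤).map ((C.d i).restrictScalars k)).comap
              (homComp (C.isInternal i) n ∘ₗ
                (LinearMap.toSpanSingleton A _ x).restrictScalars k)) (hA a ha)
          change homComp (C.isInternal i) n (a • x) ∈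
            (augSpan ε ⊤).map ((C.d i).restrictScalars k)
          have e : n = ((m + 1 : ℕ) : ℤ) + (n - (m + 1 : ℕ)) := by omega
          rw [e, homComp_smul (C.isInternal i) (C.smul_mem i) ha]
          obtain ⟨y, hy⟩ := ih (n - (m + 1 : ℕ)) (by omega) _ (homComp_mem _ _ _)
            (C.homComp_mem_cyc i _ x hx)
          exact ⟨a • y, smul_mem_augSpan (hε m a ha) trivial,
            (map_smul (C.d i) a y).trans (congrArg _ hy)⟩
        obtain ⟨y, hy, hyx⟩ := this hx'
        rw [homComp_of_mem _ hx] at hyx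
        exact ⟨y, hy, hyx⟩
      obtain ⟨e⟩ := h n
      have : FiniteDimensional k (C.cycTor i n) := e.symm.finiteDimensional
      have hs := (LinearMap.injective_iff_surjective_of_finrank_eq_finrank
        e.symm.finrank_eq).1 (E.toTor_injective h1)
      intro x hx hx'
      obtain ⟨w, hw⟩ := E.toTor_surjective_iff.1 hs x hx hx'
      obtain ⟨y, -, hy⟩ := h1 _ (sub_mem (E.d_gen_mem i n w).1.1 hx) hw
      exact ⟨E.gen i n w - y, by rw [map_sub, hy, sub_sub_cancel]⟩
  intro x hx
  have : x ∈ LinearMap.range ((C.d i).restrictScalars k) := by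
    refine mem_of_homComp_mem (C.isInternal i) fun n => ?_
    exact key (n.toNat + 1) n (by omega) _ (homComp_mem _ _ _) (C.homComp_mem_cyc i n x hx)
  exact this

/-- A complex with minimal generators is exact if and only if its spaces of generators are
isomorphic to the graded `Tor` spaces, computed by any exact complex. -/
theorem exactAt_iff (E : C.MinimalGenerators G) (hε : ∀ m, ∀ a ∈ 𝒜 (m + 1), ε a = 0)
    (hA : ∀ a, ε a = 0 → a ∈ ⨆ m, 𝒜 (m + 1)) (hA' : iSup 𝒜 = ⊤)
    (hneg : ∀ i n, n < 0 → C.deg i n = ⊥) [∀ i n, FiniteDimensional k (G i n)]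
    {C' : GradedComplex.{u, v, w} 𝒜 ε} (hC' : ∀ i, C'.ExactAt i) :
    (∀ i, C.ExactAt i) ↔ ∀ i n, Nonempty (C'.cycTor i n ≃ₗ[k] G i n) := by
  constructor
  · intro h i n
    obtain ⟨e⟩ := E.nonempty_equiv_of_exactAt h i n
    obtain ⟨e'⟩ := cycTor_equiv (C := C) (C' := C') hA' i (fun j _ => h j) (fun j _ => hC' j) n
    exact ⟨e'.symm.trans e⟩
  · intro h i
    induction i using Nat.strong_induction_on with
    | _ i ih =>
      refine E.exactAt_of_equiv hε hA hneg fun n => ?_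
      obtain ⟨e⟩ := h i n
      obtain ⟨e'⟩ := cycTor_equiv (C := C) (C' := C') hA' i ih (fun j _ => hC' j) n
      exact ⟨e'.trans e⟩

end MinimalGenerators

end GradedComplex

end Minimal

/-! ### Complexes of submodules of a graded module -/

section Embedded

variable {k : Type u} [Field k] {A : Type v} [Ring A] [Algebra k A]
  {𝒜 : ℕ → Submodule k A} {ε : A →ₐ[k] k}

/-- An augmented complex of projective modules whose terms are graded submodules `K i` of one
graded module `E`, with differentials and augmentation restricted from maps defined on `E`. The map
`d i` is the differential from `K (i + 1)` to `K i`. -/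
structure EmbeddedComplex (𝒜 : ℕ → Submodule k A) (ε : A →ₐ[k] k) {E : Type w} [AddCommGroup E]
    [Module k E] [Module A E] [IsScalarTower k A E] (deg : ℤ → Submodule k E) where
  isInternal : DirectSum.IsInternal deg
  smul_mem : ∀ (m : ℕ) (n : ℤ) (a : A) (x : E), a ∈ 𝒜 m → x ∈ deg n → a • x ∈ deg (m + n)
  K : ℕ → Submodule k E
  smul_mem_K : ∀ i (a : A), ∀ x ∈ K i, a • x ∈ K i
  homComp_mem : ∀ i n, ∀ x ∈ K i, homComp isInternal n x ∈ K i
  projective : ∀ i, Module.Projective A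
    ↥({ K i with smul_mem' := fun a x hx => smul_mem_K i a x hx } : Submodule A E)
  d : ℕ → E →ₗ[k] E
  d_smul : ∀ i (a : A) (x : E), d i (a • x) = a • d i x
  d_mem : ∀ i, ∀ x ∈ K (i + 1), d i x ∈ K i
  d_deg : ∀ i n, ∀ x ∈ K (i + 1), x ∈ deg n → d i x ∈ deg n
  aug : E →ₗ[k] k
  aug_smul : ∀ (a : A) (x : E), aug (a • x) = ε a * aug x
  aug_eq_zero : ∀ n, ∀ x ∈ K 0, x ∈ deg n → n ≠ 0 → aug x = 0
  aug_surjective : ∀ c, ∃ x ∈ K 0, aug x = c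
  aug_d : ∀ x ∈ K 1, aug (d 0 x) = 0
  d_d : ∀ i, ∀ x ∈ K (i + 2), d i (d (i + 1) x) = 0

namespace EmbeddedComplex

variable {E : Type w} [AddCommGroup E] [Module k E] [Module A E] [IsScalarTower k A E]
  {deg : ℤ → Submodule k E} (C : EmbeddedComplex 𝒜 ε deg)

/-- The term `K i` as a submodule over the algebra. -/
def mod (i : ℕ) : Submodule A E := { C.K i with smul_mem' := C.smul_mem_K i }

/-- The complex of the modules `K i`. -/
def toComplex : GradedComplex.{u, v, w} 𝒜 ε where
  P i := ↥(C.mod i)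
  deg i n := (deg n).comap ((C.mod i).subtype.restrictScalars k)
  isInternal i := isInternal_comap C.isInternal _ Subtype.val_injective fun n x =>
    ⟨⟨_, C.homComp_mem i n x x.2⟩, rfl⟩
  smul_mem _ m n a x ha hx := C.smul_mem m n a x ha hx
  projective := C.projective
  d i :=
    { toFun := fun x => ⟨C.d i x, C.d_mem i x x.2⟩
      map_add' := fun _ _ => Subtype.ext (map_add _ _ _)
      map_smul' := fun a x => Subtype.ext (C.d_smul i a x) }
  d_mem i n x hx := C.d_deg i n x x.2 hx
  aug := C.aug ∘ₗ (C.mod 0).subtype.restrictScalars k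
  aug_smul a x := C.aug_smul a x
  aug_eq_zero n x hx hn := C.aug_eq_zero n x x.2 hx hn
  aug_surjective c := (C.aug_surjective c).elim fun x h => ⟨⟨x, h.1⟩, h.2⟩
  aug_d x := C.aug_d x x.2
  d_d i x := Subtype.ext (C.d_d i x x.2)

theorem exactAt_zero_iff : C.toComplex.ExactAt 0 ↔
    C.K 0 ⊓ LinearMap.ker C.aug = (C.K 1).map (C.d 0) := by
  constructor
  · intro h
    ext x
    constructor
    · rintro ⟨hx, hx'⟩
      obtain ⟨y, hy⟩ := h ⟨x, hx⟩ hx'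
      exact ⟨y.1, y.2, congrArg Subtype.val hy⟩
    · rintro ⟨y, hy, rfl⟩
      exact ⟨C.d_mem 0 y hy, C.aug_d y hy⟩
  · rintro h ⟨x, hx⟩ hx'
    obtain ⟨y, hy, hyx⟩ := h.le ⟨hx, hx'⟩
    exact ⟨⟨y, hy⟩, Subtype.ext hyx⟩

theorem exactAt_succ_iff (i : ℕ) : C.toComplex.ExactAt (i + 1) ↔
    C.K (i + 1) ⊓ LinearMap.ker (C.d i) = (C.K (i + 2)).map (C.d (i + 1)) := by
  constructor
  · intro h
    ext x
    constructor
    · rintro ⟨hx, hx'⟩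
      obtain ⟨y, hy⟩ := h ⟨x, hx⟩ (Subtype.ext hx')
      exact ⟨y.1, y.2, congrArg Subtype.val hy⟩
    · rintro ⟨y, hy, rfl⟩
      exact ⟨C.d_mem (i + 1) y hy, C.d_d i y hy⟩
  · rintro h ⟨x, hx⟩ hx'
    obtain ⟨y, hy, hyx⟩ := h.le ⟨hx, congrArg Subtype.val hx'⟩
    exact ⟨⟨y, hy⟩, Subtype.ext hyx⟩

theorem mem_augSpan_iff {i : ℕ} {x : C.toComplex.P i} :
    x ∈ augSpan ε (⊤ : Submodule k (C.toComplex.P i)) ↔ x.1 ∈ augSpan ε (C.K i) := by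
  constructor
  · exact fun hx => map_mem_augSpan (C.mod i).subtype (fun x _ => x.2) hx
  · intro hx
    obtain ⟨y, hy, hyx⟩ := exists_mem_augSpan_of_map (C.mod i).subtype (X := ⊤)
      (fun y hy => ⟨⟨y, hy⟩, trivial, rfl⟩) hx
    rwa [← Subtype.ext hyx]

/-- Generators of the terms of a complex of submodules, each subspace `G (i + 1) n` of `E` mapping
isomorphically onto the degree `n` part of `K (i + 1) / A_{>0} K (i + 1)`. -/
def minimalGenerators {T : Type w} [AddCommGroup T] [Module k T] (G : ℕ → ℤ → Submodule k T)
    (g : T →ₗ[k] E) (hK : ∀ i n, ∀ w ∈ G (i + 1) n, g w ∈ C.K (i + 1))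
    (hdeg : ∀ i n, ∀ w ∈ G (i + 1) n, g w ∈ deg n)
    (hsurj : ∀ i n, ∀ z ∈ C.K (i + 1), z ∈ deg n →
      ∃ w ∈ G (i + 1) n, z - g w ∈ augSpan ε (C.K (i + 1)))
    (hinj : ∀ i n, ∀ w ∈ G (i + 1) n, g w ∈ augSpan ε (C.K (i + 1)) → w = 0)
    (h0 : ∀ x ∈ C.K 0, C.aug x = 0 → x ∈ augSpan ε (C.K 0))
    (hcyc : ∀ i, ∀ x ∈ C.K (i + 1), C.d i x = 0 → x ∈ augSpan ε (C.K (i + 1))) :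
    C.toComplex.MinimalGenerators fun i n => ↥(G (i + 1) n) where
  gen i n :=
    { toFun := fun w => ⟨g w, hK i n w w.2⟩
      map_add' := fun _ _ => Subtype.ext (map_add _ _ _)
      map_smul' := fun _ _ => Subtype.ext (map_smul _ _ _) }
  gen_mem i n w := hdeg i n w w.2
  gen_surj i n z hz := by
    obtain ⟨w, hw, h⟩ := hsurj i n z.1 z.2 hz
    exact ⟨⟨w, hw⟩, C.mem_augSpan_iff.2 h⟩
  gen_inj i n w hw := Subtype.ext (hinj i n w w.2 (C.mem_augSpan_iff.1 hw))
  cyc_le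
    | 0, x, hx => C.mem_augSpan_iff.2 (h0 x.1 x.2 hx)
    | i + 1, x, hx => C.mem_augSpan_iff.2 (hcyc i x.1 x.2 (congrArg Subtype.val hx))

end EmbeddedComplex

end Embedded

/-! ### The tensor algebra -/

section TensorAlg

variable {k : Type u} [Field k] {V : Type v} [AddCommGroup V] [Module k V]

open TensorAlgebra (ι algebraMapInv)

theorem tpow_mul_tpow (m n : ℕ) : tpow k V m * tpow k V n = tpow k V (m + n) :=
  (pow_add _ _ _).symm

theorem tpow_zero_mul (X : Submodule k (TensorAlgebra k V)) : tpow k V 0 * X = X := by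
  rw [tpow, pow_zero, one_mul]

theorem mul_tpow_zero (X : Submodule k (TensorAlgebra k V)) : X * tpow k V 0 = X := by
  rw [tpow, pow_zero, mul_one]

theorem ι_mem_tpow (v : V) : ι k v ∈ tpow k V 1 := by
  rw [tpow, pow_one]
  exact ⟨v, rfl⟩

theorem one_mem_tpow : (1 : TensorAlgebra k V) ∈ tpow k V 0 := by
  rw [tpow, pow_zero]
  exact Submodule.one_le.1 le_rfl

theorem mul_mem_tpow {m n : ℕ} {x y : TensorAlgebra k V} (hx : x ∈ tpow k V m)
    (hy : y ∈ tpow k V n) : x * y ∈ tpow k V (m + n) := by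
  rw [← tpow_mul_tpow]
  exact Submodule.mul_mem_mul hx hy

theorem iSup_tpow : ⨆ n, tpow k V n = ⊤ :=
  (DirectSum.Decomposition.isInternal (tpow k V)).submodule_iSup_eq_top

theorem projDeg_mem (n : ℕ) (x : TensorAlgebra k V) : projDeg k V n x ∈ tpow k V n := by
  rw [projDeg, GradedAlgebra.proj_apply]
  exact Subtype.coe_prop _

theorem projDeg_of_mem {n : ℕ} {x : TensorAlgebra k V} (hx : x ∈ tpow k V n) :
    projDeg k V n x = x := by
  rw [projDeg, GradedAlgebra.proj_apply]
  exact DirectSum.decompose_of_mem_same _ hx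

theorem projDeg_of_mem_ne {m n : ℕ} {x : TensorAlgebra k V} (hx : x ∈ tpow k V m) (h : m ≠ n) :
    projDeg k V n x = 0 := by
  rw [projDeg, GradedAlgebra.proj_apply]
  exact DirectSum.decompose_of_mem_ne _ hx h

theorem tensorAlgebra_induction {p : TensorAlgebra k V → Prop}
    (hom : ∀ n, ∀ x ∈ tpow k V n, p x) (add : ∀ x y, p x → p y → p (x + y))
    (x : TensorAlgebra k V) : p x :=
  Submodule.iSup_induction (tpow k V) (motive := p)
    (iSup_tpow (k := k) (V := V) ▸ Submodule.mem_top) hom (hom 0 0 (zero_mem _)) add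

theorem mem_of_projDeg_mem {X : Submodule k (TensorAlgebra k V)} {x : TensorAlgebra k V}
    (hx : ∀ n, projDeg k V n x ∈ X) : x ∈ X := by
  classical
  rw [← DirectSum.sum_support_decompose (tpow k V) x]
  refine Submodule.sum_mem _ fun n _ => ?_
  have := hx n
  rwa [projDeg, GradedAlgebra.proj_apply] at this

/-! ### Homogeneous subspaces of the tensor algebra -/

/-- A subspace of `T(V)` is homogeneous if it contains the homogeneous components of its
elements. -/
def IsHomog (X : Submodule k (TensorAlgebra k V)) : Prop :=
  ∀ n, ∀ x ∈ X, projDeg k V n x ∈ X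

theorem isHomog_iff_le {X : Submodule k (TensorAlgebra k V)} :
    IsHomog X ↔ X ≤ ⨆ n, X ⊓ tpow k V n := by
  constructor
  · intro h x hx
    exact mem_of_projDeg_mem fun n => Submodule.mem_iSup_of_mem n ⟨h n x hx, projDeg_mem n x⟩
  · intro h n
    refine h.trans (iSup_le fun m => ?_ : _ ≤ X.comap (projDeg k V n))
    rintro x ⟨hx, hxm⟩
    by_cases hmn : m = n
    · subst hmn
      change projDeg k V m x ∈ X
      rwa [projDeg_of_mem hxm]
    · change projDeg k V n x ∈ X
      rw [projDeg_of_mem_ne hxm hmn]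
      exact zero_mem _

theorem isHomog_of_le {X : Submodule k (TensorAlgebra k V)} {n : ℕ} (h : X ≤ tpow k V n) :
    IsHomog X :=
  isHomog_iff_le.2 fun _ hx => Submodule.mem_iSup_of_mem n ⟨hx, h hx⟩

theorem isHomog_top : IsHomog (⊤ : Submodule k (TensorAlgebra k V)) := fun _ _ _ => trivial

theorem isHomog_iSup {κ : Sort*} {X : κ → Submodule k (TensorAlgebra k V)}
    (h : ∀ i, IsHomog (X i)) : IsHomog (⨆ i, X i) := by
  intro n
  change iSup X ≤ (iSup X).comap (projDeg k V n)
  exact iSup_le fun i x hx => Submodule.mem_iSup_of_mem i (h i n x hx)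

theorem IsHomog.mul {X Y : Submodule k (TensorAlgebra k V)} (hX : IsHomog X) (hY : IsHomog Y) :
    IsHomog (X * Y) := by
  rw [isHomog_iff_le] at *
  refine (mul_le_mul' hX hY).trans ?_
  rw [Submodule.iSup_mul]
  refine iSup_le fun m => ?_
  rw [Submodule.mul_iSup]
  refine iSup_le fun n => le_iSup_of_le (m + n) (le_inf ?_ ?_)
  · exact mul_le_mul' inf_le_left inf_le_left
  · exact (mul_le_mul' inf_le_right inf_le_right).trans_eq (tpow_mul_tpow m n)

theorem isInternal_tpowInt : DirectSum.IsInternal (tpowInt k V) := by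
  refine isInternal_of_proj (fun n => match n with
    | Int.ofNat n => projDeg k V n
    | Int.negSucc _ => 0) ?_ ?_ ?_
  · rintro (n | n) x hx
    · exact projDeg_of_mem hx
    · exact ((Submodule.mem_bot k).1 hx).symm
  · rintro (m | m) (n | n) hmn x hx
    · exact projDeg_of_mem_ne hx fun h => hmn (by rw [h])
    · rfl
    · rw [(Submodule.mem_bot k).1 hx, map_zero]
    · rfl
  · rw [eq_top_iff, ← iSup_tpow]
    exact iSup_le fun n => le_iSup (tpowInt k V) (n : ℤ)

theorem IsHomog.homComp_mem {X : Submodule k (TensorAlgebra k V)} (hX : IsHomog X) (n : ℤ)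
    {x : TensorAlgebra k V} (hx : x ∈ X) : homComp isInternal_tpowInt n x ∈ X := by
  have hX := isHomog_iff_le.1 hX hx
  refine (iSup_le fun m => ?_ :
    (⨆ m, X ⊓ tpow k V m) ≤ X.comap (homComp isInternal_tpowInt n)) hX
  rintro y ⟨hy, hym⟩
  change homComp _ _ y ∈ X
  by_cases hmn : (m : ℤ) = n
  · subst hmn
    rwa [homComp_of_mem isInternal_tpowInt (n := (m : ℤ)) hym]
  · rw [homComp_of_mem_ne isInternal_tpowInt (m := (m : ℤ)) hmn hym]
    exact zero_mem _

theorem mul_mem_tpowInt {m : ℕ} {n : ℤ} {x y : TensorAlgebra k V} (hx : x ∈ tpow k V m)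
    (hy : y ∈ tpowInt k V n) : x * y ∈ tpowInt k V (m + n) := by
  obtain n | n := n
  · exact mul_mem_tpow hx hy
  · rw [(Submodule.mem_bot k).1 hy, mul_zero]
    exact zero_mem _

/-! ### The augmentation ideal and left derivatives -/

variable (k V) in
/-- The augmentation ideal `T(V)_{>0}`, as a subspace. -/
def augIdeal : Submodule k (TensorAlgebra k V) :=
  LinearMap.ker (algebraMapInv (R := k) (M := V)).toLinearMap

theorem mem_augIdeal {x : TensorAlgebra k V} : x ∈ augIdeal k V ↔ algebraMapInv x = 0 := Iff.rfl

theorem tpow_le_augIdeal {n : ℕ} (hn : n ≠ 0) : tpow k V n ≤ augIdeal k V :=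
  fun _ hx => MultiHomogeneous.algebraMapInv_eq_zero hn hx

theorem mul_mem_augIdeal_left {x : TensorAlgebra k V} (hx : x ∈ augIdeal k V)
    (y : TensorAlgebra k V) : x * y ∈ augIdeal k V := by
  rw [mem_augIdeal] at *
  rw [map_mul, hx, zero_mul]

theorem mul_mem_augIdeal_right (x : TensorAlgebra k V) {y : TensorAlgebra k V}
    (hy : y ∈ augIdeal k V) : x * y ∈ augIdeal k V := by
  rw [mem_augIdeal] at *
  rw [map_mul, hy, mul_zero]

theorem isHomog_augIdeal : IsHomog (augIdeal k V) := by
  intro n x hx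
  by_cases hn : n = 0
  · subst hn
    have key : ∀ y : TensorAlgebra k V,
        algebraMapInv (projDeg k V 0 y) = algebraMapInv y := by
      intro y
      induction y using tensorAlgebra_induction with
      | hom m y hy =>
        by_cases hm : m = 0
        · subst hm
          rw [projDeg_of_mem hy]
        · rw [projDeg_of_mem_ne hy hm, MultiHomogeneous.algebraMapInv_eq_zero hm hy, map_zero]
      | add y z hy hz => simp only [map_add, hy, hz]
    rw [mem_augIdeal, key]
    exact hx
  · exact tpow_le_augIdeal hn (projDeg_mem n x)

/-- The left derivative `v₁ v₂ ⋯ vₙ ↦ φ(v₁) v₂ ⋯ vₙ` along a linear form `φ` on `V`. -/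
def lderiv (φ : V →ₗ[k] k) : TensorAlgebra k V →ₗ[k] TensorAlgebra k V :=
  (TensorProduct.lid k _).toLinearMap ∘ₗ φ.rTensor _ ∘ₗ splitLeft k V

theorem lderiv_ι_mul (φ : V →ₗ[k] k) (v : V) (x : TensorAlgebra k V) :
    lderiv φ (ι k v * x) = φ v • x := by
  simp [lderiv, splitLeft_ι_mul]

theorem lderiv_of_mem_tpow_zero (φ : V →ₗ[k] k) {x : TensorAlgebra k V} (hx : x ∈ tpow k V 0) :
    lderiv φ x = 0 := by
  rw [tpow, pow_zero] at hx
  obtain ⟨c, rfl⟩ := Submodule.mem_one.1 hx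
  rw [Algebra.algebraMap_eq_smul_one, map_smul]
  simp [lderiv, splitLeft_one]

theorem tpow_one_mul_induction {X : Submodule k (TensorAlgebra k V)}
    {p : ∀ x : TensorAlgebra k V, x ∈ tpow k V 1 * X → Prop}
    (mul : ∀ v x, ∀ hx : x ∈ X, p (ι k v * x) (Submodule.mul_mem_mul (ι_mem_tpow v) hx))
    (add : ∀ x hx y hy, p x hx → p y hy → p (x + y) (add_mem hx hy)) {x : TensorAlgebra k V}
    (hx : x ∈ tpow k V 1 * X) : p x hx := by
  refine Submodule.mul_induction_on' (C := p) (fun a ha b hb => ?_) add hx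
  have ha' := ha
  rw [tpow, pow_one] at ha'
  obtain ⟨v, rfl⟩ := ha'
  exact mul v b hb

theorem lderiv_mem_of_mem_mul (φ : V →ₗ[k] k) {X : Submodule k (TensorAlgebra k V)}
    {x : TensorAlgebra k V} (hx : x ∈ tpow k V 1 * X) : lderiv φ x ∈ X := by
  induction hx using tpow_one_mul_induction with
  | mul v x hx =>
    rw [lderiv_ι_mul]
    exact Submodule.smul_mem _ _ hx
  | add x _ y _ hx hy =>
    rw [map_add]
    exact add_mem hx hy

theorem lderiv_mem_tpow (φ : V →ₗ[k] k) {n : ℕ} {x : TensorAlgebra k V}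
    (hx : x ∈ tpow k V (n + 1)) : lderiv φ x ∈ tpow k V n := by
  rw [add_comm, ← tpow_mul_tpow] at hx
  exact lderiv_mem_of_mem_mul φ hx

/-- A tensor is recovered from its constant term and its left derivatives along a basis of `V`. -/
theorem eq_augmentation_add_sum {κ : Type*} [Fintype κ] (b : Module.Basis κ k V)
    (x : TensorAlgebra k V) : x = algebraMap k _ (algebraMapInv x) +
      ∑ i, ι k (b i) * lderiv (b.coord i) x := by
  induction x using tensorAlgebra_induction with
  | hom n x hx =>
    obtain _ | n := n
    · have h0 := hx
      rw [tpow, pow_zero] at h0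
      obtain ⟨c, rfl⟩ := Submodule.mem_one.1 h0
      simp [lderiv_of_mem_tpow_zero _ hx]
    · rw [add_comm, ← tpow_mul_tpow] at hx
      induction hx using tpow_one_mul_induction with
      | mul v x hx =>
        have h0 : algebraMapInv (ι k v * x) = 0 :=
          MultiHomogeneous.algebraMapInv_eq_zero (n := 1 + n) (by omega)
            (mul_mem_tpow (ι_mem_tpow v) hx)
        rw [h0, map_zero, zero_add]
        conv_lhs => rw [← b.sum_repr v, map_sum, Finset.sum_mul]
        refine Finset.sum_congr rfl fun i _ => ?_
        rw [lderiv_ι_mul, map_smul, smul_mul_assoc, mul_smul_comm, Module.Basis.coord_apply]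
      | add x _ y _ hx hy =>
        conv_lhs => rw [hx, hy]
        simp only [map_add, mul_add, Finset.sum_add_distrib]
        abel
  | add x y hx hy =>
    conv_lhs => rw [hx, hy]
    simp only [map_add, mul_add, Finset.sum_add_distrib]
    abel

/-- Membership in `V ⊗ X` is tested by left derivatives. -/
theorem mem_tpow_one_mul_iff [FiniteDimensional k V] {X : Submodule k (TensorAlgebra k V)}
    {x : TensorAlgebra k V} :
    x ∈ tpow k V 1 * X ↔ x ∈ augIdeal k V ∧ ∀ φ, lderiv φ x ∈ X := by
  constructor
  · intro hx
    refine ⟨?_, fun φ => lderiv_mem_of_mem_mul φ hx⟩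
    induction hx using tpow_one_mul_induction with
    | mul v x hx => exact mul_mem_augIdeal_left (tpow_le_augIdeal one_ne_zero (ι_mem_tpow v)) x
    | add x _ y _ hx hy => exact add_mem hx hy
  · rintro ⟨h0, hx⟩
    let b := Module.finBasis k V
    rw [eq_augmentation_add_sum b x, mem_augIdeal.1 h0, map_zero, zero_add]
    exact Submodule.sum_mem _ fun i _ => Submodule.mul_mem_mul (ι_mem_tpow _) (hx _)

theorem tpow_one_mul_top [FiniteDimensional k V] : tpow k V 1 * ⊤ = augIdeal k V := by
  ext x
  rw [mem_tpow_one_mul_iff]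
  simp

/-- Tensoring with `V^(a)` over a field commutes with intersections. -/
theorem mem_tpow_mul_iInf [FiniteDimensional k V] {κ : Type*} [Nonempty κ]
    {X : κ → Submodule k (TensorAlgebra k V)} (a : ℕ) {x : TensorAlgebra k V}
    (hx : ∀ i, x ∈ tpow k V a * X i) : x ∈ tpow k V a * ⨅ i, X i := by
  induction a generalizing x with
  | zero =>
    simp only [tpow_zero_mul] at hx ⊢
    exact (Submodule.mem_iInf _).2 hx
  | succ a ih =>
    rw [add_comm, ← tpow_mul_tpow] at hx ⊢
    simp only [mul_assoc, mem_tpow_one_mul_iff] at hx ⊢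
    exact ⟨(hx (Classical.arbitrary κ)).1, fun φ => ih fun i => (hx i).2 φ⟩

theorem tpow_mul_disjoint [FiniteDimensional k V] {X Y : Submodule k (TensorAlgebra k V)}
    (h : Disjoint X Y) (a : ℕ) : Disjoint (tpow k V a * X) (tpow k V a * Y) := by
  rw [Submodule.disjoint_def]
  intro x hX hY
  have := mem_tpow_mul_iInf (X := fun b : Bool => if b then X else Y) a (x := x) fun b => by
    cases b
    · simpa using hY
    · simpa using hX
  -- `X ∩ Y` is the intersection of a family indexed by `Bool`.
  have e : (⨅ b : Bool, if b then X else Y) = ⊥ := by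
    rw [iInf_bool_eq]
    simpa using h.eq_bot
  rw [e, Submodule.mul_bot] at this
  exact (Submodule.mem_bot k).1 this

theorem finiteDimensional_tpow [FiniteDimensional k V] (n : ℕ) :
    FiniteDimensional k (tpow k V n) := by
  have : (LinearMap.range (ι k : V →ₗ[k] TensorAlgebra k V)).FG :=
    Module.Finite.iff_fg.1 inferInstance
  exact Module.Finite.iff_fg.2 (this.pow n)

theorem finiteDimensional_tpowInt [FiniteDimensional k V] (n : ℤ) :
    FiniteDimensional k (tpowInt k V n) := by
  obtain n | n := n
  · exact finiteDimensional_tpow n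
  · exact (inferInstance : FiniteDimensional k (⊥ : Submodule k (TensorAlgebra k V)))

/-! ### Reversal of words -/

variable (k V) in
/-- The anti-automorphism `v₁ v₂ ⋯ vₙ ↦ vₙ ⋯ v₂ v₁` of `T(V)`, as a linear map. -/
def revAux : TensorAlgebra k V →ₗ[k] TensorAlgebra k V :=
  (MulOpposite.opLinearEquiv k).symm.toLinearMap ∘ₗ
    (TensorAlgebra.lift k ((MulOpposite.opLinearEquiv k).toLinearMap ∘ₗ
      (ι k : V →ₗ[k] TensorAlgebra k V))).toLinearMap

theorem revAux_mul (x y : TensorAlgebra k V) :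
    revAux k V (x * y) = revAux k V y * revAux k V x := by
  simp [revAux]

theorem revAux_ι (v : V) : revAux k V (ι k v) = ι k v := by
  simp [revAux]

theorem revAux_algebraMap (c : k) :
    revAux k V (algebraMap k _ c) = algebraMap k _ c := by
  simp only [revAux, LinearMap.comp_apply, AlgHom.toLinearMap_apply, AlgHom.commutes]
  rfl

theorem revAux_revAux (x : TensorAlgebra k V) : revAux k V (revAux k V x) = x := by
  induction x using TensorAlgebra.induction with
  | algebraMap c => rw [revAux_algebraMap, revAux_algebraMap]
  | ι v => rw [revAux_ι, revAux_ι]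
  | mul a b ha hb => rw [revAux_mul, revAux_mul, ha, hb]
  | add a b ha hb => rw [map_add, map_add, ha, hb]

variable (k V) in
/-- The anti-automorphism `v₁ v₂ ⋯ vₙ ↦ vₙ ⋯ v₂ v₁` of `T(V)`, as a linear equivalence. -/
def rev : TensorAlgebra k V ≃ₗ[k] TensorAlgebra k V :=
  LinearEquiv.ofInvolutive (revAux k V) revAux_revAux

theorem rev_mul (x y : TensorAlgebra k V) : rev k V (x * y) = rev k V y * rev k V x :=
  revAux_mul x y

theorem rev_ι (v : V) : rev k V (ι k v) = ι k v := revAux_ι v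

theorem rev_algebraMap (c : k) : rev k V (algebraMap k _ c) = algebraMap k _ c :=
  revAux_algebraMap c

theorem rev_rev (x : TensorAlgebra k V) : rev k V (rev k V x) = x := revAux_revAux x

/-- The image of a subspace of `T(V)` under reversal. -/
def revMap (X : Submodule k (TensorAlgebra k V)) : Submodule k (TensorAlgebra k V) :=
  X.map (rev k V).toLinearMap

theorem mem_revMap {X : Submodule k (TensorAlgebra k V)} {x : TensorAlgebra k V} :
    x ∈ revMap X ↔ rev k V x ∈ X := by
  constructor
  · rintro ⟨y, hy, rfl⟩
    change rev k V (rev k V y) ∈ X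
    rwa [rev_rev]
  · exact fun h => ⟨_, h, rev_rev x⟩

theorem revMap_revMap (X : Submodule k (TensorAlgebra k V)) : revMap (revMap X) = X := by
  ext x
  rw [mem_revMap, mem_revMap, rev_rev]

theorem revMap_mono {X Y : Submodule k (TensorAlgebra k V)} (h : X ≤ Y) : revMap X ≤ revMap Y :=
  Submodule.map_mono h

theorem revMap_mul (X Y : Submodule k (TensorAlgebra k V)) :
    revMap (X * Y) = revMap Y * revMap X := by
  have key : ∀ X Y : Submodule k (TensorAlgebra k V),
      revMap (X * Y) ≤ revMap Y * revMap X := by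
    intro X Y
    rintro _ ⟨x, hx, rfl⟩
    refine Submodule.mul_induction_on hx ?_ ?_
    · intro a ha b hb
      change rev k V (a * b) ∈ _
      rw [rev_mul]
      exact Submodule.mul_mem_mul ⟨b, hb, rfl⟩ ⟨a, ha, rfl⟩
    · intro a b ha hb
      rw [map_add]
      exact add_mem ha hb
  refine le_antisymm (key X Y) ?_
  have := revMap_mono (key (revMap Y) (revMap X))
  rwa [revMap_revMap, revMap_revMap, revMap_revMap] at this

theorem revMap_sup (X Y : Submodule k (TensorAlgebra k V)) :
    revMap (X ⊔ Y) = revMap X ⊔ revMap Y :=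
  Submodule.map_sup _ _ _

theorem revMap_inf (X Y : Submodule k (TensorAlgebra k V)) :
    revMap (X ⊓ Y) = revMap X ⊓ revMap Y := by
  ext x
  simp [mem_revMap]

theorem revMap_iSup {κ : Sort*} (X : κ → Submodule k (TensorAlgebra k V)) :
    revMap (⨆ i, X i) = ⨆ i, revMap (X i) :=
  Submodule.map_iSup _ _

theorem revMap_iInf {κ : Sort*} (X : κ → Submodule k (TensorAlgebra k V)) :
    revMap (⨅ i, X i) = ⨅ i, revMap (X i) := by
  ext x
  simp [mem_revMap, Submodule.mem_iInf]

theorem revMap_top : revMap (⊤ : Submodule k (TensorAlgebra k V)) = ⊤ := by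
  ext x
  simp [mem_revMap]

theorem revMap_disjoint {X Y : Submodule k (TensorAlgebra k V)} (h : Disjoint X Y) :
    Disjoint (revMap X) (revMap Y) := by
  rw [disjoint_iff, ← revMap_inf, h.eq_bot]
  exact Submodule.map_bot _

theorem revMap_tpow (n : ℕ) : revMap (tpow k V n) = tpow k V n := by
  induction n with
  | zero =>
    ext x
    rw [tpow, pow_zero, mem_revMap, Submodule.mem_one, Submodule.mem_one]
    constructor
    · rintro ⟨c, hc⟩
      exact ⟨c, by rw [← rev_rev x, ← hc, rev_algebraMap]⟩
    · rintro ⟨c, rfl⟩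
      exact ⟨c, (rev_algebraMap c).symm⟩
  | succ n ih =>
    have h1 : revMap (tpow k V 1) = tpow k V 1 := by
      ext x
      rw [tpow, pow_one, mem_revMap]
      constructor
      · rintro ⟨v, hv⟩
        exact ⟨v, by rw [← rev_rev x, ← hv, rev_ι]⟩
      · rintro ⟨v, rfl⟩
        exact ⟨v, (rev_ι v).symm⟩
    rw [← tpow_mul_tpow, revMap_mul, ih, h1, tpow_mul_tpow, tpow_mul_tpow, add_comm]

theorem revMap_tpowInt (n : ℤ) : revMap (tpowInt k V n) = tpowInt k V n := by
  obtain n | n := n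
  · exact revMap_tpow n
  · exact Submodule.map_bot _

theorem algebraMapInv_rev (x : TensorAlgebra k V) :
    algebraMapInv (rev k V x) = algebraMapInv x := by
  induction x using TensorAlgebra.induction with
  | algebraMap c => rw [rev_algebraMap]
  | ι v => rw [rev_ι]
  | mul a b ha hb => rw [rev_mul, map_mul, map_mul, ha, hb, mul_comm]
  | add a b ha hb => rw [map_add, map_add, map_add, ha, hb]

theorem revMap_augIdeal : revMap (augIdeal k V) = augIdeal k V := by
  ext x
  rw [mem_revMap, mem_augIdeal, mem_augIdeal, algebraMapInv_rev]

theorem mul_tpow_disjoint [FiniteDimensional k V] {X Y : Submodule k (TensorAlgebra k V)}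
    (h : Disjoint X Y) (a : ℕ) : Disjoint (X * tpow k V a) (Y * tpow k V a) := by
  have := revMap_disjoint (tpow_mul_disjoint (revMap_disjoint h) a)
  simpa only [revMap_mul, revMap_revMap, revMap_tpow] using this

theorem projDeg_rev (n : ℕ) (x : TensorAlgebra k V) :
    projDeg k V n (rev k V x) = rev k V (projDeg k V n x) := by
  induction x using tensorAlgebra_induction with
  | hom m x hx =>
    have hx' : rev k V x ∈ tpow k V m := by
      rw [← mem_revMap, revMap_tpow]
      exact hx
    by_cases hmn : m = n
    · subst hmn
      rw [projDeg_of_mem hx, projDeg_of_mem hx']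
    · rw [projDeg_of_mem_ne hx hmn, projDeg_of_mem_ne hx' hmn, map_zero]
  | add x y hx hy => simp only [map_add, hx, hy]

end TensorAlg

/-! ### The relations and the grading of `A` -/

section Relations

variable {k : Type u} [Field k] {V : Type v} [AddCommGroup V] [Module k V]

open TensorAlgebra (ι algebraMapInv)

theorem augIdeal_le : augIdeal k V ≤ ⨆ n, tpow k V (n + 1) := by
  intro x hx
  refine mem_of_projDeg_mem fun n => ?_
  obtain _ | n := n
  · have h0 := isHomog_augIdeal 0 x hx
    have h1 := projDeg_mem 0 x
    rw [tpow, pow_zero] at h1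
    obtain ⟨c, hc⟩ := Submodule.mem_one.1 h1
    rw [mem_augIdeal, ← hc, AlgHom.commutes] at h0
    have h0 : c = 0 := h0
    rw [← hc, h0, map_zero]
    exact zero_mem _
  · exact Submodule.mem_iSup_of_mem n (projDeg_mem _ x)

namespace MultiHomogeneous

variable (D : MultiHomogeneous k V)

/-- The ideal of relations, as a subspace of `T(V)`. -/
def rel : Submodule k (TensorAlgebra k V) := D.ideal.restrictScalars k

theorem mul_mem_rel_left (x : TensorAlgebra k V) {y : TensorAlgebra k V} (hy : y ∈ D.rel) :
    x * y ∈ D.rel :=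
  D.ideal.mul_mem_left x hy

theorem mul_mem_rel_right {x : TensorAlgebra k V} (hx : x ∈ D.rel) (y : TensorAlgebra k V) :
    x * y ∈ D.rel :=
  D.ideal.mul_mem_right y hx

theorem quot_eq_zero_iff {x : TensorAlgebra k V} : D.quot x = 0 ↔ x ∈ D.rel :=
  Ideal.Quotient.eq_zero_iff_mem

theorem quot_surjective : Function.Surjective D.quot := Ideal.Quotient.mk_surjective

theorem aug_quot (x : TensorAlgebra k V) : D.aug (D.quot x) = algebraMapInv x := rfl

theorem R_le_rel {s : ℕ} (hs : s ∈ D.S) : D.R s ≤ D.rel := fun _ hx =>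
  TwoSidedIdeal.mem_asIdeal.2 (TwoSidedIdeal.subset_span ⟨s, hs, hx⟩)

theorem rel_eq : D.rel = ⨆ s ∈ D.S, ⊤ * D.R s * ⊤ := by
  apply le_antisymm
  · have hl : (⊤ : Submodule k (TensorAlgebra k V)) * (⨆ s ∈ D.S, ⊤ * D.R s * ⊤) ≤
        ⨆ s ∈ D.S, ⊤ * D.R s * ⊤ := by
      simp only [Submodule.mul_iSup, ← mul_assoc]
      gcongr
      exact le_top
    have hr : (⨆ s ∈ D.S, ⊤ * D.R s * ⊤) * (⊤ : Submodule k (TensorAlgebra k V)) ≤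
        ⨆ s ∈ D.S, ⊤ * D.R s * ⊤ := by
      simp only [Submodule.iSup_mul, mul_assoc]
      gcongr
      exact le_top
    intro x hx
    replace hx : x ∈ TwoSidedIdeal.span {x : TensorAlgebra k V | ∃ s ∈ D.S, x ∈ D.R s} :=
      TwoSidedIdeal.mem_asIdeal.1 hx
    induction hx using TwoSidedIdeal.span_induction with
    | mem x hx =>
      obtain ⟨s, hs, hx⟩ := hx
      refine Submodule.mem_iSup_of_mem s (Submodule.mem_iSup_of_mem hs ?_)
      have := Submodule.mul_mem_mul (Submodule.mul_mem_mul
        (Submodule.mem_top : (1 : TensorAlgebra k V) ∈ (⊤ : Submodule k _)) hx)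
        (Submodule.mem_top : (1 : TensorAlgebra k V) ∈ (⊤ : Submodule k _))
      simpa using this
    | zero => exact zero_mem _
    | add x y _ _ hx hy => exact add_mem hx hy
    | neg x _ hx => exact neg_mem hx
    | left_absorb a x _ hx => exact hl (Submodule.mul_mem_mul Submodule.mem_top hx)
    | right_absorb b x _ hx => exact hr (Submodule.mul_mem_mul hx Submodule.mem_top)
  · refine iSup₂_le fun s hs => ?_
    rw [Submodule.mul_le]
    intro x hx y _
    refine D.mul_mem_rel_right ?_ y
    refine (Submodule.mul_le.2 fun a _ b hb => ?_ : ⊤ * D.R s ≤ D.rel) hx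
    exact D.mul_mem_rel_left a (D.R_le_rel hs hb)

theorem isHomog_rel : IsHomog D.rel := by
  rw [rel_eq]
  exact isHomog_iSup fun s => isHomog_iSup fun hs =>
    (isHomog_top.mul (isHomog_of_le (D.R_le s hs))).mul isHomog_top

theorem rel_le_augIdeal : D.rel ≤ augIdeal k V := fun _ hx => D.algebraMapInv_ideal _ hx

/-- The degree `a` part of the ideal of relations, written through the generators. -/
def relDeg (a : ℕ) : Submodule k (TensorAlgebra k V) :=
  ⨆ t ∈ D.S.filter (fun t => t ≤ a), ⨆ j ∈ Finset.range (a - t + 1),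
    tpow k V j * D.R t * tpow k V (a - t - j)

theorem mul_le_relDeg {t p q a : ℕ} (ht : t ∈ D.S) (h : p + t + q = a) :
    tpow k V p * D.R t * tpow k V q ≤ D.relDeg a := by
  refine le_iSup₂_of_le t (Finset.mem_filter.2 ⟨ht, by omega⟩) ?_
  refine le_iSup₂_of_le p (Finset.mem_range.2 (by omega)) ?_
  rw [show a - t - p = q by omega]

theorem projDeg_mem_relDeg {x : TensorAlgebra k V} (hx : x ∈ D.rel) (a : ℕ) :
    projDeg k V a x ∈ D.relDeg a := by
  have h : D.rel ≤ ⨆ t ∈ D.S, ⨆ p, ⨆ q, tpow k V p * D.R t * tpow k V q := by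
    rw [rel_eq]
    refine iSup₂_mono fun t _ => ?_
    rw [← iSup_tpow, Submodule.iSup_mul, Submodule.iSup_mul]
    refine iSup_mono fun p => ?_
    rw [Submodule.mul_iSup]
  have h' : (⨆ t ∈ D.S, ⨆ p, ⨆ q, tpow k V p * D.R t * tpow k V q) ≤
      (D.relDeg a).comap (projDeg k V a) := by
    refine iSup₂_le fun t ht => iSup_le fun p => iSup_le fun q => ?_
    intro y hy
    have hy' : y ∈ tpow k V (p + t + q) := by
      rw [← tpow_mul_tpow, ← tpow_mul_tpow]
      have : tpow k V p * D.R t * tpow k V q ≤ tpow k V p * tpow k V t * tpow k V q :=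
        mul_le_mul' (mul_le_mul' le_rfl (D.R_le t ht)) le_rfl
      exact this hy
    change projDeg k V a y ∈ D.relDeg a
    by_cases ha : p + t + q = a
    · rw [projDeg_of_mem (ha ▸ hy')]
      exact D.mul_le_relDeg ht ha hy
    · rw [projDeg_of_mem_ne hy' ha]
      exact zero_mem _
  exact h' (h hx)

/-- The minimality condition: a relation of degree `s` is not a consequence of relations of
smaller degree. -/
theorem R_disjoint {s a : ℕ} (hs : s ∈ D.S) (ha : a < s) : Disjoint (D.R s)
    (D.relDeg a * tpow k V (s - a) ⊔
      ⨆ t ∈ D.S.filter (fun t => t < s), tpow k V (s - t) * D.R t) := by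
  refine (D.minimal s hs).mono_right (sup_le ?_ ?_)
  · simp only [relDeg, Submodule.iSup_mul]
    refine iSup₂_le fun t ht => iSup₂_le fun j hj => ?_
    obtain ⟨ht, hta⟩ := Finset.mem_filter.1 ht
    have hj := Finset.mem_range.1 hj
    refine le_iSup₂_of_le t (Finset.mem_filter.2 ⟨ht, by omega⟩) ?_
    refine le_iSup₂_of_le j (Finset.mem_range.2 (by omega)) ?_
    rw [mul_assoc, tpow_mul_tpow, show a - t - j + (s - a) = s - t - j by omega]
  · refine iSup₂_le fun t ht => ?_
    refine le_iSup₂_of_le t ht ?_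
    refine le_iSup₂_of_le (s - t) (Finset.mem_range.2 (by omega)) ?_
    rw [Nat.sub_self, mul_tpow_zero]

theorem mul_mem_grading {m n : ℕ} {a b : D.Alg} (ha : a ∈ D.grading m) (hb : b ∈ D.grading n) :
    a * b ∈ D.grading (m + n) := by
  obtain ⟨x, hx, rfl⟩ := ha
  obtain ⟨y, hy, rfl⟩ := hb
  exact ⟨x * y, mul_mem_tpow hx hy, map_mul D.quot x y⟩

theorem iSup_grading : iSup D.grading = ⊤ := by
  unfold grading
  rw [← Submodule.map_iSup, iSup_tpow, Submodule.map_top, LinearMap.range_eq_top]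
  exact D.quot_surjective

/-- The projection of `A` onto `A_n`. -/
def projAlg (n : ℕ) : D.Alg →ₗ[k] D.Alg :=
  Submodule.mapQ D.rel D.rel (projDeg k V n) fun x hx => D.isHomog_rel n x hx

theorem projAlg_of_mem {n : ℕ} {a : D.Alg} (ha : a ∈ D.grading n) : D.projAlg n a = a := by
  obtain ⟨x, hx, rfl⟩ := ha
  exact congrArg D.quot (projDeg_of_mem hx)

theorem projAlg_of_mem_ne {m n : ℕ} {a : D.Alg} (ha : a ∈ D.grading m) (h : m ≠ n) :
    D.projAlg n a = 0 := by
  obtain ⟨x, hx, rfl⟩ := ha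
  change D.quot (projDeg k V n x) = 0
  rw [projDeg_of_mem_ne hx h, map_zero]

theorem aug_eq_zero_of_mem {n : ℕ} (hn : n ≠ 0) {a : D.Alg} (ha : a ∈ D.grading n) :
    D.aug a = 0 := by
  obtain ⟨x, hx, rfl⟩ := ha
  exact algebraMapInv_eq_zero hn hx

theorem mem_iSup_grading_of_aug_eq_zero {a : D.Alg} (ha : D.aug a = 0) :
    a ∈ ⨆ n, D.grading (n + 1) := by
  obtain ⟨x, rfl⟩ := D.quot_surjective a
  rw [aug_quot] at ha
  have hx := augIdeal_le ha
  have := Submodule.mem_map_of_mem (f := D.quot.toLinearMap) hx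
  rwa [Submodule.map_iSup] at this

end MultiHomogeneous

end Relations

/-! ### Homogeneous left ideals of the tensor algebra are free -/

section Free

variable {k : Type u} [Field k] {V : Type v} [AddCommGroup V] [Module k V]

open TensorAlgebra (ι algebraMapInv)

/-- A homogeneous subspace has a homogeneous complement, chosen degree by degree. -/
theorem exists_homogeneous_complement {X L : Submodule k (TensorAlgebra k V)} (hX : IsHomog X)
    (hL : IsHomog L) (hXL : X ≤ L) :
    ∃ W, IsHomog W ∧ W ≤ L ∧ Disjoint W X ∧ L ≤ W ⊔ X := by
  choose c hc using fun n => exists_isCompl (X ⊓ tpow k V n)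
  let W : ℕ → Submodule k (TensorAlgebra k V) := fun n => c n ⊓ (L ⊓ tpow k V n)
  have hWX : ∀ n, L ⊓ tpow k V n ≤ W n ⊔ X ⊓ tpow k V n := by
    intro n x hx
    obtain ⟨y, hy, z, hz, rfl⟩ := Submodule.mem_sup.1
      ((hc n).sup_eq_top ▸ Submodule.mem_top : x ∈ X ⊓ tpow k V n ⊔ c n)
    refine add_mem (Submodule.mem_sup_right hy) (Submodule.mem_sup_left ⟨hz, ?_⟩)
    have := sub_mem hx (inf_le_inf_right _ hXL hy : y ∈ L ⊓ tpow k V n)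
    rwa [add_sub_cancel_left] at this
  have hproj : ∀ n x, x ∈ ⨆ m, W m → projDeg k V n x ∈ W n := by
    intro n x hx
    refine (iSup_le fun m => ?_ : (⨆ m, W m) ≤ (W n).comap (projDeg k V n)) hx
    intro y hy
    change projDeg k V n y ∈ W n
    by_cases hmn : m = n
    · subst hmn
      rwa [projDeg_of_mem hy.2.2]
    · rw [projDeg_of_mem_ne hy.2.2 hmn]
      exact zero_mem _
  refine ⟨⨆ n, W n, isHomog_iSup fun n => isHomog_of_le (inf_le_right.trans inf_le_right),
    iSup_le fun n => inf_le_right.trans inf_le_left, ?_, ?_⟩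
  · rw [Submodule.disjoint_def]
    intro x hxW hxX
    refine (Submodule.mem_bot k).1 (mem_of_projDeg_mem fun n => ?_)
    rw [← (hc n).inf_eq_bot]
    exact ⟨⟨hX n x hxX, projDeg_mem n x⟩, (hproj n x hxW).1⟩
  · intro x hx
    refine mem_of_projDeg_mem fun n => ?_
    have := hWX n ⟨hL n x hx, projDeg_mem n x⟩
    exact sup_le_sup (le_iSup W n) inf_le_left this

/-- Graded Nakayama lemma: a homogeneous left ideal is generated by a complement of
`T(V)_{>0} L`. -/
theorem le_mul_of_le_sup {W L : Submodule k (TensorAlgebra k V)} (hW : IsHomog W)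
    (hL : IsHomog L) (hLW : L ≤ W ⊔ augIdeal k V * L) : L ≤ ⊤ * W := by
  have hW' : W ≤ ⊤ * W := fun w hw => by
    simpa using Submodule.mul_mem_mul
      (Submodule.mem_top : (1 : TensorAlgebra k V) ∈ (⊤ : Submodule k _)) hw
  have hT : ∀ X : Submodule k (TensorAlgebra k V), X * (⊤ * W) ≤ ⊤ * W := fun X => by
    rw [← mul_assoc]
    exact mul_le_mul' le_top le_rfl
  have key : ∀ n, L ⊓ tpow k V n ≤ ⊤ * W := by
    intro n
    induction n using Nat.strong_induction_on with
    | _ n ih =>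
    -- The degree `n` part of `T(V)_{>0} L` involves only parts of `L` of degree less than `n`.
    have h1 : augIdeal k V * L ≤ (⊤ * W).comap (projDeg k V n) := by
      refine (mul_le_mul' augIdeal_le (isHomog_iff_le.1 hL)).trans ?_
      rw [Submodule.iSup_mul]
      refine iSup_le fun p => ?_
      rw [Submodule.mul_iSup]
      refine iSup_le fun m => ?_
      intro y hy
      have h2 : tpow k V (p + 1) * (L ⊓ tpow k V m) ≤ tpow k V (p + 1 + m) :=
        (mul_le_mul' le_rfl inf_le_right).trans_eq (tpow_mul_tpow _ _)
      change projDeg k V n y ∈ ⊤ * W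
      by_cases hn : p + 1 + m = n
      · rw [projDeg_of_mem (hn ▸ h2 hy)]
        exact ((mul_le_mul' le_rfl (ih m (by omega))).trans (hT _)) hy
      · rw [projDeg_of_mem_ne (h2 hy) hn]
        exact zero_mem _
    rintro x ⟨hx, hxn⟩
    obtain ⟨w, hw, y, hy, rfl⟩ := Submodule.mem_sup.1 (hLW hx)
    rw [← projDeg_of_mem hxn, map_add]
    exact add_mem (hW' (hW n w hw)) (h1 hy)
  intro x hx
  exact mem_of_projDeg_mem fun n => key n ⟨hL n x hx, projDeg_mem n x⟩

/-- Left multiplication `T(V) ⊗ W → T(V)`. -/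
def mulTensor (W : Submodule k (TensorAlgebra k V)) :
    TensorAlgebra k V ⊗[k] ↥W →ₗ[k] TensorAlgebra k V :=
  LinearMap.mul' k _ ∘ₗ W.subtype.lTensor _

theorem mulTensor_tmul (W : Submodule k (TensorAlgebra k V)) (x : TensorAlgebra k V) (w : W) :
    mulTensor W (x ⊗ₜ w) = x * w := by
  simp [mulTensor]

theorem range_mulTensor (W : Submodule k (TensorAlgebra k V)) :
    LinearMap.range (mulTensor W) = ⊤ * W := by
  apply le_antisymm
  · rintro _ ⟨u, rfl⟩
    induction u using TensorProduct.induction_on with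
    | zero => rw [map_zero]; exact zero_mem _
    | tmul x w =>
      rw [mulTensor_tmul]
      exact Submodule.mul_mem_mul Submodule.mem_top w.2
    | add x y hx hy => rw [map_add]; exact add_mem hx hy
  · rw [Submodule.mul_le]
    exact fun x _ w hw => ⟨x ⊗ₜ ⟨w, hw⟩, mulTensor_tmul W x _⟩

/-- Tensors whose left factor has degree less than `n`. -/
def tensorLT (W : Submodule k (TensorAlgebra k V)) (n : ℕ) :
    Submodule k (TensorAlgebra k V ⊗[k] ↥W) :=
  Submodule.span k {u | ∃ m < n, ∃ x ∈ tpow k V m, ∃ w : W, x ⊗ₜ w = u}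

theorem exists_mem_tensorLT (W : Submodule k (TensorAlgebra k V))
    (u : TensorAlgebra k V ⊗[k] ↥W) : ∃ n, u ∈ tensorLT W n := by
  have mono : ∀ {m n}, m ≤ n → tensorLT W m ≤ tensorLT W n := fun {m n} h =>
    Submodule.span_mono fun u ⟨l, hl, hu⟩ => ⟨l, by omega, hu⟩
  have add : ∀ u v, (∃ n, u ∈ tensorLT W n) → (∃ n, v ∈ tensorLT W n) →
      ∃ n, u + v ∈ tensorLT W n := fun u v ⟨m, hm⟩ ⟨n, hn⟩ =>
    ⟨max m n, add_mem (mono (le_max_left _ _) hm) (mono (le_max_right _ _) hn)⟩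
  induction u using TensorProduct.induction_on with
  | zero => exact ⟨0, zero_mem _⟩
  | tmul x w =>
    induction x using tensorAlgebra_induction with
    | hom n x hx => exact ⟨n + 1, Submodule.subset_span ⟨n, by omega, x, hx, w, rfl⟩⟩
    | add x y hx hy =>
      rw [TensorProduct.add_tmul]
      exact add _ _ hx hy
  | add u v hu hv => exact add _ _ hu hv

theorem lderiv_rTensor_mem {W : Submodule k (TensorAlgebra k V)} {n : ℕ} (φ : V →ₗ[k] k)
    {u : TensorAlgebra k V ⊗[k] ↥W} (hu : u ∈ tensorLT W (n + 1)) :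
    (lderiv φ).rTensor W u ∈ tensorLT W n := by
  refine (Submodule.span_le.2 ?_ :
    tensorLT W (n + 1) ≤ (tensorLT W n).comap ((lderiv φ).rTensor W)) hu
  rintro _ ⟨m, hm, x, hx, w, rfl⟩
  change (lderiv φ).rTensor W (x ⊗ₜ w) ∈ tensorLT W n
  rw [LinearMap.rTensor_tmul]
  obtain _ | m := m
  · rw [lderiv_of_mem_tpow_zero φ hx, TensorProduct.zero_tmul]
    exact zero_mem _
  · exact Submodule.subset_span ⟨m, by omega, _, lderiv_mem_tpow φ hx, w, rfl⟩

theorem mulTensor_mulLeft (W : Submodule k (TensorAlgebra k V)) (a : TensorAlgebra k V)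
    (u : TensorAlgebra k V ⊗[k] ↥W) :
    mulTensor W ((LinearMap.mulLeft k a).rTensor W u) = a * mulTensor W u := by
  induction u using TensorProduct.induction_on with
  | zero => simp
  | tmul x w => simp [mulTensor_tmul, mul_assoc]
  | add x y hx hy => simp only [map_add, hx, hy, mul_add]

/-- Left ideals of `T(V)` are free: a relation between elements of `W` with coefficients in `T(V)`
can be divided by letters on the left until it becomes a relation over `k`. -/
theorem mulTensor_injective [FiniteDimensional k V] {W : Submodule k (TensorAlgebra k V)}
    (hW : Disjoint W (augIdeal k V * W)) : Function.Injective (mulTensor W) := by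
  let b := Module.finBasis k V
  -- A tensor is the sum of its constant term and of its left derivatives multiplied by letters.
  have expand : ∀ u : TensorAlgebra k V ⊗[k] ↥W,
      u = 1 ⊗ₜ TensorProduct.lid k W (algebraMapInv.toLinearMap.rTensor W u) +
        ∑ i, (LinearMap.mulLeft k (ι k (b i))).rTensor W ((lderiv (b.coord i)).rTensor W u) := by
    intro u
    induction u using TensorProduct.induction_on with
    | zero => simp
    | tmul x w =>
      conv_lhs => rw [eq_augmentation_add_sum b x]
      simp [TensorProduct.add_tmul, TensorProduct.sum_tmul, Algebra.algebraMap_eq_smul_one,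
        TensorProduct.smul_tmul]
    | add x y hx hy =>
      conv_lhs => rw [hx, hy]
      simp only [map_add, TensorProduct.tmul_add, Finset.sum_add_distrib]
      abel
  rw [← LinearMap.ker_eq_bot, LinearMap.ker_eq_bot']
  intro u hu
  obtain ⟨n, hn⟩ := exists_mem_tensorLT W u
  induction n generalizing u with
  | zero =>
    have : tensorLT W 0 = ⊥ := by
      rw [tensorLT, Submodule.span_eq_bot]
      rintro _ ⟨m, hm, -⟩
      omega
    rwa [this, Submodule.mem_bot] at hn
  | succ n ih =>
    set w := TensorProduct.lid k W (algebraMapInv.toLinearMap.rTensor W u) with hw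
    set D := fun i => (lderiv (b.coord i)).rTensor W u with hD
    have hu' : (w : TensorAlgebra k V) + ∑ i, ι k (b i) * mulTensor W (D i) = 0 := by
      rw [← hu]
      conv_rhs => rw [expand u]
      simp only [map_add, map_sum, mulTensor_mulLeft, mulTensor_tmul, one_mul]
      rfl
    have hsum : ∑ i, ι k (b i) * mulTensor W (D i) ∈ augIdeal k V * W := by
      refine Submodule.sum_mem _ fun i _ => ?_
      have h1 : mulTensor W (D i) ∈ ⊤ * W := by
        rw [← range_mulTensor]
        exact ⟨_, rfl⟩
      have h2 := Submodule.mul_mem_mul (ι_mem_tpow (k := k) (b i)) h1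
      rwa [← mul_assoc, tpow_one_mul_top] at h2
    -- The constant term lies both in `W` and in `T(V)_{>0} W`.
    have hw0 : (w : TensorAlgebra k V) = 0 := by
      refine Submodule.disjoint_def.1 hW _ w.2 ?_
      rw [eq_neg_of_add_eq_zero_left hu']
      exact neg_mem hsum
    rw [hw0, zero_add] at hu'
    -- Left derivation along `b j` isolates the `j`-th summand, a relation of smaller degree.
    have hD0 : ∀ j, D j = 0 := by
      intro j
      refine ih (D j) ?_ (lderiv_rTensor_mem _ hn)
      have := congrArg (lderiv (b.coord j)) hu'
      rw [map_sum, map_zero, Finset.sum_eq_single j] at this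
      · simpa [lderiv_ι_mul] using this
      · intro i _ hij
        simp [lderiv_ι_mul, hij]
      · simp
    have hw0' : w = 0 := Subtype.ext hw0
    rw [expand u, ← hw, hw0', TensorProduct.tmul_zero, zero_add]
    exact Finset.sum_eq_zero fun i _ => by
      change (LinearMap.mulLeft k (ι k (b i))).rTensor W (D i) = 0
      rw [hD0, map_zero]

end Free

/-! ### The Gruenberg resolution -/

section Gruenberg

variable {k : Type u} [Field k] {V : Type v} [AddCommGroup V] [Module k V]

open TensorAlgebra (ι algebraMapInv)

namespace MultiHomogeneous

variable (D : MultiHomogeneous k V)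

/-- The descending chain of left ideals `T ⊇ 𝔪 ⊇ I ⊇ I𝔪 ⊇ I² ⊇ ⋯` of `T = T(V)`, where
`𝔪 = T(V)_{>0}` and `I` is the ideal of relations. -/
def chain : ℕ → Submodule k (TensorAlgebra k V)
  | 0 => ⊤
  | 1 => augIdeal k V
  | i + 2 => D.rel * chain i

theorem rel_mul_top : D.rel * ⊤ = D.rel := by
  refine le_antisymm (Submodule.mul_le.2 fun x hx y _ => D.mul_mem_rel_right hx y) fun x hx => ?_
  simpa using Submodule.mul_mem_mul hx
    (Submodule.mem_top : (1 : TensorAlgebra k V) ∈ (⊤ : Submodule k _))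

theorem top_mul_rel : ⊤ * D.rel = D.rel := by
  refine le_antisymm (Submodule.mul_le.2 fun x _ y hy => D.mul_mem_rel_left x hy) fun x hx => ?_
  simpa using Submodule.mul_mem_mul
    (Submodule.mem_top : (1 : TensorAlgebra k V) ∈ (⊤ : Submodule k _)) hx

theorem mul_mem_chain (x : TensorAlgebra k V) : ∀ (i : ℕ) {y : TensorAlgebra k V},
    y ∈ D.chain i → x * y ∈ D.chain i
  | 0, _, _ => trivial
  | 1, _, hy => mul_mem_augIdeal_right x hy
  | i + 2, y, hy => by
    have := Submodule.mul_mem_mul (Submodule.mem_top : x ∈ (⊤ : Submodule k _)) hy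
    rwa [chain, ← mul_assoc, top_mul_rel] at this

theorem mul_chain_le (X : Submodule k (TensorAlgebra k V)) (i : ℕ) :
    X * D.chain i ≤ D.chain i :=
  Submodule.mul_le.2 fun x _ _ hy => D.mul_mem_chain x i hy

theorem chain_succ_le : ∀ i, D.chain (i + 1) ≤ D.chain i
  | 0 => le_top
  | 1 => by
    change D.rel * ⊤ ≤ augIdeal k V
    rw [rel_mul_top]
    exact D.rel_le_augIdeal
  | i + 2 => mul_le_mul' le_rfl (chain_succ_le i)

theorem chain_add_two_le_mul (i : ℕ) : D.chain (i + 2) ≤ augIdeal k V * D.chain i :=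
  mul_le_mul' D.rel_le_augIdeal le_rfl

theorem isHomog_chain : ∀ i, IsHomog (D.chain i)
  | 0 => isHomog_top
  | 1 => isHomog_augIdeal
  | i + 2 => D.isHomog_rel.mul (isHomog_chain i)

/-- The left ideal of `T(V)` underlying `chain`. -/
def chainIdeal (i : ℕ) : Submodule (TensorAlgebra k V) (TensorAlgebra k V) :=
  { D.chain i with smul_mem' := fun x _ hy => D.mul_mem_chain x i hy }

/-- The subquotient of the chain by the second next ideal, the term in degree `i` of the Gruenberg
resolution. -/
def Gruenberg (i : ℕ) : Type (max u v) :=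
  ↥(D.chainIdeal i) ⧸ Submodule.comap (D.chainIdeal i).subtype (D.chainIdeal (i + 2))

instance (i : ℕ) : AddCommGroup (D.Gruenberg i) := by
  unfold Gruenberg
  infer_instance

instance (i : ℕ) : Module (TensorAlgebra k V) (D.Gruenberg i) := by
  unfold Gruenberg
  infer_instance

instance (i : ℕ) : Module k (D.Gruenberg i) := by
  unfold Gruenberg
  infer_instance

instance (i : ℕ) : IsScalarTower k (TensorAlgebra k V) (D.Gruenberg i) := by
  unfold Gruenberg
  infer_instance

/-- The quotient map onto a term of the Gruenberg resolution. -/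
def toGruenberg (i : ℕ) : ↥(D.chain i) →ₗ[k] D.Gruenberg i where
  toFun x := Submodule.Quotient.mk
    (p := Submodule.comap (D.chainIdeal i).subtype (D.chainIdeal (i + 2))) x
  map_add' _ _ := rfl
  map_smul' _ _ := rfl

theorem toGruenberg_surjective (i : ℕ) : Function.Surjective (D.toGruenberg i) :=
  Submodule.Quotient.mk_surjective (Submodule.comap (D.chainIdeal i).subtype
    (D.chainIdeal (i + 2)))

theorem toGruenberg_eq_zero_iff {i : ℕ} {x : D.chain i} :
    D.toGruenberg i x = 0 ↔ (x : TensorAlgebra k V) ∈ D.chain (i + 2) :=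
  Submodule.Quotient.mk_eq_zero _

theorem isTorsionBySet_gruenberg (i : ℕ) :
    Module.IsTorsionBySet (TensorAlgebra k V) (D.Gruenberg i) D.ideal := by
  rintro y ⟨a, ha⟩
  obtain ⟨x, rfl⟩ := D.toGruenberg_surjective i y
  exact (D.toGruenberg_eq_zero_iff (x := ⟨a * x, D.mul_mem_chain a i x.2⟩)).2
    (Submodule.mul_mem_mul ha x.2)

instance (i : ℕ) : Module D.Alg (D.Gruenberg i) := (D.isTorsionBySet_gruenberg i).module

instance (i : ℕ) : IsScalarTower k D.Alg (D.Gruenberg i) :=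
  Module.IsTorsionBySet.isScalarTower (D.isTorsionBySet_gruenberg i)

theorem quot_smul_toGruenberg (i : ℕ) (a : TensorAlgebra k V) (x : D.chain i) :
    D.quot a • D.toGruenberg i x = D.toGruenberg i ⟨a * x, D.mul_mem_chain a i x.2⟩ := rfl

/-- If `W` is a homogeneous complement of `𝔪 L_i` in `L_i`, then `L_i = T ⊗ W`, and `L_i / I L_i` is
the free module `A ⊗ W`. -/
theorem projective_gruenberg [FiniteDimensional k V] (i : ℕ) :
    Module.Projective D.Alg (D.Gruenberg i) := by
  obtain ⟨W, hW, hWL, hdisj, hsup⟩ := exists_homogeneous_complement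
    (isHomog_augIdeal.mul (D.isHomog_chain i)) (D.isHomog_chain i) (D.mul_chain_le _ i)
  have hLW := le_mul_of_le_sup hW (D.isHomog_chain i) hsup
  have hinj := mulTensor_injective (hdisj.mono_right (mul_le_mul' le_rfl hWL))
  have hmem : ∀ u, mulTensor W u ∈ D.chain i := fun u => by
    have : mulTensor W u ∈ ⊤ * W := by
      rw [← range_mulTensor]
      exact ⟨u, rfl⟩
    exact (mul_le_mul' le_rfl hWL).trans (D.mul_chain_le ⊤ i) this
  let Φ : D.Alg ⊗[k] ↥W →ₗ[D.Alg] D.Gruenberg i :=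
    TensorProduct.AlgebraTensorModule.lift (LinearMap.toSpanSingleton D.Alg _
      (D.toGruenberg i ∘ₗ Submodule.inclusion hWL))
  have hΦ : ∀ u, Φ (D.quot.toLinearMap.rTensor W u) = D.toGruenberg i ⟨mulTensor W u, hmem u⟩ := by
    intro u
    induction u using TensorProduct.induction_on with
    | zero =>
      rw [map_zero, map_zero, eq_comm, D.toGruenberg_eq_zero_iff]
      simp
    | tmul x w =>
      change D.quot x • D.toGruenberg i _ = _
      rw [quot_smul_toGruenberg]
      exact congrArg _ (Subtype.ext (mulTensor_tmul W x w).symm)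
    | add x y hx hy =>
      rw [map_add, map_add, hx, hy, ← map_add]
      exact congrArg _ (Subtype.ext (map_add _ _ _).symm)
  have hq : Function.Surjective (D.quot.toLinearMap.rTensor W) :=
    LinearMap.rTensor_surjective W D.quot_surjective
  have hbij : Function.Bijective Φ := by
    constructor
    · rw [injective_iff_map_eq_zero]
      intro y hy
      obtain ⟨u, rfl⟩ := hq y
      rw [hΦ, D.toGruenberg_eq_zero_iff] at hy
      have h1 : D.chain (i + 2) ≤ D.rel * W := by
        refine (mul_le_mul' le_rfl hLW).trans_eq ?_
        rw [← mul_assoc, rel_mul_top]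
      -- An element of `I W` is the product of a tensor in the kernel of `T ⊗ W → A ⊗ W`, and the
      -- multiplication `T ⊗ W → T` is injective.
      have h2 : D.rel * W ≤
          (LinearMap.ker (D.quot.toLinearMap.rTensor W)).map (mulTensor W) := by
        rw [Submodule.mul_le]
        intro x hx w hw
        refine ⟨x ⊗ₜ ⟨w, hw⟩, ?_, mulTensor_tmul W x _⟩
        change D.quot x ⊗ₜ _ = 0
        rw [D.quot_eq_zero_iff.2 hx, TensorProduct.zero_tmul]
      obtain ⟨u', hu', he⟩ := h2 (h1 hy)
      rwa [← hinj he]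
    · intro y
      obtain ⟨⟨x, hx⟩, rfl⟩ := D.toGruenberg_surjective i y
      have hx' := hLW hx
      rw [← range_mulTensor] at hx'
      obtain ⟨u, rfl⟩ := hx'
      exact ⟨_, hΦ u⟩
  exact Module.Projective.of_equiv (LinearEquiv.ofBijective Φ hbij)

/-- The component of degree `n` of a term of the Gruenberg resolution. -/
def gruenbergDeg (i : ℕ) (n : ℤ) : Submodule k (D.Gruenberg i) :=
  ((tpowInt k V n).comap (D.chain i).subtype).map (D.toGruenberg i)

theorem isInternal_chain (i : ℕ) :
    DirectSum.IsInternal fun n => (tpowInt k V n).comap (D.chain i).subtype :=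
  isInternal_comap isInternal_tpowInt _ Subtype.val_injective fun n x =>
    ⟨⟨_, (D.isHomog_chain i).homComp_mem n x.2⟩, rfl⟩

theorem isInternal_gruenbergDeg (i : ℕ) : DirectSum.IsInternal (D.gruenbergDeg i) := by
  refine isInternal_map (D.isInternal_chain i) _ (D.toGruenberg_surjective i) ?_
  intro n x hx
  rw [toGruenberg_eq_zero_iff] at hx ⊢
  have := homComp_comm (D.isInternal_chain i) isInternal_tpowInt (D.chain i).subtype
    (fun n x hx => hx) n x
  have this' : homComp isInternal_tpowInt n (x : TensorAlgebra k V) =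
    (homComp (D.isInternal_chain i) n x : TensorAlgebra k V) := this
  rw [← this']
  exact (D.isHomog_chain (i + 2)).homComp_mem n hx

/-- The differential of the Gruenberg resolution, induced by the inclusions in the chain. -/
def gruenbergD (i : ℕ) : D.Gruenberg (i + 1) →ₗ[D.Alg] D.Gruenberg i where
  __ := descend (D.toGruenberg (i + 1)) (D.toGruenberg_surjective (i + 1))
    (D.toGruenberg i ∘ₗ Submodule.inclusion (D.chain_succ_le i))
    fun _ hx => D.toGruenberg_eq_zero_iff.2
      (D.chain_succ_le (i + 2) (D.toGruenberg_eq_zero_iff.1 hx))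
  map_smul' a y := by
    obtain ⟨a, rfl⟩ := D.quot_surjective a
    obtain ⟨x, rfl⟩ := D.toGruenberg_surjective _ y
    rw [quot_smul_toGruenberg]
    simp only [AddHom.toFun_eq_coe, LinearMap.coe_toAddHom, descend_apply, RingHom.id_apply]
    rfl

theorem gruenbergD_apply (i : ℕ) (x : D.chain (i + 1)) :
    D.gruenbergD i (D.toGruenberg (i + 1) x) = D.toGruenberg i ⟨x, D.chain_succ_le i x.2⟩ :=
  descend_apply _ _ _ _ x

/-- The augmentation of the Gruenberg resolution. -/
def gruenbergAug : D.Gruenberg 0 →ₗ[k] k :=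
  descend (D.toGruenberg 0) (D.toGruenberg_surjective 0)
    (algebraMapInv.toLinearMap ∘ₗ (D.chain 0).subtype)
    fun _ hx => D.chain_succ_le 1 (D.toGruenberg_eq_zero_iff.1 hx)

theorem gruenbergAug_apply (x : D.chain 0) :
    D.gruenbergAug (D.toGruenberg 0 x) = algebraMapInv (x : TensorAlgebra k V) :=
  descend_apply _ _ _ _ x

/-- The Gruenberg resolution of the trivial module. -/
def gruenbergResolution [FiniteDimensional k V] :
    GradedProjectiveResolution.{u, max u v, max u v} D.grading D.aug where
  P := D.Gruenberg
  deg := D.gruenbergDeg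
  isInternal := D.isInternal_gruenbergDeg
  smul_mem := by
    rintro i m n _ _ ⟨a, ha, rfl⟩ ⟨x, hx, rfl⟩
    exact ⟨⟨a * x, D.mul_mem_chain a i x.2⟩, mul_mem_tpowInt ha hx, rfl⟩
  projective := D.projective_gruenberg
  d := D.gruenbergD
  d_mem := by
    rintro i n _ ⟨x, hx, rfl⟩
    rw [gruenbergD_apply]
    exact ⟨_, hx, rfl⟩
  aug := D.gruenbergAug
  aug_smul := by
    intro a y
    obtain ⟨a, rfl⟩ := D.quot_surjective a
    obtain ⟨x, rfl⟩ := D.toGruenberg_surjective _ y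
    rw [quot_smul_toGruenberg, gruenbergAug_apply, gruenbergAug_apply, map_mul, aug_quot]
  aug_eq_zero := by
    rintro n _ ⟨x, hx, rfl⟩ hn
    rw [gruenbergAug_apply]
    obtain n | n := n
    · exact algebraMapInv_eq_zero (fun h => hn (by rw [h]; rfl)) hx
    · have hx : (x : TensorAlgebra k V) = 0 := (Submodule.mem_bot k).1 hx
      rw [hx, map_zero]
  aug_surjective := fun c => ⟨D.toGruenberg 0 ⟨algebraMap k _ c, trivial⟩, by
    rw [gruenbergAug_apply, AlgHom.commutes]
    rfl⟩
  exact_zero := by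
    intro y
    obtain ⟨x, rfl⟩ := D.toGruenberg_surjective _ y
    rw [gruenbergAug_apply]
    constructor
    · intro hx
      exact ⟨D.toGruenberg 1 ⟨x, hx⟩, D.gruenbergD_apply 0 _⟩
    · rintro ⟨z, hz⟩
      obtain ⟨z, rfl⟩ := D.toGruenberg_surjective _ z
      rw [gruenbergD_apply, ← sub_eq_zero, ← map_sub, toGruenberg_eq_zero_iff] at hz
      have := sub_mem (show (z : TensorAlgebra k V) ∈ augIdeal k V from z.2)
        (D.chain_succ_le 1 hz : _ ∈ augIdeal k V)
      have e : (x : TensorAlgebra k V) ∈ augIdeal k V := by simpa using this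
      exact e
  exact_succ := by
    intro i y
    obtain ⟨x, rfl⟩ := D.toGruenberg_surjective _ y
    rw [gruenbergD_apply, toGruenberg_eq_zero_iff]
    constructor
    · intro hx
      exact ⟨D.toGruenberg (i + 2) ⟨x, hx⟩, D.gruenbergD_apply (i + 1) _⟩
    · rintro ⟨z, hz⟩
      obtain ⟨z, rfl⟩ := D.toGruenberg_surjective _ z
      rw [gruenbergD_apply, ← sub_eq_zero, ← map_sub, toGruenberg_eq_zero_iff] at hz
      have := sub_mem (show (z : TensorAlgebra k V) ∈ D.chain (i + 2) from z.2)
        (D.chain_succ_le (i + 2) hz)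
      simpa using this

/-- Govorov's formula for `Tor_{i+1}(k, k)`: for `i + 1 = 2l` it reads
`(I^l ∩ 𝔪 I^{l-1} 𝔪) / (𝔪 I^l + I^l 𝔪)`, and for `i + 1 = 2l + 1` it reads
`(I^l 𝔪 ∩ 𝔪 I^l) / (𝔪 I^l 𝔪 + I^{l+1})`. -/
abbrev Govorov (i : ℕ) (n : ℤ) : Type (max u v) :=
  SubQuot (tpowInt k V n ⊓ D.chain (i + 1) ⊓ augIdeal k V * D.chain i)
    (augIdeal k V * D.chain (i + 1) ⊔ D.chain (i + 2))

/-- The image of a subspace of `T(V)` in a term of the Gruenberg resolution. -/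
def gruenbergImage (i : ℕ) (X : Submodule k (TensorAlgebra k V)) : Submodule k (D.Gruenberg i) :=
  (X.comap (D.chain i).subtype).map (D.toGruenberg i)

theorem toGruenberg_mem_image_iff {i : ℕ} {X : Submodule k (TensorAlgebra k V)}
    (hX : X ≤ D.chain i) {x : D.chain i} : D.toGruenberg i x ∈ D.gruenbergImage i X ↔
      (x : TensorAlgebra k V) ∈ X ⊔ D.chain (i + 2) := by
  constructor
  · rintro ⟨y, hy, hyx⟩
    rw [eq_comm, ← sub_eq_zero, ← map_sub, toGruenberg_eq_zero_iff] at hyx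
    exact Submodule.mem_sup.2 ⟨y, hy, _, hyx, by simp⟩
  · intro hx
    obtain ⟨y, hy, z, hz, hyz⟩ := Submodule.mem_sup.1 hx
    refine ⟨⟨y, hX hy⟩, hy, ?_⟩
    rw [eq_comm, ← sub_eq_zero, ← map_sub, toGruenberg_eq_zero_iff]
    simpa [← hyz] using hz

theorem augSpan_gruenbergImage {i : ℕ} {X : Submodule k (TensorAlgebra k V)}
    (hX : X ≤ D.chain i) : augSpan D.aug (D.gruenbergImage i X) =
      D.gruenbergImage i (augIdeal k V * X) := by
  apply le_antisymm
  · refine augSpan_le ?_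
    rintro a ha _ ⟨x, hx, rfl⟩
    obtain ⟨a, rfl⟩ := D.quot_surjective a
    exact ⟨⟨a * x, D.mul_mem_chain a i x.2⟩, Submodule.mul_mem_mul ha hx, rfl⟩
  · rintro _ ⟨⟨y, hy'⟩, hy, rfl⟩
    have key : ∀ y ∈ augIdeal k V * X, ∃ hy' : y ∈ D.chain i,
        D.toGruenberg i ⟨y, hy'⟩ ∈ augSpan D.aug (D.gruenbergImage i X) := by
      intro y hy
      refine Submodule.mul_induction_on hy ?_ ?_
      · intro a ha x hx
        refine ⟨D.mul_mem_chain a i (hX hx), ?_⟩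
        exact smul_mem_augSpan (a := D.quot a) (x := D.toGruenberg i ⟨x, hX hx⟩) ha ⟨_, hx, rfl⟩
      · rintro x y ⟨hx, hx'⟩ ⟨hy, hy'⟩
        exact ⟨add_mem hx hy, add_mem hx' hy'⟩
    exact (key y hy).2

/-- The cycles in degree `i` are the image of the next ideal of the chain. -/
theorem cyc_gruenberg [FiniteDimensional k V] : ∀ i,
    D.gruenbergResolution.toComplex.cyc i = D.gruenbergImage i (D.chain (i + 1)) := by
  intro i
  ext y
  obtain ⟨x, rfl⟩ := D.toGruenberg_surjective _ y
  refine Iff.trans ?_ (D.toGruenberg_mem_image_iff (D.chain_succ_le i)).symm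
  rw [sup_of_le_left (D.chain_succ_le (i + 1))]
  obtain _ | i := i
  · change D.gruenbergAug _ = 0 ↔ _
    rw [gruenbergAug_apply]
    rfl
  · change D.gruenbergD i _ = 0 ↔ _
    rw [gruenbergD_apply, toGruenberg_eq_zero_iff]

theorem govorov_equiv [FiniteDimensional k V] (i : ℕ) (n : ℤ) :
    Nonempty (D.Govorov i n ≃ₗ[k] D.gruenbergResolution.toComplex.cycTor i n) := by
  have hcyc := D.cyc_gruenberg i
  have htop : (⊤ : Submodule k (D.Gruenberg i)) = D.gruenbergImage i (D.chain i) := by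
    rw [eq_comm, eq_top_iff]
    rintro y -
    obtain ⟨x, rfl⟩ := D.toGruenberg_surjective _ y
    exact ⟨x, x.2, rfl⟩
  have hB : augSpan D.aug (D.gruenbergResolution.toComplex.cyc i) =
      D.gruenbergImage i (augIdeal k V * D.chain (i + 1)) := by
    rw [hcyc]
    exact D.augSpan_gruenbergImage (D.chain_succ_le i)
  have hX : (augSpan D.aug ⊤ : Submodule k (D.Gruenberg i)) =
      D.gruenbergImage i (augIdeal k V * D.chain i) := by
    rw [htop]
    exact D.augSpan_gruenbergImage le_rfl
  have e : ∀ x : ↥(tpowInt k V n ⊓ D.chain (i + 1) ⊓ augIdeal k V * D.chain i),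
    (x : TensorAlgebra k V) ∈ D.chain i := fun x => D.chain_succ_le i x.2.1.2
  refine subQuot_equiv (D.toGruenberg i ∘ₗ (Submodule.subtype _).codRestrict _ e) ?_ ?_ ?_
  · rintro ⟨x, ⟨hx1, hx2⟩, hx3⟩
    refine ⟨⟨⟨_, hx1, rfl⟩, ?_⟩, ?_⟩
    · rw [hcyc]
      exact ⟨_, hx2, rfl⟩
    · exact hX ▸ ⟨_, hx3, rfl⟩
  · intro x
    rw [hB]
    exact D.toGruenberg_mem_image_iff ((D.mul_chain_le _ _).trans (D.chain_succ_le i))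
  · rintro _ ⟨⟨⟨x, hxn, rfl⟩, hx2⟩, hx3⟩
    have hx2' : D.toGruenberg i x ∈ D.gruenbergImage i (D.chain (i + 1)) := hcyc ▸ hx2
    have hx3' : D.toGruenberg i x ∈ D.gruenbergImage i (augIdeal k V * D.chain i) := hX ▸ hx3
    rw [toGruenberg_mem_image_iff _ (D.chain_succ_le i),
      sup_of_le_left (D.chain_succ_le (i + 1))] at hx2'
    rw [toGruenberg_mem_image_iff _ (D.mul_chain_le _ i),
      sup_of_le_left (D.chain_add_two_le_mul i)] at hx3'
    refine ⟨⟨x, ⟨hxn, hx2'⟩, hx3'⟩, ?_⟩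
    change D.toGruenberg i x - D.toGruenberg i x ∈ _
    rw [sub_self]
    exact zero_mem _

end MultiHomogeneous

end Gruenberg

/-! ### The Koszul complex -/

section Koszul

variable {k : Type u} [Field k] {V : Type v} [AddCommGroup V] [Module k V]

open TensorAlgebra (ι algebraMapInv)

namespace MultiHomogeneous

variable (D : MultiHomogeneous k V)

/-- The component of total degree `n` of `A ⊗ T(V)`. -/
def totalDeg (n : ℤ) : Submodule k (D.Alg ⊗[k] TensorAlgebra k V) :=
  Submodule.span k {z | ∃ p q : ℕ, ((p + q : ℕ) : ℤ) = n ∧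
    ∃ a ∈ D.grading p, ∃ x ∈ tpow k V q, a ⊗ₜ x = z}

theorem tmul_mem_totalDeg {p q : ℕ} {n : ℤ} (h : ((p + q : ℕ) : ℤ) = n) {a : D.Alg}
    (ha : a ∈ D.grading p) {x : TensorAlgebra k V} (hx : x ∈ tpow k V q) :
    a ⊗ₜ[k] x ∈ D.totalDeg n :=
  Submodule.subset_span ⟨p, q, h, a, ha, x, hx, rfl⟩

theorem totalDeg_le {n : ℤ} {X : Submodule k (D.Alg ⊗[k] TensorAlgebra k V)}
    (h : ∀ p q : ℕ, ((p + q : ℕ) : ℤ) = n → ∀ a ∈ D.grading p, ∀ x ∈ tpow k V q,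
      a ⊗ₜ[k] x ∈ X) : D.totalDeg n ≤ X := by
  refine Submodule.span_le.2 ?_
  rintro _ ⟨p, q, hpq, a, ha, x, hx, rfl⟩
  exact h p q hpq a ha x hx

/-- The projection of `A ⊗ T(V)` onto its component of bidegree `(p, q)`. -/
def biProj (p q : ℕ) : D.Alg ⊗[k] TensorAlgebra k V →ₗ[k] D.Alg ⊗[k] TensorAlgebra k V :=
  TensorProduct.map (D.projAlg p) (projDeg k V q)

theorem isInternal_totalDeg : DirectSum.IsInternal D.totalDeg := by
  -- The projection onto total degree `n` is the sum of those onto the bidegrees `(p, n - p)`.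
  let π : ℤ → (D.Alg ⊗[k] TensorAlgebra k V →ₗ[k] D.Alg ⊗[k] TensorAlgebra k V) := fun n =>
    match n with
    | Int.ofNat n => ∑ c ∈ Finset.HasAntidiagonal.antidiagonal n, D.biProj c.1 c.2
    | Int.negSucc _ => 0
  have hπ : ∀ (p q : ℕ) (n : ℤ), ∀ a ∈ D.grading p, ∀ x ∈ tpow k V q,
      π n (a ⊗ₜ[k] x) = if ((p + q : ℕ) : ℤ) = n then a ⊗ₜ[k] x else 0 := by
    intro p q n a ha x hx
    have hne : ∀ c : ℕ × ℕ, c ≠ (p, q) → D.biProj c.1 c.2 (a ⊗ₜ[k] x) = 0 := by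
      intro c hc
      rw [biProj, TensorProduct.map_tmul]
      by_cases h1 : p = c.1
      · have h2 : q ≠ c.2 := fun h2 => hc (Prod.ext h1.symm h2.symm)
        rw [projDeg_of_mem_ne hx h2, TensorProduct.tmul_zero]
      · rw [D.projAlg_of_mem_ne ha h1, TensorProduct.zero_tmul]
    obtain n | n := n
    · simp only [π, LinearMap.sum_apply]
      split_ifs with h
      · rw [Finset.sum_eq_single (p, q) (fun c _ hc => hne c hc)
          (fun h' => (h' (Finset.HasAntidiagonal.mem_antidiagonal.2 (Int.ofNat.inj h))).elim)]
        rw [biProj, TensorProduct.map_tmul, D.projAlg_of_mem ha, projDeg_of_mem hx]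
      · refine Finset.sum_eq_zero fun c hc => hne c fun h' => h ?_
        rw [← Finset.HasAntidiagonal.mem_antidiagonal.1 hc, h']
        rfl
    · rw [if_neg (by omega)]
      rfl
  refine isInternal_of_proj π ?_ ?_ ?_
  · intro n x hx
    refine (D.totalDeg_le fun p q hpq a ha x hx => ?_ :
      D.totalDeg n ≤ LinearMap.eqLocus (π n) LinearMap.id) hx
    exact (hπ p q n a ha x hx).trans (if_pos hpq)
  · intro m n hmn x hx
    refine (D.totalDeg_le fun p q hpq a ha x hx => ?_ :
      D.totalDeg m ≤ LinearMap.ker (π n)) hx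
    exact (hπ p q n a ha x hx).trans (if_neg (hpq ▸ hmn))
  · rw [eq_top_iff]
    rintro z -
    induction z using TensorProduct.induction_on with
    | zero => exact zero_mem _
    | add x y hx hy => exact add_mem hx hy
    | tmul a x =>
      induction a using graded_induction D.iSup_grading with
      | hom p a ha =>
        induction x using tensorAlgebra_induction with
        | hom q x hx => exact Submodule.mem_iSup_of_mem _ (D.tmul_mem_totalDeg rfl ha hx)
        | add x y hx hy => rw [TensorProduct.tmul_add]; exact add_mem hx hy
      | add a b ha hb => rw [TensorProduct.add_tmul]; exact add_mem ha hb

theorem smul_mem_totalDeg {m : ℕ} {n : ℤ} {a : D.Alg} {z : D.Alg ⊗[k] TensorAlgebra k V}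
    (ha : a ∈ D.grading m) (hz : z ∈ D.totalDeg n) : a • z ∈ D.totalDeg (m + n) := by
  refine (D.totalDeg_le fun p q hpq b hb x hx => ?_ : D.totalDeg n ≤
    (D.totalDeg (m + n)).comap (DistribSMul.toLinearMap k _ a)) hz
  exact D.tmul_mem_totalDeg (by omega) (D.mul_mem_grading ha hb) hx

/-- The subspace `A ⊗ X` of `A ⊗ T(V)`, for a subspace `X` of `T(V)`. -/
def extend (X : Submodule k (TensorAlgebra k V)) : Submodule k (D.Alg ⊗[k] TensorAlgebra k V) :=
  LinearMap.range (X.subtype.lTensor D.Alg)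

theorem tmul_mem_extend {X : Submodule k (TensorAlgebra k V)} (a : D.Alg)
    {x : TensorAlgebra k V} (hx : x ∈ X) : a ⊗ₜ[k] x ∈ D.extend X :=
  ⟨a ⊗ₜ ⟨x, hx⟩, rfl⟩

theorem extend_le {X : Submodule k (TensorAlgebra k V)}
    {Y : Submodule k (D.Alg ⊗[k] TensorAlgebra k V)}
    (h : ∀ a, ∀ x ∈ X, D.quot a ⊗ₜ[k] x ∈ Y) : D.extend X ≤ Y := by
  rintro _ ⟨u, rfl⟩
  induction u using TensorProduct.induction_on with
  | zero => rw [map_zero]; exact zero_mem _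
  | tmul a x =>
    obtain ⟨a, rfl⟩ := D.quot_surjective a
    exact h a x x.2
  | add x y hx hy => rw [map_add]; exact add_mem hx hy

theorem extend_mono {X Y : Submodule k (TensorAlgebra k V)} (h : X ≤ Y) :
    D.extend X ≤ D.extend Y :=
  D.extend_le fun _ _ hx => D.tmul_mem_extend _ (h hx)

theorem smul_mem_extend {X : Submodule k (TensorAlgebra k V)} (a : D.Alg)
    {z : D.Alg ⊗[k] TensorAlgebra k V} (hz : z ∈ D.extend X) : a • z ∈ D.extend X :=
  (D.extend_le fun b _ hx => D.tmul_mem_extend (a • D.quot b) hx :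
    D.extend X ≤ (D.extend X).comap (DistribSMul.toLinearMap k _ a)) hz

theorem homComp_mem_extend {X : Submodule k (TensorAlgebra k V)} (hX : IsHomog X) (n : ℤ)
    {z : D.Alg ⊗[k] TensorAlgebra k V} (hz : z ∈ D.extend X) :
    homComp D.isInternal_totalDeg n z ∈ D.extend X := by
  refine (D.extend_le fun a x hx => ?_ : D.extend X ≤
    (D.extend X).comap (homComp D.isInternal_totalDeg n)) hz
  change homComp D.isInternal_totalDeg n _ ∈ D.extend X
  generalize D.quot a = a
  replace hx := isHomog_iff_le.1 hX hx
  induction a using graded_induction D.iSup_grading with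
  | hom p a ha =>
    induction hx using Submodule.iSup_induction' with
    | mem q x hx =>
      have hm := D.tmul_mem_totalDeg rfl ha hx.2
      by_cases hn : ((p + q : ℕ) : ℤ) = n
      · subst hn
        rw [homComp_of_mem _ hm]
        exact D.tmul_mem_extend a hx.1
      · rw [homComp_of_mem_ne _ hn hm]
        exact zero_mem _
    | zero => rw [TensorProduct.tmul_zero, map_zero]; exact zero_mem _
    | add x y _ _ hx hy => rw [TensorProduct.tmul_add, map_add]; exact add_mem hx hy
  | add a b ha hb => rw [TensorProduct.add_tmul, map_add]; exact add_mem ha hb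

/-- The map `ε ⊗ 1 : A ⊗ T(V) → T(V)`. -/
def augFst : D.Alg ⊗[k] TensorAlgebra k V →ₗ[k] TensorAlgebra k V :=
  (TensorProduct.lid k _).toLinearMap ∘ₗ D.aug.toLinearMap.rTensor _

theorem augFst_tmul (a : D.Alg) (x : TensorAlgebra k V) :
    D.augFst (a ⊗ₜ x) = D.aug a • x := by
  simp [augFst]

theorem augFst_smul (a : D.Alg) (z : D.Alg ⊗[k] TensorAlgebra k V) :
    D.augFst (a • z) = D.aug a • D.augFst z := by
  induction z using TensorProduct.induction_on with
  | zero => simp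
  | tmul b x => rw [TensorProduct.smul_tmul', augFst_tmul, augFst_tmul, smul_eq_mul, map_mul,
      mul_smul]
  | add x y hx hy => rw [smul_add, map_add, map_add, smul_add, hx, hy]

theorem augFst_mem {X : Submodule k (TensorAlgebra k V)} {z : D.Alg ⊗[k] TensorAlgebra k V}
    (hz : z ∈ D.extend X) : D.augFst z ∈ X := by
  refine (D.extend_le fun a x hx => ?_ : D.extend X ≤ X.comap D.augFst) hz
  change D.augFst _ ∈ X
  rw [augFst_tmul]
  exact X.smul_mem _ hx

theorem augFst_mem_tpowInt {n : ℤ} {z : D.Alg ⊗[k] TensorAlgebra k V} (hz : z ∈ D.totalDeg n) :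
    D.augFst z ∈ tpowInt k V n := by
  refine (D.totalDeg_le fun p q hpq a ha x hx => ?_ :
    D.totalDeg n ≤ (tpowInt k V n).comap D.augFst) hz
  change D.augFst _ ∈ tpowInt k V n
  rw [augFst_tmul]
  by_cases hp : p = 0
  · subst hp
    have : n = (q : ℤ) := by omega
    subst this
    exact Submodule.smul_mem _ _ hx
  · rw [D.aug_eq_zero_of_mem hp ha, zero_smul]
    exact zero_mem _

/-- Modulo `A_{>0} ⊗ X`, an element of `A ⊗ X` is determined by its image under `ε ⊗ 1`. -/
theorem sub_augFst_mem {X : Submodule k (TensorAlgebra k V)} {z : D.Alg ⊗[k] TensorAlgebra k V}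
    (hz : z ∈ D.extend X) : z - 1 ⊗ₜ D.augFst z ∈ augSpan D.aug (D.extend X) := by
  refine (D.extend_le fun a x hx => ?_ : D.extend X ≤ (augSpan D.aug (D.extend X)).comap
    (LinearMap.id - (TensorProduct.mk k D.Alg _ 1) ∘ₗ D.augFst)) hz
  change D.quot a ⊗ₜ x - 1 ⊗ₜ D.augFst (D.quot a ⊗ₜ x) ∈ augSpan D.aug (D.extend X)
  have e : D.quot a ⊗ₜ[k] x - 1 ⊗ₜ D.augFst (D.quot a ⊗ₜ x) =
      (D.quot a - algebraMap k _ (D.aug (D.quot a))) • (1 : D.Alg) ⊗ₜ[k] x := by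
    rw [augFst_tmul, TensorProduct.smul_tmul', smul_eq_mul, mul_one, TensorProduct.sub_tmul,
      Algebra.algebraMap_eq_smul_one, TensorProduct.tmul_smul, TensorProduct.smul_tmul']
  rw [e]
  refine smul_mem_augSpan ?_ (D.tmul_mem_extend 1 hx)
  rw [map_sub, AlgHom.commutes, Algebra.algebraMap_self, RingHom.id_apply, sub_self]

theorem augFst_eq_zero {X : Submodule k (D.Alg ⊗[k] TensorAlgebra k V)}
    {z : D.Alg ⊗[k] TensorAlgebra k V} (hz : z ∈ augSpan D.aug X) : D.augFst z = 0 := by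
  refine (augSpan_le fun a ha x _ => ?_ : augSpan D.aug X ≤ LinearMap.ker D.augFst) hz
  rw [LinearMap.mem_ker, augFst_smul, ha, zero_smul]

/-! ### The differentials -/

theorem shiftL_tmul_ι_mul (a : D.Alg) (v : V) (x : TensorAlgebra k V) :
    D.shiftL (a ⊗ₜ (ι k v * x)) = (a * D.quot (ι k v)) ⊗ₜ x := by
  simp [shiftL, splitLeft_ι_mul]

theorem shiftL_smul (a : D.Alg) (z : D.Alg ⊗[k] TensorAlgebra k V) :
    D.shiftL (a • z) = a • D.shiftL z := by
  induction z using TensorProduct.induction_on with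
  | zero => simp
  | add x y hx hy => rw [smul_add, map_add, map_add, smul_add, hx, hy]
  | tmul b x =>
    rw [TensorProduct.smul_tmul', smul_eq_mul]
    simp only [shiftL, LinearMap.comp_apply, LinearMap.lTensor_tmul, LinearEquiv.coe_coe]
    induction splitLeft k V x using TensorProduct.induction_on with
    | zero => simp
    | add x y hx hy => simp only [TensorProduct.tmul_add, map_add, smul_add, hx, hy]
    | tmul v x => simp [TensorProduct.smul_tmul', mul_assoc]

/-- The `a`-th power of `shiftL` multiplies the first `a` letters of a word into `A`. -/
theorem shiftL_pow_tmul {a : ℕ} (α : D.Alg) {x : TensorAlgebra k V} (hx : x ∈ tpow k V a)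
    (y : TensorAlgebra k V) : (D.shiftL ^ a) (α ⊗ₜ (x * y)) = (α * D.quot x) ⊗ₜ y := by
  induction a generalizing α x with
  | zero =>
    rw [tpow, pow_zero] at hx
    obtain ⟨c, rfl⟩ := Submodule.mem_one.1 hx
    rw [pow_zero, Module.End.one_apply, AlgHom.commutes, ← Algebra.smul_def, ← Algebra.commutes,
      ← Algebra.smul_def, TensorProduct.smul_tmul]
  | succ a ih =>
    rw [add_comm, ← tpow_mul_tpow] at hx
    induction hx using tpow_one_mul_induction with
    | mul v x hx =>
      rw [pow_succ, Module.End.mul_apply, mul_assoc, shiftL_tmul_ι_mul, ih _ hx, map_mul,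
        mul_assoc]
    | add x _ x' _ hx hx' =>
      rw [add_mul, TensorProduct.tmul_add, map_add, hx, hx', map_add, mul_add,
        TensorProduct.add_tmul]

theorem shiftL_pow_smul (n : ℕ) (a : D.Alg) (z : D.Alg ⊗[k] TensorAlgebra k V) :
    (D.shiftL ^ n) (a • z) = a • (D.shiftL ^ n) z := by
  induction n generalizing z with
  | zero => rfl
  | succ n ih => rw [pow_succ, Module.End.mul_apply, Module.End.mul_apply, shiftL_smul, ih]

theorem shiftL_pow_tmul_mem {a : ℕ} (ha : a ≠ 0) {X : Submodule k (TensorAlgebra k V)}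
    (α : D.Alg) {x : TensorAlgebra k V} (hx : x ∈ tpow k V a * X) :
    (D.shiftL ^ a) (α ⊗ₜ x) ∈ augSpan D.aug (D.extend X) := by
  have : tpow k V a * X ≤ (augSpan D.aug (D.extend X)).comap
      ((D.shiftL ^ a) ∘ₗ TensorProduct.mk k D.Alg _ α) := by
    rw [Submodule.mul_le]
    intro u hu w hw
    change (D.shiftL ^ a) (α ⊗ₜ (u * w)) ∈ augSpan D.aug (D.extend X)
    rw [shiftL_pow_tmul D α hu]
    have : (α * D.quot u) ⊗ₜ[k] w = (α * D.quot u) • (1 : D.Alg) ⊗ₜ[k] w := by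
      rw [TensorProduct.smul_tmul', smul_eq_mul, mul_one]
    rw [this]
    refine smul_mem_augSpan ?_ (D.tmul_mem_extend 1 hw)
    rw [map_mul, aug_quot, algebraMapInv_eq_zero ha hu, mul_zero]
  exact this hx

theorem shiftL_pow_mem_totalDeg {a p q : ℕ} {α : D.Alg} (hα : α ∈ D.grading p)
    {x : TensorAlgebra k V} (hx : x ∈ tpow k V (a + q)) :
    (D.shiftL ^ a) (α ⊗ₜ x) ∈ D.totalDeg ((p + (a + q) : ℕ) : ℤ) := by
  have : tpow k V a * tpow k V q ≤ (D.totalDeg ((p + (a + q) : ℕ) : ℤ)).comap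
      ((D.shiftL ^ a) ∘ₗ TensorProduct.mk k D.Alg _ α) := by
    rw [Submodule.mul_le]
    intro u hu w hw
    change (D.shiftL ^ a) (α ⊗ₜ (u * w)) ∈ D.totalDeg ((p + (a + q) : ℕ) : ℤ)
    rw [shiftL_pow_tmul D α hu]
    exact D.tmul_mem_totalDeg (by omega) (D.mul_mem_grading hα ⟨u, hu, rfl⟩) hw
  rw [tpow_mul_tpow] at this
  exact this hx

theorem deltaL_smul : ∀ (i : ℕ) (a : D.Alg) (z : D.Alg ⊗[k] TensorAlgebra k V),
    D.deltaL i (a • z) = a • D.deltaL i z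
  | 0, a, z => by simp [deltaL]
  | 1, a, z => D.shiftL_smul a z
  | i + 2, a, z => by
    simp only [deltaL, LinearMap.sum_apply, LinearMap.comp_apply, Finset.smul_sum]
    refine Finset.sum_congr rfl fun s _ => ?_
    rw [← shiftL_pow_smul]
    congr 1
    induction z using TensorProduct.induction_on with
    | zero => simp
    | tmul b x => simp [TensorProduct.smul_tmul']
    | add x y hx hy => rw [smul_add, map_add, map_add, smul_add, hx, hy]

theorem nInd_injOn {i : ℕ} (hi : 2 ≤ i) {s t : ℕ} (h : nInd s i = nInd t i) : s = t := by
  unfold nInd at h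
  have h2 : 0 < i / 2 := Nat.div_pos hi two_pos
  exact Nat.eq_of_mul_eq_mul_right h2 (by omega)

theorem nInd_succ {s : ℕ} (hs : 2 ≤ s) (i : ℕ) : nInd s (i + 1) = jump s (i + 1) + nInd s i := by
  unfold nInd jump
  obtain ⟨m, rfl | rfl⟩ := i.even_or_odd'
  · rw [if_neg (by rw [Nat.not_even_iff_odd]; exact ⟨m, rfl⟩)]
    rw [show (2 * m + 1) / 2 = m by omega, show 2 * m / 2 = m by omega]
    omega
  · rw [if_pos ⟨m + 1, by ring⟩]
    rw [show (2 * m + 1 + 1) / 2 = m + 1 by omega, show (2 * m + 1) / 2 = m by omega, mul_add]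
    omega

/-- Two consecutive differentials move `s` letters in total. -/
theorem jump_add_jump {s : ℕ} (hs : 2 ≤ s) (i : ℕ) : jump s (i + 1) + jump s i = s := by
  unfold jump
  by_cases h : Even i
  · rw [if_neg (by simpa [Nat.even_add_one] using h), if_pos h]
    omega
  · rw [if_pos (by simpa [Nat.even_add_one] using h), if_neg h]
    omega

theorem jump_pos {s : ℕ} (hs : 2 ≤ s) (i : ℕ) : jump s i ≠ 0 := by
  unfold jump
  split_ifs <;> omega

theorem jump_lt {s : ℕ} (hs : 2 ≤ s) (i : ℕ) : jump s i < s := by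
  unfold jump
  split_ifs <;> omega

theorem le_nInd {s i : ℕ} (hi : 2 ≤ i) : s ≤ nInd s i := by
  unfold nInd
  have h2 : 0 < i / 2 := Nat.div_pos hi two_pos
  exact (Nat.le_mul_of_pos_right s h2).trans (Nat.le_add_right _ _)

/-- On words of length `n_s(i)`, the differential moves `n_s(i) - n_s(i-1)` letters. -/
theorem deltaL_eq {s : ℕ} (hs : s ∈ D.S) : ∀ i, ∀ z ∈ D.extend (tpow k V (nInd s (i + 1))),
    D.deltaL (i + 1) z = (D.shiftL ^ jump s (i + 1)) z
  | 0, z, _ => by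
    change D.shiftL z = _
    rw [show jump s (0 + 1) = 1 from rfl, pow_one]
  | i + 1, z, hz => by
    refine (D.extend_le fun a x hx => ?_ : D.extend (tpow k V (nInd s (i + 2))) ≤
      LinearMap.eqLocus (D.deltaL (i + 2)) (D.shiftL ^ jump s (i + 2))) hz
    change D.deltaL (i + 2) _ = _
    simp only [deltaL, LinearMap.sum_apply, LinearMap.comp_apply, LinearMap.lTensor_tmul]
    rw [Finset.sum_eq_single_of_mem s hs, projDeg_of_mem hx]
    intro t _ hts
    rw [projDeg_of_mem_ne hx fun h => hts (nInd_injOn (by omega) h).symm, TensorProduct.tmul_zero,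
      map_zero]

theorem Jcomp_le_mul {s i : ℕ} : Jcomp D s i ≤ D.R s * tpow k V (nInd s i - s) := by
  refine (iInf₂_le 0 (Finset.mem_range.2 (Nat.succ_pos _))).trans_eq ?_
  rw [tpow_zero_mul, Nat.sub_zero]

theorem Jcomp_le_tpow {s i : ℕ} (hs : s ∈ D.S) (hi : 2 ≤ i) :
    Jcomp D s i ≤ tpow k V (nInd s i) := by
  refine D.Jcomp_le_mul.trans ((mul_le_mul' (D.R_le s hs) le_rfl).trans_eq ?_)
  rw [tpow_mul_tpow, Nat.add_sub_cancel' (le_nInd hi)]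

theorem Jcomp_le_jump_mul [FiniteDimensional k V] {s i : ℕ} (hs : s ∈ D.S) (hi : 2 ≤ i) :
    Jcomp D s (i + 1) ≤ tpow k V (jump s (i + 1)) * Jcomp D s i := by
  intro x hx
  have e : Jcomp D s i = ⨅ j : Finset.range (nInd s i - s + 1),
      tpow k V (j : ℕ) * D.R s * tpow k V (nInd s i - s - j) := by
    unfold Jcomp
    rw [iInf_subtype']
  have : Nonempty (Finset.range (nInd s i - s + 1)) :=
    ⟨⟨0, Finset.mem_range.2 (Nat.succ_pos _)⟩⟩
  have hn := nInd_succ (D.two_le s hs) i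
  have hl := le_nInd (s := s) hi
  rw [e]
  refine mem_tpow_mul_iInf _ fun j => ?_
  have hj := Finset.mem_range.1 j.2
  have h1 := (Submodule.mem_iInf _).1 ((Submodule.mem_iInf _).1 hx (jump s (i + 1) + j))
    (Finset.mem_range.2 (by omega))
  rw [← tpow_mul_tpow, mul_assoc, mul_assoc] at h1
  rw [mul_assoc]
  rwa [show nInd s (i + 1) - s - (jump s (i + 1) + j) = nInd s i - s - j by omega] at h1

theorem Jcomp_two {s : ℕ} : Jcomp D s 2 = D.R s := by
  have h : nInd s 2 = s := by simp [nInd]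
  simp [Jcomp, h]

theorem Jcomp_le_J {s i : ℕ} (hs : s ∈ D.S) (hi : 2 ≤ i) : Jcomp D s i ≤ D.J i := by
  obtain ⟨i, rfl⟩ := Nat.exists_eq_add_of_le' hi
  exact le_iSup₂_of_le s hs le_rfl

/-- The letters moved by the differential leave a word of the preceding term. -/
theorem Jcomp_le_jump_mul_J [FiniteDimensional k V] {s i : ℕ} (hs : s ∈ D.S) (hi : 1 ≤ i) :
    Jcomp D s (i + 1) ≤ tpow k V (jump s (i + 1)) * (D.J i ⊓ tpow k V (nInd s i)) := by
  by_cases h : i = 1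
  · subst h
    rw [Jcomp_two, J, inf_eq_left.2 (by simp [nInd]), tpow_mul_tpow]
    have : jump s (1 + 1) + 1 = s := jump_add_jump (D.two_le s hs) 1
    rw [this]
    exact D.R_le s hs
  · exact (D.Jcomp_le_jump_mul hs (by omega)).trans (mul_le_mul' le_rfl
      (le_inf (D.Jcomp_le_J hs (by omega)) (D.Jcomp_le_tpow hs (by omega))))

theorem isHomog_J : ∀ i, IsHomog (D.J i)
  | 0 => isHomog_of_le le_rfl
  | 1 => isHomog_of_le le_rfl
  | _ + 2 => isHomog_iSup fun _ => isHomog_iSup fun hs =>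
    isHomog_of_le (D.Jcomp_le_tpow hs (by omega))

/-- To check a property of `A ⊗ J_i` for `i ≥ 2`, it suffices to consider the `A ⊗ J_i^s`. -/
theorem KL_le {i : ℕ} {Y : Submodule k (D.Alg ⊗[k] TensorAlgebra k V)}
    (h : ∀ s ∈ D.S, ∀ a, ∀ x ∈ Jcomp D s (i + 2), D.quot a ⊗ₜ[k] x ∈ Y) : D.KL (i + 2) ≤ Y := by
  refine D.extend_le fun a x hx => ?_
  refine (iSup₂_le fun s hs x hx => h s hs a x hx :
    D.J (i + 2) ≤ Y.comap (TensorProduct.mk k D.Alg _ (D.quot a))) hx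

theorem deltaL_mem_augSpan [FiniteDimensional k V] : ∀ i, ∀ z ∈ D.KL (i + 1),
    D.deltaL (i + 1) z ∈ augSpan D.aug (D.KL i)
  | 0, z, hz => by
    refine (D.extend_le fun a x hx => ?_ : D.KL 1 ≤
      (augSpan D.aug (D.KL 0)).comap (D.deltaL 1)) hz
    have := D.shiftL_pow_tmul_mem one_ne_zero (D.quot a) (x := x) (X := tpow k V 0)
      (by rw [mul_tpow_zero]; exact hx)
    rwa [pow_one] at this
  | i + 1, z, hz => by
    refine (D.KL_le fun s hs a x hx => ?_ : D.KL (i + 2) ≤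
      (augSpan D.aug (D.KL (i + 1))).comap (D.deltaL (i + 2))) hz
    change D.deltaL (i + 2) _ ∈ augSpan D.aug (D.KL (i + 1))
    rw [D.deltaL_eq hs (i + 1) _ (D.tmul_mem_extend _ (D.Jcomp_le_tpow hs (by omega) hx))]
    exact augSpan_mono (D.extend_mono inf_le_left) (D.shiftL_pow_tmul_mem
      (jump_pos (D.two_le s hs) _) (D.quot a) (D.Jcomp_le_jump_mul_J hs (by omega) hx))

theorem augSpan_extend_le (X : Submodule k (TensorAlgebra k V)) :
    augSpan D.aug (D.extend X) ≤ D.extend X :=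
  augSpan_le fun a _ _ hx => D.smul_mem_extend a hx

theorem deltaL_deltaL [FiniteDimensional k V] (i : ℕ) : ∀ z ∈ D.KL (i + 2),
    D.deltaL (i + 1) (D.deltaL (i + 2) z) = 0 := by
  intro z hz
  refine (D.KL_le fun s hs a x hx => ?_ : D.KL (i + 2) ≤
    LinearMap.ker (D.deltaL (i + 1) ∘ₗ D.deltaL (i + 2))) hz
  change D.deltaL (i + 1) (D.deltaL (i + 2) _) = 0
  have h2 := D.two_le s hs
  rw [D.deltaL_eq hs (i + 1) _ (D.tmul_mem_extend _ (D.Jcomp_le_tpow hs (by omega) hx))]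
  rw [D.deltaL_eq hs i]
  · rw [← Module.End.mul_apply, ← pow_add]
    have e : jump s (i + 1) + jump s (i + 2) = s := by
      rw [add_comm]
      exact jump_add_jump h2 (i + 1)
    change (D.shiftL ^ (jump s (i + 1) + jump s (i + 2))) _ = 0
    rw [e]
    -- The `s` letters moved by both differentials form a relation, which vanishes in `A`.
    refine (Submodule.mul_le.2 fun r hr y _ => ?_ : D.R s * tpow k V (nInd s (i + 2) - s) ≤
      LinearMap.ker ((D.shiftL ^ s) ∘ₗ TensorProduct.mk k D.Alg _ (D.quot a))) (D.Jcomp_le_mul hx)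
    change (D.shiftL ^ s) (_ ⊗ₜ (r * y)) = 0
    rw [shiftL_pow_tmul D _ (D.R_le s hs hr), D.quot_eq_zero_iff.2 (D.R_le_rel hs hr), mul_zero,
      TensorProduct.zero_tmul]
  · exact D.augSpan_extend_le _ (augSpan_mono (D.extend_mono inf_le_right) (D.shiftL_pow_tmul_mem
      (jump_pos h2 _) (D.quot a) (D.Jcomp_le_jump_mul_J hs (by omega) hx)))

theorem deltaL_mem_totalDeg (i : ℕ) {n : ℤ} {z : D.Alg ⊗[k] TensorAlgebra k V}
    (hz : z ∈ D.KL (i + 1)) (hn : z ∈ D.totalDeg n) : D.deltaL (i + 1) z ∈ D.totalDeg n := by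
  -- For the homogeneous component of an arbitrary `z`, pure tensors suffice.
  have key : ∀ z ∈ D.KL (i + 1), D.deltaL (i + 1) (homComp D.isInternal_totalDeg n z) ∈
      D.totalDeg n := by
    intro z hz
    have h : ∀ s a, a ≤ s → ∀ α : D.Alg, ∀ x ∈ tpow k V s, (D.shiftL ^ a)
        (homComp D.isInternal_totalDeg n (α ⊗ₜ x)) ∈ D.totalDeg n := by
      intro s a has α x hx
      induction α using graded_induction D.iSup_grading with
      | hom p α hα =>
        have hm := D.tmul_mem_totalDeg rfl hα hx
        by_cases hpn : ((p + s : ℕ) : ℤ) = n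
        · subst hpn
          rw [homComp_of_mem _ hm]
          have := D.shiftL_pow_mem_totalDeg (a := a) (q := s - a) hα
            (by rwa [Nat.add_sub_cancel' has])
          rwa [Nat.add_sub_cancel' has] at this
        · rw [homComp_of_mem_ne _ hpn hm, map_zero]
          exact zero_mem _
      | add α β hα hβ => rw [TensorProduct.add_tmul, map_add, map_add]; exact add_mem hα hβ
    obtain _ | i := i
    · refine (D.extend_le fun a x hx => ?_ : D.KL 1 ≤ (D.totalDeg n).comap
        (D.deltaL 1 ∘ₗ homComp D.isInternal_totalDeg n)) hz
      have := h 1 1 le_rfl (D.quot a) x hx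
      rwa [pow_one] at this
    · refine (D.KL_le fun s hs a x hx => ?_ : D.KL (i + 2) ≤ (D.totalDeg n).comap
        (D.deltaL (i + 2) ∘ₗ homComp D.isInternal_totalDeg n)) hz
      have hx := D.Jcomp_le_tpow hs (by omega) hx
      change D.deltaL (i + 2) _ ∈ D.totalDeg n
      rw [D.deltaL_eq hs (i + 1) _ (D.homComp_mem_extend (isHomog_of_le le_rfl) n
        (D.tmul_mem_extend _ hx))]
      refine h (nInd s (i + 2)) _ ?_ (D.quot a) x hx
      have := nInd_succ (D.two_le s hs) (i + 1)
      change nInd s (i + 2) = jump s (i + 2) + nInd s (i + 1) at this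
      change jump s (i + 2) ≤ _
      omega
  have := key z hz
  rwa [homComp_of_mem _ hn] at this

theorem augL_tmul (a : D.Alg) (x : TensorAlgebra k V) :
    D.augL (a ⊗ₜ x) = D.aug a * algebraMapInv x := by
  simp [augL]

theorem augL_smul (a : D.Alg) (z : D.Alg ⊗[k] TensorAlgebra k V) :
    D.augL (a • z) = D.aug a * D.augL z := by
  induction z using TensorProduct.induction_on with
  | zero => simp
  | tmul b x => rw [TensorProduct.smul_tmul', augL_tmul, augL_tmul, smul_eq_mul, map_mul,
      mul_assoc]
  | add x y hx hy => rw [smul_add, map_add, map_add, mul_add, hx, hy]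

theorem augL_eq_zero {n : ℤ} {x : D.Alg ⊗[k] TensorAlgebra k V} (hx : x ∈ D.KL 0)
    (hxn : x ∈ D.totalDeg n) (hn : n ≠ 0) : D.augL x = 0 := by
  -- For the homogeneous component of an arbitrary element, pure tensors suffice.
  have h1 : ∀ x ∈ D.KL 0, D.augL (homComp D.isInternal_totalDeg n x) = 0 := by
    intro x hx
    refine (D.extend_le fun a x hx => ?_ : D.KL 0 ≤ LinearMap.ker
      (D.augL ∘ₗ homComp D.isInternal_totalDeg n)) hx
    change D.augL (homComp D.isInternal_totalDeg n _) = 0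
    generalize D.quot a = α
    induction α using graded_induction D.iSup_grading with
    | hom p α hα =>
      have hm := D.tmul_mem_totalDeg rfl hα hx
      by_cases hpn : ((p + 0 : ℕ) : ℤ) = n
      · subst hpn
        rw [homComp_of_mem _ hm, augL_tmul, D.aug_eq_zero_of_mem (by omega) hα, zero_mul]
      · rw [homComp_of_mem_ne _ hpn hm, map_zero]
    | add α β hα hβ => rw [TensorProduct.add_tmul, map_add, map_add, hα, hβ, add_zero]
  have := h1 x hx
  rwa [homComp_of_mem _ hxn] at this

/-- The term `A ⊗ J_i` of the Koszul complex is free, hence projective, as an `A`-module. -/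
theorem projective_KL (i : ℕ) : Module.Projective D.Alg
    ↥({ D.KL i with smul_mem' := fun a _ hz => D.smul_mem_extend a hz } :
      Submodule D.Alg (D.Alg ⊗[k] TensorAlgebra k V)) := by
  let f : D.Alg ⊗[k] ↥(D.J i) →ₗ[D.Alg]
      ↥({ D.KL i with smul_mem' := fun a _ hz => D.smul_mem_extend a hz } :
      Submodule D.Alg (D.Alg ⊗[k] TensorAlgebra k V)) :=
    (TensorProduct.AlgebraTensorModule.lTensor D.Alg D.Alg (D.J i).subtype).codRestrict _
      fun x => ⟨x, rfl⟩
  have hf : Function.Bijective f := by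
    constructor
    · intro x y hxy
      exact Module.Flat.lTensor_preserves_injective_linearMap (M := D.Alg) (D.J i).subtype
        Subtype.val_injective (congrArg Subtype.val hxy)
    · rintro ⟨_, x, rfl⟩
      exact ⟨x, rfl⟩
  exact Module.Projective.of_equiv (LinearEquiv.ofBijective f hf)

theorem augL_surjective (c : k) : ∃ x ∈ D.KL 0, D.augL x = c := by
  refine ⟨1 ⊗ₜ algebraMap k _ c, D.tmul_mem_extend 1 ?_, ?_⟩
  · rw [J, tpow, pow_zero]
    exact Submodule.mem_one.2 ⟨c, rfl⟩
  · rw [augL_tmul, map_one, one_mul, AlgHom.commutes]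
    rfl

theorem augL_augSpan {X : Submodule k (D.Alg ⊗[k] TensorAlgebra k V)}
    {z : D.Alg ⊗[k] TensorAlgebra k V} (hz : z ∈ augSpan D.aug X) : D.augL z = 0 := by
  refine (augSpan_le fun a ha x _ => ?_ : augSpan D.aug X ≤ LinearMap.ker D.augL) hz
  rw [LinearMap.mem_ker, augL_smul, ha, zero_mul]

theorem deltaL_mem [FiniteDimensional k V] (i : ℕ) {z : D.Alg ⊗[k] TensorAlgebra k V}
    (hz : z ∈ D.KL (i + 1)) : D.deltaL (i + 1) z ∈ D.KL i :=
  D.augSpan_extend_le _ (D.deltaL_mem_augSpan i z hz)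

/-- The left multi-Koszul complex. -/
def koszul [FiniteDimensional k V] : EmbeddedComplex D.grading D.aug D.totalDeg where
  isInternal := D.isInternal_totalDeg
  smul_mem _ _ _ _ ha hx := D.smul_mem_totalDeg ha hx
  K := D.KL
  smul_mem_K _ a _ hx := D.smul_mem_extend a hx
  homComp_mem i n _ hx := D.homComp_mem_extend (D.isHomog_J i) n hx
  projective := D.projective_KL
  d i := D.deltaL (i + 1)
  d_smul i := D.deltaL_smul (i + 1)
  d_mem i _ hx := D.deltaL_mem i hx
  d_deg i _ _ hx hn := D.deltaL_mem_totalDeg i hx hn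
  aug := D.augL
  aug_smul := D.augL_smul
  aug_eq_zero _ _ hx hxn hn := D.augL_eq_zero hx hxn hn
  aug_surjective := D.augL_surjective
  aug_d x hx := D.augL_augSpan (D.deltaL_mem_augSpan 0 x hx)
  d_d := D.deltaL_deltaL

theorem isLeftMultiKoszul_iff [FiniteDimensional k V] :
    D.IsLeftMultiKoszul ↔ ∀ i, D.koszul.toComplex.ExactAt i := by
  constructor
  · rintro ⟨-, h, h'⟩ i
    obtain _ | i := i
    · exact D.koszul.exactAt_zero_iff.2 h
    · exact (D.koszul.exactAt_succ_iff i).2 (h' (i + 1) (by omega))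
  · intro h
    refine ⟨?_, D.koszul.exactAt_zero_iff.1 (h 0), ?_⟩
    · rw [eq_top_iff]
      rintro c -
      obtain ⟨x, hx⟩ := D.augL_surjective c
      exact ⟨x, hx⟩
    · intro i hi
      obtain ⟨i, rfl⟩ := Nat.exists_eq_add_of_le' hi
      exact (D.koszul.exactAt_succ_iff i).1 (h (i + 1))

end MultiHomogeneous

end Koszul

/-! ### Minimality of the Koszul complex -/

section Minimality

variable {k : Type u} [Field k] {V : Type v} [AddCommGroup V] [Module k V]

open TensorAlgebra (ι algebraMapInv)

theorem projDeg_mul {m : ℕ} (p : ℕ) (x : TensorAlgebra k V) {y : TensorAlgebra k V}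
    (hy : y ∈ tpow k V m) : projDeg k V (p + m) (x * y) = projDeg k V p x * y := by
  induction x using tensorAlgebra_induction with
  | hom q x hx =>
    by_cases hq : q = p
    · subst hq
      rw [projDeg_of_mem hx, projDeg_of_mem (mul_mem_tpow hx hy)]
    · rw [projDeg_of_mem_ne hx hq, projDeg_of_mem_ne (mul_mem_tpow hx hy) (by omega), zero_mul]
  | add x x' hx hx' => rw [add_mul, map_add, map_add, add_mul, hx, hx']

theorem projDeg_mul_of_lt {m n : ℕ} (h : n < m) (x : TensorAlgebra k V) {y : TensorAlgebra k V}
    (hy : y ∈ tpow k V m) : projDeg k V n (x * y) = 0 := by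
  induction x using tensorAlgebra_induction with
  | hom q x hx => exact projDeg_of_mem_ne (mul_mem_tpow hx hy) (by omega)
  | add x x' hx hx' => rw [add_mul, map_add, hx, hx', add_zero]

theorem projDeg_zero_eq_zero {x : TensorAlgebra k V} (hx : x ∈ augIdeal k V) :
    projDeg k V 0 x = 0 := by
  refine (iSup_le fun n x hx => projDeg_of_mem_ne hx n.succ_ne_zero :
    ⨆ n, tpow k V (n + 1) ≤ LinearMap.ker (projDeg k V 0)) (augIdeal_le hx)

namespace MultiHomogeneous

variable (D : MultiHomogeneous k V)

/-- The map `a ⊗ x ↦ ã_p x_q`, where `ã_p` is the degree `p` part of a lift of `a` to `T(V)`, which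
is well defined modulo the relations of degree `p`. -/
def liftMul (p q : ℕ) :
    D.Alg ⊗[k] TensorAlgebra k V →ₗ[k] TensorAlgebra k V ⧸ D.relDeg p * tpow k V q :=
  TensorProduct.lift (descend D.quot.toLinearMap D.quot_surjective
    (((LinearMap.mul k (TensorAlgebra k V)).compl₁₂ (projDeg k V p) (projDeg k V q)).compr₂
      (D.relDeg p * tpow k V q).mkQ) fun t ht => by
        ext x
        refine (Submodule.Quotient.mk_eq_zero _).2 (Submodule.mul_mem_mul ?_ (projDeg_mem q x))
        exact D.projDeg_mem_relDeg (D.quot_eq_zero_iff.1 ht) p)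

theorem liftMul_tmul (p q : ℕ) (t x : TensorAlgebra k V) : D.liftMul p q (D.quot t ⊗ₜ x) =
    Submodule.Quotient.mk (projDeg k V p t * projDeg k V q x) := by
  rw [liftMul, TensorProduct.lift.tmul]
  exact LinearMap.congr_fun (descend_apply D.quot.toLinearMap D.quot_surjective _ _ t) x

/-- Moving `c` letters into `A` and multiplying them back recovers the word, if the number `m` of
remaining letters is the one seen by `liftMul`. -/
theorem liftMul_shiftL {p q c m : ℕ} (t : TensorAlgebra k V) {x : TensorAlgebra k V}
    (hx : x ∈ tpow k V (c + m)) : D.liftMul p q ((D.shiftL ^ c) (D.quot t ⊗ₜ x)) =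
      if m = q then Submodule.Quotient.mk (projDeg k V (p + q) (t * x)) else 0 := by
  rw [← tpow_mul_tpow] at hx
  induction hx using Submodule.mul_induction_on' with
  | mem_mul_mem x hx y hy =>
    rw [shiftL_pow_tmul D _ hx, ← map_mul, liftMul_tmul]
    split_ifs with h
    · subst h
      rw [projDeg_of_mem hy, ← mul_assoc, projDeg_mul p _ hy]
    · rw [projDeg_of_mem_ne hy h, mul_zero, Submodule.Quotient.mk_zero]
  | add x _ y _ hx hy =>
    rw [TensorProduct.tmul_add, map_add, map_add, hx, hy, mul_add, map_add]
    split_ifs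
    · rfl
    · rw [add_zero]

theorem augSpan_extend_le_of {X : Submodule k (TensorAlgebra k V)}
    {Y : Submodule k (D.Alg ⊗[k] TensorAlgebra k V)}
    (h : ∀ t ∈ augIdeal k V, ∀ x ∈ X, D.quot t ⊗ₜ[k] x ∈ Y) :
    augSpan D.aug (D.extend X) ≤ Y := by
  refine augSpan_le fun a ha z hz => ?_
  obtain ⟨t, rfl⟩ := D.quot_surjective a
  refine (D.extend_le fun s x hx => ?_ : D.extend X ≤
    Y.comap (DistribSMul.toLinearMap k _ (D.quot t))) hz
  change D.quot t • D.quot s ⊗ₜ[k] x ∈ Y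
  rw [TensorProduct.smul_tmul', smul_eq_mul, ← map_mul]
  exact h _ (mul_mem_augIdeal_left ha s) x hx

theorem augL_eq (z : D.Alg ⊗[k] TensorAlgebra k V) : D.augL z = algebraMapInv (D.augFst z) := by
  induction z using TensorProduct.induction_on with
  | zero => simp
  | tmul a x => rw [augL_tmul, augFst_tmul, map_smul, smul_eq_mul]
  | add x y hx hy => rw [map_add, map_add, map_add, hx, hy]

theorem augFst_eq_zero_of_augL {z : D.Alg ⊗[k] TensorAlgebra k V} (hz : z ∈ D.KL 0)
    (h : D.augL z = 0) : D.augFst z = 0 := by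
  have hw := D.augFst_mem hz
  rw [J, tpow, pow_zero] at hw
  obtain ⟨c, hc⟩ := Submodule.mem_one.1 hw
  rw [augL_eq, ← hc, AlgHom.commutes] at h
  have h : c = 0 := h
  rw [← hc, h, map_zero]

theorem relDeg_one : D.relDeg 1 = ⊥ := by
  refine eq_bot_iff.2 (iSup₂_le fun t ht => ?_)
  have h := Finset.mem_filter.1 ht
  have := D.two_le t h.1
  omega

theorem augFst_eq_zero_of_deltaL_one {z : D.Alg ⊗[k] TensorAlgebra k V} (hz : z ∈ D.KL 1)
    (h : D.deltaL 1 z = 0) : D.augFst z = 0 := by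
  have hw : D.augFst z ∈ tpow k V 1 := D.augFst_mem hz
  have key : ∀ t, ∀ x ∈ tpow k V 1, D.liftMul 1 0 (D.deltaL 1 (D.quot t ⊗ₜ x)) =
      Submodule.Quotient.mk (projDeg k V 1 (t * x)) := by
    intro t x hx
    have := D.liftMul_shiftL (p := 1) (q := 0) (c := 1) (m := 0) t hx
    rwa [if_pos rfl, pow_one] at this
  have h2 := (D.augSpan_extend_le_of fun t ht x hx => by
    rw [LinearMap.mem_ker, LinearMap.comp_apply, key t x hx, ← zero_add 1, projDeg_mul 0 t hx,
      projDeg_zero_eq_zero ht, zero_mul, Submodule.Quotient.mk_zero] :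
    augSpan D.aug (D.KL 1) ≤ LinearMap.ker (D.liftMul 1 0 ∘ₗ D.deltaL 1)) (D.sub_augFst_mem hz)
  rw [LinearMap.mem_ker, LinearMap.comp_apply, map_sub, h, zero_sub, map_neg, neg_eq_zero,
    ← map_one D.quot, key 1 _ hw, one_mul, projDeg_of_mem hw, Submodule.Quotient.mk_eq_zero,
    relDeg_one, Submodule.bot_mul] at h2
  exact h2

theorem projDeg_mem_Jcomp {s i : ℕ} (hs : s ∈ D.S) {w : TensorAlgebra k V}
    (hw : w ∈ D.J (i + 2)) : projDeg k V (nInd s (i + 2)) w ∈ Jcomp D s (i + 2) := by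
  refine (iSup₂_le fun t ht x hx => ?_ :
    D.J (i + 2) ≤ (Jcomp D s (i + 2)).comap (projDeg k V (nInd s (i + 2)))) hw
  change projDeg k V (nInd s (i + 2)) x ∈ Jcomp D s (i + 2)
  have hx' := D.Jcomp_le_tpow ht (by omega) hx
  by_cases hts : t = s
  · subst hts
    rwa [projDeg_of_mem hx']
  · rw [projDeg_of_mem_ne hx' fun h => hts (nInd_injOn (by omega) h)]
    exact zero_mem _

/-- A cycle of the Koszul complex is decomposable. This is where the minimality of the relations
enters. With `w = (ε ⊗ 1) z` and `n = n_s(i+2)`, lifting the equation `δ z = 0` to degree `n` of the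
tensor algebra shows that the component `w_n ∈ R_s ⊗ V^(n-s)` lies in `I_a ⊗ V^(n-a)`, where
`a < s` is the number of letters moved, up to terms `V^(s-t) ⊗ R_t ⊗ V^(n-s)` with `t < s`. -/
theorem augFst_eq_zero_of_deltaL [FiniteDimensional k V] (i : ℕ)
    {z : D.Alg ⊗[k] TensorAlgebra k V} (hz : z ∈ D.KL (i + 2)) (h : D.deltaL (i + 2) z = 0) :
    D.augFst z = 0 := by
  have hw := D.augFst_mem hz
  suffices h0 : ∀ m, projDeg k V m (D.augFst z) ∈ (⊥ : Submodule k (TensorAlgebra k V)) from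
    mem_of_projDeg_mem h0
  intro m
  -- Only the degrees `n_s(i+2)` occur in `J_{i+2}`.
  by_cases hm : ∃ s ∈ D.S, nInd s (i + 2) = m
  swap
  · refine (iSup₂_le fun t ht x hx => ?_ : D.J (i + 2) ≤
      (⊥ : Submodule k (TensorAlgebra k V)).comap (projDeg k V m)) hw
    exact projDeg_of_mem_ne (D.Jcomp_le_tpow ht (by omega) hx) fun h => hm ⟨t, ht, h⟩
  obtain ⟨s, hs, rfl⟩ := hm
  have h2 := D.two_le s hs
  set a := jump s (i + 2)
  set b := nInd s (i + 1)
  set Y := (⨆ t ∈ D.S.filter (fun t => t < s), tpow k V (s - t) * D.R t) *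
    tpow k V (nInd s (i + 2) - s)
  have hn : nInd s (i + 2) = a + b := nInd_succ h2 (i + 1)
  have key : ∀ t ∈ D.S, ∀ u, ∀ x ∈ Jcomp D t (i + 2),
      D.liftMul a b (D.deltaL (i + 2) (D.quot u ⊗ₜ x)) =
        if nInd t (i + 1) = b then Submodule.Quotient.mk (projDeg k V (nInd s (i + 2)) (u * x))
        else 0 := by
    intro t ht u x hx
    have hx' := D.Jcomp_le_tpow ht (by omega) hx
    rw [D.deltaL_eq ht (i + 1) _ (D.tmul_mem_extend _ hx'), hn]
    rw [nInd_succ (D.two_le t ht) (i + 1)] at hx'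
    exact D.liftMul_shiftL u hx'
  -- On the indecomposable part `1 ⊗ w`, the lift of the differential is the component `w_n`: a word
  -- of `J_{i+2}^t` has length `n` only for `t = s`.
  have h1 : D.liftMul a b (D.deltaL (i + 2) (1 ⊗ₜ D.augFst z)) =
      Submodule.Quotient.mk (projDeg k V (nInd s (i + 2)) (D.augFst z)) := by
    refine (iSup₂_le fun t ht x hx => ?_ : D.J (i + 2) ≤ LinearMap.eqLocus
      (D.liftMul a b ∘ₗ D.deltaL (i + 2) ∘ₗ TensorProduct.mk k D.Alg _ 1)
      ((D.relDeg a * tpow k V b).mkQ ∘ₗ projDeg k V (nInd s (i + 2)))) hw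
    change D.liftMul a b (D.deltaL (i + 2) (1 ⊗ₜ x)) =
      Submodule.Quotient.mk (projDeg k V (nInd s (i + 2)) x)
    rw [← map_one D.quot, key t ht 1 x hx, one_mul]
    split_ifs with htb
    · rfl
    · rw [projDeg_of_mem_ne (D.Jcomp_le_tpow ht (by omega) hx), Submodule.Quotient.mk_zero]
      intro hts
      rw [nInd_injOn (by omega) hts] at htb
      exact htb rfl
  -- On the decomposable part, the lift of the differential takes values in `Y`.
  have h3 := (D.augSpan_extend_le_of fun u hu x hx => (iSup₂_le fun t ht x hx => ?_ :
      D.J (i + 2) ≤ (Y.map (D.relDeg a * tpow k V b).mkQ).comap (D.liftMul a b ∘ₗ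
        D.deltaL (i + 2) ∘ₗ TensorProduct.mk k D.Alg _ (D.quot u))) hx :
    augSpan D.aug (D.KL (i + 2)) ≤ (Y.map (D.relDeg a * tpow k V b).mkQ).comap
      (D.liftMul a b ∘ₗ D.deltaL (i + 2))) (D.sub_augFst_mem hz)
  · rw [Submodule.mem_comap, LinearMap.comp_apply, map_sub, h, zero_sub, map_neg,
      Submodule.neg_mem_iff, h1] at h3
    obtain ⟨y, hy, hyw⟩ := h3
    have hw' : projDeg k V (nInd s (i + 2)) (D.augFst z) ∈ D.relDeg a * tpow k V b ⊔ Y := by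
      have := (Submodule.Quotient.eq _).1 hyw
      rw [← sub_sub_self y (projDeg k V (nInd s (i + 2)) (D.augFst z))]
      exact sub_mem (Submodule.mem_sup_right hy) (Submodule.mem_sup_left this)
    have hl := le_nInd (s := s) (i := i + 2) (by omega)
    have hj : a < s := jump_lt h2 _
    have hd := mul_tpow_disjoint (D.R_disjoint hs hj) (nInd s (i + 2) - s)
    rw [Submodule.sup_mul, mul_assoc, tpow_mul_tpow,
      show s - a + (nInd s (i + 2) - s) = b by omega] at hd
    exact hd.le_bot ⟨D.Jcomp_le_mul (D.projDeg_mem_Jcomp hs hw), hw'⟩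
  · change D.liftMul a b (D.deltaL (i + 2) (D.quot u ⊗ₜ x)) ∈
      Y.map (D.relDeg a * tpow k V b).mkQ
    rw [key t ht u x hx]
    split_ifs with htb
    swap
    · exact zero_mem _
    refine ⟨_, ?_, rfl⟩
    have hx' := D.Jcomp_le_tpow ht (by omega) hx
    change projDeg k V (nInd s (i + 2)) (u * x) ∈ Y
    -- A coefficient `u` without constant term contributes in degree `n` only if `x` has smaller
    -- length `n_t(i+2) < n`. Since `n_t(i+1) = b`, this forces `i = 0`, where `b = 1` for all `t`.
    rcases lt_trichotomy (nInd t (i + 2)) (nInd s (i + 2)) with hts | hts | hts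
    · obtain _ | i := i
      · have e : ∀ r, nInd r 2 = r := fun r => by simp [nInd]
        simp only [zero_add, e] at hts hx' ⊢
        simp only [Y, zero_add, e, Nat.sub_self, mul_tpow_zero]
        rw [Jcomp_two] at hx
        have := projDeg_mul (s - t) u hx'
        rw [Nat.sub_add_cancel hts.le] at this
        rw [this]
        exact Submodule.mem_iSup_of_mem t (Submodule.mem_iSup_of_mem
          (Finset.mem_filter.2 ⟨ht, hts⟩) (Submodule.mul_mem_mul (projDeg_mem _ _) hx))
      · rw [nInd_injOn (by omega) htb] at hts
        exact (lt_irrefl _ hts).elim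
    · have := projDeg_mul 0 u hx'
      rw [zero_add, hts] at this
      rw [this, projDeg_zero_eq_zero hu, zero_mul]
      exact zero_mem _
    · rw [projDeg_mul_of_lt hts u hx']
      exact zero_mem _

theorem mem_augSpan_of_augFst {X : Submodule k (TensorAlgebra k V)}
    {z : D.Alg ⊗[k] TensorAlgebra k V} (hz : z ∈ D.extend X) (h : D.augFst z = 0) :
    z ∈ augSpan D.aug (D.extend X) := by
  have := D.sub_augFst_mem hz
  rwa [h, TensorProduct.tmul_zero, sub_zero] at this

theorem mem_augSpan_of_deltaL [FiniteDimensional k V] : ∀ i, ∀ z ∈ D.KL (i + 1),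
    D.deltaL (i + 1) z = 0 → z ∈ augSpan D.aug (D.KL (i + 1))
  | 0, _, hz, h => D.mem_augSpan_of_augFst hz (D.augFst_eq_zero_of_deltaL_one hz h)
  | i + 1, _, hz, h => D.mem_augSpan_of_augFst hz (D.augFst_eq_zero_of_deltaL i hz h)

theorem one_tmul_mem_totalDeg {n : ℤ} {w : TensorAlgebra k V} (hw : w ∈ tpowInt k V n) :
    1 ⊗ₜ w ∈ D.totalDeg n := by
  obtain n | n := n
  · exact D.tmul_mem_totalDeg (p := 0) (q := n) (by simp)
      ⟨1, one_mem_tpow, map_one D.quot⟩ hw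
  · rw [(Submodule.mem_bot k).1 hw, TensorProduct.tmul_zero]
    exact zero_mem _

/-- The spaces `J_{i+1}` freely generate the terms of the Koszul complex. -/
def koszulGenerators [FiniteDimensional k V] :
    D.koszul.toComplex.MinimalGenerators fun i n => ↥(D.Jdeg (i + 1) n) :=
  D.koszul.minimalGenerators D.Jdeg (TensorProduct.mk k D.Alg _ 1)
    (fun _ _ _ hw => D.tmul_mem_extend 1 hw.1)
    (fun _ _ _ hw => D.one_tmul_mem_totalDeg hw.2)
    (fun _ _ z hz hn => ⟨D.augFst z, ⟨D.augFst_mem hz, D.augFst_mem_tpowInt hn⟩,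
      D.sub_augFst_mem hz⟩)
    (fun _ _ w _ h => by
      have := D.augFst_eq_zero h
      rwa [TensorProduct.mk_apply, augFst_tmul, map_one, one_smul] at this)
    (fun _ hz h => D.mem_augSpan_of_augFst hz (D.augFst_eq_zero_of_augL hz h))
    D.mem_augSpan_of_deltaL

theorem totalDeg_of_neg {n : ℤ} (hn : n < 0) : D.totalDeg n = ⊥ :=
  eq_bot_iff.2 (D.totalDeg_le fun p q h => by omega)

theorem finiteDimensional_Jdeg [FiniteDimensional k V] (i : ℕ) (n : ℤ) :
    FiniteDimensional k (D.Jdeg i n) := by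
  have := finiteDimensional_tpowInt (k := k) (V := V) n
  exact Submodule.finiteDimensional_of_le (inf_le_right : D.Jdeg i n ≤ tpowInt k V n)

/-- The left multi-Koszul property in terms of the ideals of the Gruenberg resolution. -/
theorem isLeftMultiKoszul_iff_govorov [FiniteDimensional k V] : D.IsLeftMultiKoszul ↔
    ∀ i n, Nonempty (D.Govorov i n ≃ₗ[k] ↥(D.Jdeg (i + 1) n)) := by
  have : ∀ i n, FiniteDimensional k ↥(D.Jdeg (i + 1) n) :=
    fun i n => D.finiteDimensional_Jdeg (i + 1) n
  rw [isLeftMultiKoszul_iff, D.koszulGenerators.exactAt_iff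
    (fun m _ ha => D.aug_eq_zero_of_mem m.succ_ne_zero ha)
    (fun _ ha => D.mem_iSup_grading_of_aug_eq_zero ha) D.iSup_grading ?_
    D.gruenbergResolution.exactAt_toComplex]
  · refine forall₂_congr fun i n => ?_
    obtain ⟨e⟩ := D.govorov_equiv i n
    exact ⟨fun ⟨f⟩ => ⟨e.trans f⟩, fun ⟨f⟩ => ⟨e.symm.trans f⟩⟩
  · intro i n hn
    refine (Submodule.eq_bot_iff _).2 fun x hx => Subtype.ext ?_
    have : x.1 ∈ D.totalDeg n := hx
    rw [D.totalDeg_of_neg hn] at this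
    exact this

end MultiHomogeneous

end Minimality

/-! ### The opposite algebra -/

section Opposite

variable {k : Type u} [Field k] {V : Type v} [AddCommGroup V] [Module k V]

open TensorAlgebra (ι algebraMapInv)

theorem iSup_range_reflect {α : Type*} [CompleteLattice α] (m : ℕ) (f : ℕ → ℕ → α) :
    ⨆ j ∈ Finset.range (m + 1), f j (m - j) = ⨆ j ∈ Finset.range (m + 1), f (m - j) j := by
  apply le_antisymm <;> refine iSup₂_le fun j hj => le_iSup₂_of_le (m - j)
    (Finset.mem_range.2 (by omega)) ?_ <;>
  rw [Nat.sub_sub_self (by have := Finset.mem_range.1 hj; omega)]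

theorem iInf_range_reflect {α : Type*} [CompleteLattice α] (m : ℕ) (f : ℕ → ℕ → α) :
    ⨅ j ∈ Finset.range (m + 1), f j (m - j) = ⨅ j ∈ Finset.range (m + 1), f (m - j) j :=
  iSup_range_reflect (α := αᵒᵈ) m f

theorem revMap_pow (X : Submodule k (TensorAlgebra k V)) (n : ℕ) :
    revMap (X ^ n) = revMap X ^ n := by
  induction n with
  | zero => exact revMap_tpow 0
  | succ n ih => rw [pow_succ, pow_succ', revMap_mul, ih]

theorem subQuot_revMap_equiv (X B : Submodule k (TensorAlgebra k V)) :
    Nonempty (SubQuot X B ≃ₗ[k] SubQuot (revMap X) (revMap B)) :=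
  subQuot_equiv ((rev k V).toLinearMap ∘ₗ X.subtype) (fun x => ⟨x, x.2, rfl⟩)
    (fun x => by
      rw [mem_revMap]
      change rev k V (rev k V x) ∈ B ↔ _
      rw [rev_rev])
    (by
      rintro _ ⟨x, hx, rfl⟩
      refine ⟨⟨x, hx⟩, ?_⟩
      rw [LinearMap.comp_apply, Submodule.subtype_apply, sub_self]
      exact zero_mem _)

namespace MultiHomogeneous

variable (D : MultiHomogeneous k V)

/-- The relations of the opposite algebra: all words are reversed. -/
def op : MultiHomogeneous k V where
  S := D.S
  two_le := D.two_le
  R s := revMap (D.R s)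
  R_le s hs := by
    rw [← revMap_tpow s]
    exact revMap_mono (D.R_le s hs)
  minimal s hs := by
    have := revMap_disjoint (D.minimal s hs)
    simp only [revMap_iSup, revMap_mul, revMap_tpow, ← mul_assoc] at this
    refine this.mono_right (iSup₂_mono fun t _ => ?_)
    exact (iSup_range_reflect (s - t) fun i j => tpow k V i * revMap (D.R t) * tpow k V j).le

theorem rel_op : D.op.rel = revMap D.rel := by
  rw [rel_eq, rel_eq]
  simp only [revMap_iSup, revMap_mul, revMap_top, ← mul_assoc]
  rfl

theorem Jcomp_op (s i : ℕ) : D.op.Jcomp s i = revMap (D.Jcomp s i) := by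
  unfold Jcomp
  simp only [revMap_iInf, revMap_mul, revMap_tpow, ← mul_assoc]
  exact iInf_range_reflect (nInd s i - s) fun p q => tpow k V p * revMap (D.R s) * tpow k V q

theorem J_op : ∀ i, D.op.J i = revMap (D.J i)
  | 0 => (revMap_tpow 0).symm
  | 1 => (revMap_tpow 1).symm
  | i + 2 => by
    simp only [J, revMap_iSup, ← Jcomp_op]
    rfl

theorem Jdeg_op (i : ℕ) (n : ℤ) : D.op.Jdeg i n = revMap (D.Jdeg i n) := by
  rw [Jdeg, Jdeg, revMap_inf, revMap_tpowInt, J_op]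

theorem Jdeg_op_equiv (i : ℕ) (n : ℤ) : Nonempty (↥(D.op.Jdeg i n) ≃ₗ[k] ↥(D.Jdeg i n)) := by
  rw [Jdeg_op]
  exact ⟨((rev k V).submoduleMap _).symm⟩

/-! ### Symmetry of the Govorov formula -/

theorem chain_even : ∀ l, D.chain (2 * l) = D.rel ^ l * ⊤
  | 0 => by rw [pow_zero, one_mul]; rfl
  | l + 1 => by rw [pow_succ', mul_assoc, ← chain_even l]; rfl

theorem chain_odd : ∀ l, D.chain (2 * l + 1) = D.rel ^ l * augIdeal k V
  | 0 => by rw [pow_zero, one_mul]; rfl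
  | l + 1 => by rw [pow_succ', mul_assoc, ← chain_odd l]; rfl

theorem top_mul_rel_pow (l : ℕ) : ⊤ * D.rel ^ l = D.rel ^ l * ⊤ :=
  (Commute.pow_right (D.top_mul_rel.trans D.rel_mul_top.symm : Commute ⊤ D.rel) l).eq

theorem top_mul_augIdeal : (⊤ : Submodule k (TensorAlgebra k V)) * augIdeal k V = augIdeal k V := by
  refine le_antisymm (Submodule.mul_le.2 fun x _ y hy => mul_mem_augIdeal_right x hy) fun x hx => ?_
  simpa using Submodule.mul_mem_mul
    (Submodule.mem_top : (1 : TensorAlgebra k V) ∈ (⊤ : Submodule k _)) hx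

theorem augIdeal_mul_top : augIdeal k V * (⊤ : Submodule k (TensorAlgebra k V)) = augIdeal k V := by
  rw [← revMap_revMap (augIdeal k V * ⊤), revMap_mul, revMap_augIdeal, revMap_top,
    top_mul_augIdeal, revMap_augIdeal]

/-- The spaces computing `Tor` by powers of the ideal of relations and of the augmentation ideal
are unchanged when all words are reversed. -/
theorem govorov_op_equiv (i : ℕ) (n : ℤ) :
    Nonempty (D.op.Govorov i n ≃ₗ[k] D.Govorov i n) := by
  obtain ⟨e⟩ := subQuot_revMap_equiv (k := k) (V := V)
    (tpowInt k V n ⊓ D.op.chain (i + 1) ⊓ augIdeal k V * D.op.chain i)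
    (augIdeal k V * D.op.chain (i + 1) ⊔ D.op.chain (i + 2))
  suffices h : revMap (D.op.chain (i + 1)) ⊓ revMap (augIdeal k V * D.op.chain i) =
      D.chain (i + 1) ⊓ augIdeal k V * D.chain i ∧
      revMap (augIdeal k V * D.op.chain (i + 1) ⊔ D.op.chain (i + 2)) =
        augIdeal k V * D.chain (i + 1) ⊔ D.chain (i + 2) by
    rw [revMap_inf, revMap_inf, revMap_tpowInt, inf_assoc (tpowInt k V n) (revMap _), h.1, h.2,
      ← inf_assoc] at e
    exact ⟨e⟩
  have hr : revMap D.op.rel = D.rel := by rw [rel_op, revMap_revMap]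
  have ht := D.top_mul_rel_pow
  obtain ⟨l, rfl | rfl⟩ := i.even_or_odd'
  -- `(I^l 𝔪 ∩ 𝔪 I^l T) / (𝔪 I^l 𝔪 + I^{l+1} T)`: reversal exchanges the terms of the intersection.
  · rw [show 2 * l + 2 = 2 * (l + 1) by ring]
    simp only [chain_even, chain_odd, revMap_sup, revMap_mul, revMap_pow, hr, revMap_top,
      revMap_augIdeal, ht]
    constructor
    · rw [inf_comm, mul_assoc, top_mul_augIdeal, ← ht, ← mul_assoc (augIdeal k V),
        augIdeal_mul_top]
    · rw [mul_assoc]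
  -- `(I^{l+1} T ∩ 𝔪 I^l 𝔪) / (𝔪 I^{l+1} T + I^{l+1} 𝔪)`: reversal exchanges the terms of the sum.
  · rw [show 2 * l + 1 + 1 = 2 * (l + 1) by ring, show 2 * l + 1 + 2 = 2 * (l + 1) + 1 by ring]
    simp only [chain_even, chain_odd, revMap_sup, revMap_mul, revMap_pow, hr, revMap_top,
      revMap_augIdeal, ht]
    constructor
    · rw [mul_assoc]
    · rw [mul_assoc, top_mul_augIdeal, ← ht, ← mul_assoc (augIdeal k V), augIdeal_mul_top,
        sup_comm]

/-! ### The right Koszul complex -/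

/-- The anti-isomorphism from `A` to the opposite algebra induced by the reversal of words. -/
def revAlg : D.Alg ≃ₗ[k] D.op.Alg :=
  Submodule.Quotient.equiv D.rel D.op.rel (rev k V) D.rel_op.symm

theorem revAlg_quot (x : TensorAlgebra k V) : D.revAlg (D.quot x) = D.op.quot (rev k V x) := rfl

theorem aug_revAlg (a : D.Alg) : D.op.aug (D.revAlg a) = D.aug a := by
  obtain ⟨x, rfl⟩ := D.quot_surjective a
  rw [revAlg_quot, aug_quot, aug_quot, algebraMapInv_rev]

/-- The reversal `T(V) ⊗ A → A° ⊗ T(V)`, which exchanges the right and the left Koszul complex. -/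
def flipRev : TensorAlgebra k V ⊗[k] D.Alg →ₗ[k] D.op.Alg ⊗[k] TensorAlgebra k V :=
  ((TensorProduct.congr (rev k V) D.revAlg).trans (TensorProduct.comm k _ _)).toLinearMap

theorem flipRev_injective : Function.Injective D.flipRev := LinearEquiv.injective _

theorem flipRev_tmul (x : TensorAlgebra k V) (a : D.Alg) :
    D.flipRev (x ⊗ₜ a) = D.revAlg a ⊗ₜ rev k V x := by
  simp [flipRev]

theorem shiftR_mul_ι_tmul (x : TensorAlgebra k V) (v : V) (a : D.Alg) :
    D.shiftR ((x * ι k v) ⊗ₜ a) = x ⊗ₜ (D.quot (ι k v) * a) := by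
  simp [shiftR, splitRight_mul_ι]

theorem flipRev_shiftR (z : TensorAlgebra k V ⊗[k] D.Alg) :
    D.flipRev (D.shiftR z) = D.op.shiftL (D.flipRev z) := by
  induction z using TensorProduct.induction_on with
  | zero => simp
  | add x y hx hy => simp only [map_add, hx, hy]
  | tmul x a =>
    obtain ⟨a, rfl⟩ := D.quot_surjective a
    induction x using tensorAlgebra_induction with
    | add x y hx hy => simp only [TensorProduct.add_tmul, map_add, hx, hy]
    | hom n x hx =>
      obtain _ | n := n
      · rw [tpow, pow_zero] at hx
        obtain ⟨c, rfl⟩ := Submodule.mem_one.1 hx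
        rw [Algebra.algebraMap_eq_smul_one, flipRev_tmul]
        simp only [shiftR, shiftL, LinearMap.comp_apply, LinearMap.lTensor_tmul,
          LinearMap.rTensor_tmul, map_smul, splitRight_one, smul_zero, TensorProduct.zero_tmul,
          map_zero]
        have : rev k V 1 = 1 := by
          simpa using rev_algebraMap (k := k) (V := V) 1
        rw [this, splitLeft_one, smul_zero, TensorProduct.tmul_zero, map_zero, map_zero]
      · rw [← tpow_mul_tpow] at hx
        induction hx using Submodule.mul_induction_on' with
        | mem_mul_mem x _ y hy =>
          rw [tpow, pow_one] at hy
          obtain ⟨v, rfl⟩ := hy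
          rw [shiftR_mul_ι_tmul, ← map_mul, flipRev_tmul, flipRev_tmul, revAlg_quot, revAlg_quot,
            rev_mul, rev_mul, rev_ι, shiftL_tmul_ι_mul, map_mul]
        | add x _ y _ hx hy => simp only [TensorProduct.add_tmul, map_add, hx, hy]

theorem flipRev_deltaR : ∀ (i : ℕ) (z : TensorAlgebra k V ⊗[k] D.Alg),
    D.flipRev (D.deltaR i z) = D.op.deltaL i (D.flipRev z)
  | 0, z => map_zero _
  | 1, z => D.flipRev_shiftR z
  | i + 2, z => by
    have hpow : ∀ n z, D.flipRev ((D.shiftR ^ n) z) = (D.op.shiftL ^ n) (D.flipRev z) := by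
      intro n
      induction n with
      | zero => exact fun _ => rfl
      | succ n ih =>
        intro z
        rw [pow_succ, pow_succ, Module.End.mul_apply, Module.End.mul_apply, ih, flipRev_shiftR]
    simp only [deltaR, deltaL, LinearMap.sum_apply, LinearMap.comp_apply, map_sum]
    refine Finset.sum_congr rfl fun s _ => ?_
    rw [hpow]
    congr 1
    induction z using TensorProduct.induction_on with
    | zero => simp
    | add x y hx hy => simp only [map_add, hx, hy]
    | tmul x a =>
      rw [LinearMap.rTensor_tmul, flipRev_tmul, flipRev_tmul, LinearMap.lTensor_tmul, projDeg_rev]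

theorem augL_flipRev (z : TensorAlgebra k V ⊗[k] D.Alg) :
    D.op.augL (D.flipRev z) = D.augR z := by
  induction z using TensorProduct.induction_on with
  | zero => simp
  | add x y hx hy => simp only [map_add, hx, hy]
  | tmul x a =>
    rw [flipRev_tmul, augL_tmul, aug_revAlg, algebraMapInv_rev]
    simp [augR, mul_comm]

theorem map_flipRev_KR (i : ℕ) : (D.KR i).map D.flipRev = D.op.KL i := by
  apply le_antisymm
  · rintro _ ⟨_, ⟨u, rfl⟩, rfl⟩
    induction u using TensorProduct.induction_on with
    | zero => simp
    | add x y hx hy => simp only [map_add]; exact add_mem hx hy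
    | tmul x a =>
      rw [LinearMap.rTensor_tmul, flipRev_tmul]
      refine D.op.tmul_mem_extend _ ?_
      rw [J_op]
      exact ⟨x, x.2, rfl⟩
  · refine D.op.extend_le fun a x hx => ?_
    rw [J_op, mem_revMap] at hx
    refine ⟨rev k V x ⊗ₜ D.quot (rev k V a), ⟨⟨_, hx⟩ ⊗ₜ D.quot (rev k V a), rfl⟩, ?_⟩
    rw [flipRev_tmul, revAlg_quot, rev_rev, rev_rev]

theorem isRightMultiKoszul_iff_op : D.IsRightMultiKoszul ↔ D.op.IsLeftMultiKoszul := by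
  let e := D.flipRev
  have key : ∀ (K L : Submodule k (TensorAlgebra k V ⊗[k] D.Alg))
      (Z : Submodule k (TensorAlgebra k V ⊗[k] D.Alg))
      (Z' : Submodule k (D.op.Alg ⊗[k] TensorAlgebra k V)) (i : ℕ),
      (∀ z, z ∈ Z ↔ e z ∈ Z') → (K ⊓ Z = L.map (D.deltaR i) ↔
        K.map e ⊓ Z' = (L.map e).map (D.op.deltaL i)) := by
    intro K L Z Z' i hZ
    have h1 : K.map e ⊓ Z' = (K ⊓ Z).map e := by
      ext x
      constructor
      · rintro ⟨⟨y, hy, rfl⟩, hy'⟩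
        exact ⟨y, ⟨hy, (hZ y).2 hy'⟩, rfl⟩
      · rintro ⟨y, ⟨hy, hy'⟩, rfl⟩
        exact ⟨⟨y, hy, rfl⟩, (hZ y).1 hy'⟩
    have h2 : (L.map e).map (D.op.deltaL i) =
        (L.map (D.deltaR i)).map e := by
      rw [← Submodule.map_comp, ← Submodule.map_comp]
      congr 1
      exact LinearMap.ext fun z => (D.flipRev_deltaR i z).symm
    rw [h1, h2, (Submodule.map_injective_of_injective D.flipRev_injective).eq_iff]
  have hker : ∀ i z, z ∈ LinearMap.ker (D.deltaR i) ↔ e z ∈ LinearMap.ker (D.op.deltaL i) := by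
    intro i z
    rw [LinearMap.mem_ker, LinearMap.mem_ker, ← flipRev_deltaR,
      map_eq_zero_iff _ D.flipRev_injective]
  have h0 : (D.KR 0).map D.augR = (D.op.KL 0).map D.op.augL := by
    rw [← map_flipRev_KR, ← Submodule.map_comp]
    congr 1
    refine LinearMap.ext fun z => (D.augL_flipRev z).symm
  unfold IsRightMultiKoszul IsLeftMultiKoszul
  rw [h0, key _ _ _ (LinearMap.ker D.op.augL) 1 fun z => by
    rw [LinearMap.mem_ker, LinearMap.mem_ker, augL_flipRev]]
  simp only [e, map_flipRev_KR]
  refine and_congr_right' (and_congr_right' (forall₂_congr fun i _ => ?_))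
  rw [key _ _ _ _ (i + 1) (hker i)]
  simp only [e, map_flipRev_KR]

end MultiHomogeneous

end Opposite

/-! ### The criterion -/

section Criterion

variable {k : Type u} [Field k] {V : Type v} [AddCommGroup V] [Module k V]

open TensorAlgebra (ι algebraMapInv)

namespace MultiHomogeneous

variable (D : MultiHomogeneous k V)

/-- `J_0` is `k`, in degree `0`. -/
theorem Jdeg_zero_equiv (n : ℤ) : Nonempty
    (SubQuot (if n = 0 then ⊤ else ⊥ : Submodule k k) ⊥ ≃ₗ[k] ↥(D.Jdeg 0 n)) := by
  have hJ : ∀ y, y ∈ D.Jdeg 0 n ↔ ∃ c ∈ (if n = 0 then ⊤ else ⊥ : Submodule k k),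
      Algebra.linearMap k (TensorAlgebra k V) c = y := by
    intro y
    constructor
    · rintro ⟨hy, hyn⟩
      have hy' : y ∈ tpow k V 0 := hy
      rw [tpow, pow_zero] at hy'
      obtain ⟨c, rfl⟩ := Submodule.mem_one.1 hy'
      by_cases hn : n = 0
      · exact ⟨c, by rw [if_pos hn]; trivial, rfl⟩
      · refine ⟨0, zero_mem _, ?_⟩
        have h1 := homComp_of_mem isInternal_tpowInt hyn
        rw [homComp_of_mem_ne isInternal_tpowInt (Ne.symm hn)
          (show algebraMap k _ c ∈ tpowInt k V 0 from hy)] at h1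
        rw [← h1, map_zero]
    · rintro ⟨c, hc, rfl⟩
      split_ifs at hc with hn
      · have : algebraMap k (TensorAlgebra k V) c ∈ tpow k V 0 := by
          rw [tpow, pow_zero]
          exact Submodule.mem_one.2 ⟨c, rfl⟩
        subst hn
        exact ⟨this, this⟩
      · rw [(Submodule.mem_bot k).1 hc, map_zero]
        exact zero_mem _
  obtain ⟨e⟩ := subQuot_equiv (X := (if n = 0 then ⊤ else ⊥ : Submodule k k)) (B := ⊥)
    (X' := D.Jdeg 0 n) (B' := ⊥)
    (Algebra.linearMap k (TensorAlgebra k V) ∘ₗ Submodule.subtype _)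
    (fun x => (hJ _).2 ⟨x, x.2, rfl⟩)
    (fun x => by
      rw [Submodule.mem_bot, Submodule.mem_bot]
      exact map_eq_zero_iff _ (FaithfulSMul.algebraMap_injective k (TensorAlgebra k V)))
    (fun y hy => by
      obtain ⟨c, hc, rfl⟩ := (hJ y).1 hy
      exact ⟨⟨c, hc⟩, sub_self _⟩)
  exact ⟨e.trans (Submodule.quotEquivOfEqBot _ (by simp))⟩

/-- The Govorov formula for `Tor` as a quotient of ideals in the tensor algebra, for any graded
projective resolution. -/
theorem tor_succ_equiv_govorov [FiniteDimensional k V]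
    (P : GradedProjectiveResolution.{u, max u v, max u v} D.grading D.aug) (i : ℕ) (n : ℤ) :
    Nonempty (P.Tor (i + 1) n ≃ₗ[k] D.Govorov i n) := by
  obtain ⟨e₁⟩ := P.tor_succ_equiv i n
  obtain ⟨e₂⟩ := GradedComplex.cycTor_equiv (C := P.toComplex)
    (C' := D.gruenbergResolution.toComplex) D.iSup_grading i
    (fun j _ => P.exactAt_toComplex j) (fun j _ => D.gruenbergResolution.exactAt_toComplex j) n
  obtain ⟨e₃⟩ := D.govorov_equiv i n
  exact ⟨(e₁.trans e₂).trans e₃.symm⟩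

/-- The condition on `Tor_0` always holds, both sides being `k` in degree `0`. -/
theorem tor_equiv_Jdeg_iff [FiniteDimensional k V]
    (P : GradedProjectiveResolution.{u, max u v, max u v} D.grading D.aug) :
    (∀ i n, Nonempty (P.Tor i n ≃ₗ[k] ↥(D.Jdeg i n))) ↔
      ∀ i n, Nonempty (D.Govorov i n ≃ₗ[k] ↥(D.Jdeg (i + 1) n)) := by
  constructor
  · intro h i n
    obtain ⟨e⟩ := h (i + 1) n
    obtain ⟨f⟩ := D.tor_succ_equiv_govorov P i n
    exact ⟨f.symm.trans e⟩
  · intro h i n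
    obtain _ | i := i
    · obtain ⟨e⟩ := P.tor_zero_equiv n
      obtain ⟨f⟩ := D.Jdeg_zero_equiv n
      exact ⟨e.trans f⟩
    · obtain ⟨e⟩ := h i n
      obtain ⟨f⟩ := D.tor_succ_equiv_govorov P i n
      exact ⟨f.trans e⟩

theorem isRightMultiKoszul_iff_govorov [FiniteDimensional k V] : D.IsRightMultiKoszul ↔
    ∀ i n, Nonempty (D.Govorov i n ≃ₗ[k] ↥(D.Jdeg (i + 1) n)) := by
  rw [isRightMultiKoszul_iff_op, isLeftMultiKoszul_iff_govorov]
  refine forall₂_congr fun i n => ?_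
  obtain ⟨e⟩ := D.govorov_op_equiv i n
  obtain ⟨f⟩ := D.Jdeg_op_equiv (i + 1) n
  exact ⟨fun ⟨g⟩ => ⟨(e.symm.trans g).trans f⟩, fun ⟨g⟩ => ⟨(e.trans g).trans f.symm⟩⟩

end MultiHomogeneous

end Criterion

end MultiKoszul

end

theorem mainTheorem2 {k : Type u} [Field k] {V : Type v} [AddCommGroup V] [Module k V]
    [FiniteDimensional k V] (D : MultiKoszul.MultiHomogeneous k V) :
    Nonempty (MultiKoszul.GradedProjectiveResolution.{u, max u v, max u v} D.grading D.aug) ∧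
    ∀ P : MultiKoszul.GradedProjectiveResolution.{u, max u v, max u v} D.grading D.aug,
      (D.IsLeftMultiKoszul ↔
        ∀ (i : ℕ) (n : ℤ), Nonempty (P.Tor i n ≃ₗ[k] ↥(D.Jdeg i n))) ∧
      (D.IsRightMultiKoszul ↔
        ∀ (i : ℕ) (n : ℤ), Nonempty (P.Tor i n ≃ₗ[k] ↥(D.Jdeg i n))) :=
  ⟨⟨D.gruenbergResolution⟩, fun P =>
    ⟨D.isLeftMultiKoszul_iff_govorov.trans (D.tor_equiv_Jdeg_iff P).symm,
      D.isRightMultiKoszul_iff_govorov.trans (D.tor_equiv_Jdeg_iff P).symm⟩⟩
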